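/- For $N\in\mathbb N$, real coefficients $K_{ijl}$ ($1\le i,j,l\le N$), an $N\times N$ real matrix $M$ and $g\in\mathbb R^N$ consider the quadratic system $$\frac{dX_i}{dt}=\sum_{j,l=1}^N K_{ijl}X_jX_l+\sum_{j=1}^N M_{ij}X_j+g_i,\qquad i=1,\dots,N, \qquad (1)$$ and the local semiflow $S^t$ that it defines on $\mathbb R^N$. The coefficients $K_{ijl}$ satisfy the *$p$-decomposition condition* if there is a set $I\subset\{1,\dots,N\}$ of $p$ indices such that for all real numbers $b_{jl}$ ($j,l\in I$) the linear system $\sum_{i\notin I}K_{ijl}u_i=b_{jl}$ ($j,l\in I$) has a solution $u=(u_i)_{i\notin I}$. Let $B^n=\{q\in\mathbb R^n:|q|\le1\}$. The system (1) *$\epsilon$-realizes* a vector field $Q$ on $B^n$ if there are a map $Z\in C^{1+r}(B^n;\mathbb R^N)$ for some $r\in(0,1)$, which is an embedding (injective, with injective derivative at every point of $B^n$), and a field $\tilde Q\in C^1(B^n;\mathbb R^n)$ with $|\tilde Q|_{C^1(B^n)}=\sup_{B^n}|\tilde Q|+\sup_{B^n}|\nabla\tilde Q|<\epsilon$, such that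 (i) the $n$-dimensional manifold $\mathcal M=Z(B^n)$ is positively invariant (solutions of (1) starting in $\mathcal M$ exist for all $t\ge0$ and remain in $\mathcal M$) and locally attracting (there is an open set $U\supset\mathcal M$ such that solutions starting in $U$ exist for all $t\ge 0$ and $\sup_{x\in U}\operatorname{dist}(S^tx,\mathcal M)\to0$ as $t\to\infty$); (ii) the restriction of $S^t$ to $\mathcal M$ is given by $dq/dt=Q(q)+\tilde Q(q)$: for every $q_0\in B^n$ there is a solution $q:[0,\infty)\to B^n$ of this equation with $q(0)=q_0$ for which $Z(q(t))$, $t\ge0$, is a solution of (1). **Proposition.** For each $N$ let coefficients $K_{ijl}=K^{(N)}_{ijl}$ be fixed, and suppose that for each $N\ge6$ they satisfy the $p$-decomposition condition for some $p$ with $N/2<p^2+p\le N$. Then for each integer $n\ge0$, each $\epsilon>0$ and each vector field $Q\in C^1(B^n;\mathbb R^n)$ with $$\sup_{q\in B^n}|\nabla Q(q)|<1,\qquad Q(q)\cdot q<0\quad\text{for } |q|=1$$ (where $|\nabla Q|$ is the operator norm), there exist $N$, $M$ and $g$ such that the system (1) with the coefficients $K^{(N)}_{ijl}$ $\epsilon$-realizes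 $Q$. -/

import Mathlib

noncomputable section

/-- The closed unit ball `Bⁿ = {q : |q| ≤ 1}` of `ℝⁿ` (Euclidean norm). -/
abbrev unitBall (n : ℕ) : Set (EuclideanSpace ℝ (Fin n)) :=
  Metric.closedBall 0 1

/-- The norm of `C¹(Bⁿ)`: `sup |F| + sup |∇F|` over the closed unit ball, the gradient being
the derivative up to the boundary, measured in the operator norm. -/
def c1Norm {n m : ℕ} (F : EuclideanSpace ℝ (Fin n) → EuclideanSpace ℝ (Fin m)) : ℝ :=
  (⨆ q : unitBall n, ‖F q‖) + ⨆ q : unitBall n, ‖fderivWithin ℝ F (unitBall n) q‖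

/-- `F` is of class `C^{1+r}` on the closed unit ball for some `r ∈ (0,1)`: it is `C¹` and its
derivative is Hölder continuous with exponent `r`. -/
def IsC1Plus {n m : ℕ} (F : EuclideanSpace ℝ (Fin n) → EuclideanSpace ℝ (Fin m)) : Prop :=
  ContDiffOn ℝ 1 F (unitBall n) ∧
    ∃ r C : NNReal, 0 < r ∧ r < 1 ∧
      HolderOnWith C r (fderivWithin ℝ F (unitBall n)) (unitBall n)

/-- An embedding of the closed unit ball: an injective immersion (the ball being compact, it is a
diffeomorphism onto its image). -/
def IsBallEmbedding {n m : ℕ}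
    (Z : EuclideanSpace ℝ (Fin n) → EuclideanSpace ℝ (Fin m)) : Prop :=
  Set.InjOn Z (unitBall n) ∧
    ∀ q ∈ unitBall n, Function.Injective (fderivWithin ℝ Z (unitBall n) q)

/-- The (graph of the) local semiflow `Sᵗ` of the autonomous system `dx/dt = V x`:
`FlowsTo V t x y` says that `Sᵗ x` is defined and equals `y`, that is, the solution starting
at `x` exists on `[0,t]` and has the value `y` at time `t`. -/
def FlowsTo {m : ℕ} (V : EuclideanSpace ℝ (Fin m) → EuclideanSpace ℝ (Fin m)) (t : ℝ)
    (x y : EuclideanSpace ℝ (Fin m)) : Prop :=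
  ∃ γ : ℝ → EuclideanSpace ℝ (Fin m),
    γ 0 = x ∧ γ t = y ∧ IsIntegralCurveOn γ (fun _ => V) (Set.Icc 0 t)

/-- `S` is positively invariant: the solutions that start in `S` exist for all `t ≥ 0` and
stay in `S`. -/
def IsPositivelyInvariant {m : ℕ} (V : EuclideanSpace ℝ (Fin m) → EuclideanSpace ℝ (Fin m))
    (S : Set (EuclideanSpace ℝ (Fin m))) : Prop :=
  ∀ x ∈ S, ∀ t : ℝ, 0 ≤ t → ∃ y ∈ S, FlowsTo V t x y

/-- `S` is locally attracting: the solutions that start in some open neighbourhood `U` of `S`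
exist for all `t ≥ 0`, and the distance of `Sᵗ x` from `S` tends to `0` as `t → ∞`,
uniformly in `x ∈ U`. -/
def IsLocallyAttracting {m : ℕ} (V : EuclideanSpace ℝ (Fin m) → EuclideanSpace ℝ (Fin m))
    (S : Set (EuclideanSpace ℝ (Fin m))) : Prop :=
  ∃ U : Set (EuclideanSpace ℝ (Fin m)), IsOpen U ∧ S ⊆ U ∧
    (∀ x ∈ U, ∀ t : ℝ, 0 ≤ t → ∃ y, FlowsTo V t x y) ∧
    ∀ δ : ℝ, 0 < δ → ∃ T : ℝ, 0 ≤ T ∧ ∀ t : ℝ, T ≤ t → ∀ x ∈ U, ∀ y,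
      FlowsTo V t x y → Metric.infDist y S < δ

/-- The local semiflow of `dX/dt = V X` on `ℝᴺ` realizes the vector field `Q` on `Bⁿ` with
accuracy `ε`: there is a positively invariant, locally attracting manifold `M = Z(Bⁿ)`, embedded
by a `C^{1+r}` map `Z`, on which, in the coordinate `q ∈ Bⁿ`, the semiflow is given by
`dq/dt = Q q + Q' q` with a perturbation `Q'` of `C¹(Bⁿ)`-norm less than `ε`. -/
def EpsRealizes {n N : ℕ} (ε : ℝ)
    (Q : EuclideanSpace ℝ (Fin n) → EuclideanSpace ℝ (Fin n))
    (V : EuclideanSpace ℝ (Fin N) → EuclideanSpace ℝ (Fin N)) : Prop :=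
  ∃ (Z : EuclideanSpace ℝ (Fin n) → EuclideanSpace ℝ (Fin N))
    (Q' : EuclideanSpace ℝ (Fin n) → EuclideanSpace ℝ (Fin n)),
    IsC1Plus Z ∧ IsBallEmbedding Z ∧
    IsPositivelyInvariant V (Z '' unitBall n) ∧
    IsLocallyAttracting V (Z '' unitBall n) ∧
    ContDiffOn ℝ 1 Q' (unitBall n) ∧ c1Norm Q' < ε ∧
    ∀ q₀ ∈ unitBall n, ∃ q : ℝ → EuclideanSpace ℝ (Fin n),
      q 0 = q₀ ∧ (∀ t : ℝ, 0 ≤ t → q t ∈ unitBall n) ∧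
      IsIntegralCurveOn q (fun _ y => Q y + Q' y) (Set.Ici 0) ∧
      IsIntegralCurveOn (fun t => Z (q t)) (fun _ => V) (Set.Ici 0)

/-- The quadratic vector field `X ↦ K(X) + M X + g` on `ℝᴺ`, with
`K_i(X) = ∑ j, ∑ l, K_{ijl} X_j X_l`. -/
def quadField {N : ℕ} (K : Fin N → Fin N → Fin N → ℝ) (M : Matrix (Fin N) (Fin N) ℝ)
    (g : EuclideanSpace ℝ (Fin N)) (X : EuclideanSpace ℝ (Fin N)) :
    EuclideanSpace ℝ (Fin N) :=
  WithLp.toLp 2 fun i => (∑ j, ∑ l, K i j l * X j * X l) + (∑ j, M i j * X j) + g i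

/-- The `p`-decomposition condition: the coordinates can be split into `p` coordinates
`Y = (X_j)_{j ∈ I}` and the remaining ones `Z = (X_i)_{i ∉ I}` in such a way that the linear
system `∑ i ∉ I, K_{ijl} u_i = b_{jl}` (`j, l ∈ I`) has a solution `u` for all `b`. -/
def PDecomposition {N : ℕ} (p : ℕ) (K : Fin N → Fin N → Fin N → ℝ) : Prop :=
  ∃ I : Finset (Fin N), I.card = p ∧
    ∀ b : Fin N → Fin N → ℝ, ∃ u : Fin N → ℝ,
      ∀ j ∈ I, ∀ l ∈ I, ∑ i ∈ Iᶜ, K i j l * u i = b j l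

end

/-! The linear and constant terms are free, so linear damping of size `Λ` can be imposed on all but
`n` coordinates. The system is then slow-fast, `q' = C w + O(1/Λ)`, `w' = Λ (G(q, w) - w)`, and an
attracting slow manifold `w = h q` carries the reduced field `C (h q) + O(1/Λ)`. It remains to
choose `G` and `C` so that the reduced field is close to `Q`.

By density of polynomials in `C¹` of the ball, `Q` may be replaced by a polynomial field. A
polynomial is a linear readout of a chain of variables in which each new one is a multiple of a
coordinate `q i` times an earlier one: `y = e + s b(q) y` with `b` linear in `q`
(`exists_chain_polyField`). Both `q` and `y` are stored at indices in `I`. The fast coordinates off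
`I` relax to `κ` times the quadratic forms `K_i`, `i ∉ I`, in the coordinates of `I`. By the
decomposition condition, linear combinations of these coordinates give every bilinear form in `q`
and `y`, and the linear terms feed these combinations, times `κ`, back to the coordinates `y`
(`exists_combination_eq_bilinear`). The fast equilibrium therefore solves the chain with `s = κ ^
2`. The remaining quadratic coefficients cannot be chosen; rescaling by different powers of `1/Λ` on
and off `I` makes all of them small except the block from `I × I` to the complement of `I`
(`exists_scaled_coeff`).

The slow manifold is built by the Lyapunov-Perron method: in reversed time `w` is strongly unstable,
so for each `q₀` exactly one solution keeps `w` bounded and `q` of moderate growth, and `h q₀` is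
its `w 0` (`exists_slow_manifold`). Its Lipschitz and `C^{1,1}` bounds do not depend on `Λ`.
Closeness in `C¹` then follows by interpolation: the reduced field is within `O(1/Λ)` of the
polynomial in the sup norm, and the difference has a Lipschitz derivative with a fixed constant
(`exists_slow_manifold_near`). All regularity is carried by the three-point estimate `ThreePt`,
which passes to the manifold by comparing three trajectories, without variational equations.

The lower bound on `p ^ 2 + p` serves to make `p` as large as the number of slow and chain
variables. -/

section

/-! ### Calculus of the three-point (`C^{1,1}`) estimate. -/

open Filter Topology

/-- A derivative-free form of "`f` is `ℓ`-Lipschitz and of class `C^{1,1}`". -/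
structure ThreePt {X Y : Type*} [NormedAddCommGroup X] [NormedSpace ℝ X]
    [NormedAddCommGroup Y] [NormedSpace ℝ Y] (ℓ L : ℝ) (f : X → Y) : Prop where
  lip : ∀ a b, ‖f a - f b‖ ≤ ℓ * ‖a - b‖
  three : ∀ a b c, ‖f a + f b - (2 : ℝ) • f c‖ ≤ ℓ * ‖a + b - (2 : ℝ) • c‖ + L * ‖a - b‖ ^ 2

namespace ThreePt

variable {X Y Z : Type*} [NormedAddCommGroup X] [NormedSpace ℝ X]
  [NormedAddCommGroup Y] [NormedSpace ℝ Y] [NormedAddCommGroup Z] [NormedSpace ℝ Z]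
  {ℓ L ℓ' L' : ℝ} {f : X → Y}

theorem mono (hf : ThreePt ℓ L f) (h : ℓ ≤ ℓ') (h' : L ≤ L') : ThreePt ℓ' L' f where
  lip a b := (hf.lip a b).trans (by gcongr)
  three a b c := (hf.three a b c).trans (by gcongr)

theorem continuous (hf : ThreePt ℓ L f) : Continuous f := by
  have : LipschitzWith ℓ.toNNReal f := LipschitzWith.of_dist_le' fun a b => by
    simpa [dist_eq_norm] using hf.lip a b
  exact this.continuous

theorem const (y : Y) : ThreePt 0 0 (fun _ : X => y) where
  lip a b := by simp
  three a b c := by simp [two_smul]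

theorem clm (T : X →L[ℝ] Y) : ThreePt ‖T‖ 0 T where
  lip a b := by rw [← map_sub]; exact T.le_opNorm _
  three a b c := by
    rw [← map_add, ← map_smul, ← map_sub, zero_mul, add_zero]; exact T.le_opNorm _

theorem add {g : X → Y} (hf : ThreePt ℓ L f) (hg : ThreePt ℓ' L' g) :
    ThreePt (ℓ + ℓ') (L + L') (fun x => f x + g x) where
  lip a b := by
    have := norm_add_le (f a - f b) (g a - g b)
    rw [show f a + g a - (f b + g b) = f a - f b + (g a - g b) by abel]
    linarith [hf.lip a b, hg.lip a b]
  three a b c := by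
    have := norm_add_le (f a + f b - (2 : ℝ) • f c) (g a + g b - (2 : ℝ) • g c)
    rw [show f a + g a + (f b + g b) - (2 : ℝ) • (f c + g c) =
      f a + f b - (2 : ℝ) • f c + (g a + g b - (2 : ℝ) • g c) by rw [smul_add]; abel]
    linarith [hf.three a b c, hg.three a b c]

theorem smul (r : ℝ) (hf : ThreePt ℓ L f) : ThreePt (|r| * ℓ) (|r| * L) (fun x => r • f x) where
  lip a b := by
    rw [← smul_sub, norm_smul, Real.norm_eq_abs, mul_assoc]
    exact mul_le_mul_of_nonneg_left (hf.lip a b) (abs_nonneg r)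
  three a b c := by
    rw [← smul_add, smul_comm (2 : ℝ) r, ← smul_sub, norm_smul, Real.norm_eq_abs, mul_assoc,
      mul_assoc, ← mul_add]
    exact mul_le_mul_of_nonneg_left (hf.three a b c) (abs_nonneg r)

theorem neg (hf : ThreePt ℓ L f) : ThreePt ℓ L (fun x => -f x) := by
  simpa using hf.smul (-1)

theorem sub {g : X → Y} (hf : ThreePt ℓ L f) (hg : ThreePt ℓ' L' g) :
    ThreePt (ℓ + ℓ') (L + L') (fun x => f x - g x) := by
  simpa [sub_eq_add_neg] using hf.add hg.neg

theorem sum {ι : Type*} (s : Finset ι) {u v : ι → ℝ} {F : ι → X → Y}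
    (hF : ∀ i ∈ s, ThreePt (u i) (v i) (F i)) :
    ThreePt (∑ i ∈ s, u i) (∑ i ∈ s, v i) (fun x => ∑ i ∈ s, F i x) := by
  classical
  induction s using Finset.induction_on with
  | empty => simpa using ThreePt.const (X := X) (0 : Y)
  | insert i s hi ih =>
    simp only [Finset.sum_insert hi]
    exact (hF i (Finset.mem_insert_self _ _)).add
      (ih fun j hj => hF j (Finset.mem_insert_of_mem hj))

theorem comp {g : Y → Z} (hg : ThreePt ℓ' L' g) (hf : ThreePt ℓ L f) (h0 : 0 ≤ ℓ') (h1 : 0 ≤ L') :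
    ThreePt (ℓ' * ℓ) (ℓ' * L + L' * ℓ ^ 2) (fun x => g (f x)) where
  lip a b := by
    refine (hg.lip _ _).trans ?_
    rw [mul_assoc]
    exact mul_le_mul_of_nonneg_left (hf.lip a b) h0
  three a b c := by
    refine (hg.three _ _ _).trans ?_
    have h2 := mul_le_mul_of_nonneg_left (hf.three a b c) h0
    have h3 : ‖f a - f b‖ ^ 2 ≤ (ℓ * ‖a - b‖) ^ 2 :=
      pow_le_pow_left₀ (norm_nonneg _) (hf.lip a b) 2
    have h4 := mul_le_mul_of_nonneg_left h3 h1
    nlinarith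

theorem prodMk {g : X → Z} (hf : ThreePt ℓ L f) (hg : ThreePt ℓ' L' g) :
    ThreePt (max ℓ ℓ') (max L L') (fun x => (f x, g x)) where
  lip a b := by
    have h1 := (hf.mono (le_max_left ℓ ℓ') (le_max_left L L')).lip a b
    have h2 := (hg.mono (le_max_right ℓ ℓ') (le_max_right L L')).lip a b
    exact max_le h1 h2
  three a b c := by
    have h1 := (hf.mono (le_max_left ℓ ℓ') (le_max_left L L')).three a b c
    have h2 := (hg.mono (le_max_right ℓ ℓ') (le_max_right L L')).three a b c
    exact max_le h1 h2

/-- The second difference of a product splits into the second differences of the factors, weighted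
by values bounded by `B`, plus half the product of the first differences; the last term gives `ℓ *
ℓ' / 2`. -/
theorem mul {f g : X → ℝ} {B : ℝ} (hf : ThreePt ℓ L f) (hg : ThreePt ℓ' L' g)
    (hℓ : 0 ≤ ℓ) (hfB : ∀ x, |f x| ≤ B) (hgB : ∀ x, |g x| ≤ B) :
    ThreePt (B * (ℓ + ℓ')) (B * (L + L') + ℓ * ℓ' / 2) (fun x => f x * g x) where
  lip a b := by
    have h1 := hf.lip a b
    have h2 := hg.lip a b
    have hB : 0 ≤ B := (abs_nonneg _).trans (hfB a)
    simp only [Real.norm_eq_abs] at *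
    rw [show f a * g a - f b * g b = f a * (g a - g b) + (f a - f b) * g b by ring]
    refine (abs_add_le _ _).trans ?_
    rw [abs_mul, abs_mul]
    have := mul_le_mul (hfB a) h2 (abs_nonneg _) hB
    have := mul_le_mul h1 (hgB b) (abs_nonneg _) ((abs_nonneg _).trans h1)
    nlinarith
  three a b c := by
    have h1 := hf.three a b c
    have h2 := hg.three a b c
    have h3 := hf.lip a b
    have h4 := hg.lip a b
    have hB : 0 ≤ B := (abs_nonneg _).trans (hfB a)
    simp only [Real.norm_eq_abs, smul_eq_mul] at *
    rw [show f a * g a + f b * g b - 2 * (f c * g c) =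
      ((f a + f b) / 2) * (g a + g b - 2 * g c) + (f a + f b - 2 * f c) * g c
        + (f a - f b) * (g a - g b) / 2 by ring]
    refine (abs_add_three _ _ _).trans ?_
    rw [abs_mul, abs_mul, abs_div ((f a - f b) * (g a - g b)), abs_mul (f a - f b), abs_two]
    have h5 : |(f a + f b) / 2| ≤ B := by
      rw [abs_div, abs_two]
      linarith [abs_add_le (f a) (f b), hfB a, hfB b]
    have := mul_le_mul h5 h2 (abs_nonneg _) hB
    have := mul_le_mul h1 (hgB c) (abs_nonneg _) ((abs_nonneg _).trans h1)
    have := mul_le_mul h3 h4 (abs_nonneg _) (mul_nonneg hℓ (norm_nonneg _))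
    nlinarith

theorem euclidean {ι : Type*} [Fintype ι] {F : X → EuclideanSpace ℝ ι}
    (hF : ∀ i, ThreePt ℓ L (fun x => F x i)) :
    ThreePt (Fintype.card ι * ℓ) (Fintype.card ι * L) F := by
  classical
  have key : F = fun x => ∑ i, F x i • EuclideanSpace.single i (1 : ℝ) := by
    funext x
    ext j
    simp [Finset.sum_apply, Pi.single_apply]
  have h1 : ∀ i, ThreePt ℓ L (fun x => F x i • (EuclideanSpace.single i (1 : ℝ))) := fun i =>
    { lip := fun a b => by
        rw [← sub_smul, norm_smul]
        simpa using (hF i).lip a b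
      three := fun a b c => by
        rw [smul_smul, ← add_smul, ← sub_smul, norm_smul]
        simpa using (hF i).three a b c }
  have := ThreePt.sum Finset.univ (fun i _ => h1 i)
  rw [key]
  simpa using this

/-- A Lipschitz derivative gives the three-point estimate. -/
theorem of_hasFDerivAt {f' : X → X →L[ℝ] Y} (hf : ∀ x, HasFDerivAt f (f' x) x)
    (hb : ∀ x, ‖f' x‖ ≤ ℓ) (hl : ∀ x y, ‖f' x - f' y‖ ≤ L * ‖x - y‖) (hL : 0 ≤ L) :
    ThreePt ℓ L f := by
  have lip : ∀ a b, ‖f a - f b‖ ≤ ℓ * ‖a - b‖ := fun a b =>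
    Convex.norm_image_sub_le_of_norm_hasFDerivWithin_le (s := Set.univ)
      (fun x _ => (hf x).hasFDerivWithinAt) (fun x _ => hb x) convex_univ trivial trivial
  refine ⟨lip, fun a b c => ?_⟩
  obtain ⟨m, hm⟩ : ∃ m : X, m = (1 / 2 : ℝ) • (a + b) := ⟨_, rfl⟩
  -- Expanding about the midpoint `m`, the first-order terms at `a` and `b` cancel and each
  -- remainder is at most `L (‖a - b‖ / 2) ^ 2`. What is left compares `f m` with `f c`, which is
  -- the Lipschitz term.
  have taylor : ∀ x : X, ‖x - m‖ = ‖a - b‖ / 2 →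
      ‖f x - f m - f' m (x - m)‖ ≤ L * (‖a - b‖ / 2) * (‖a - b‖ / 2) := by
    intro x hx
    have := Convex.norm_image_sub_le_of_norm_hasFDerivWithin_le' (f := f) (f' := f')
      (s := Metric.closedBall m (‖a - b‖ / 2)) (φ := f' m) (C := L * (‖a - b‖ / 2)) (x := m) (y := x)
      (fun x _ => (hf x).hasFDerivWithinAt)
      (fun y hy => (hl y m).trans
        (mul_le_mul_of_nonneg_left (by simpa [dist_eq_norm] using hy) hL))
      (convex_closedBall _ _) (by simp [div_nonneg, norm_nonneg])
      (by simp [dist_eq_norm, hx])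
    rwa [hx] at this
  have ha : a - m = (1 / 2 : ℝ) • (a - b) := by rw [hm]; module
  have hb' : b - m = -((1 / 2 : ℝ) • (a - b)) := by rw [hm]; module
  have ta := taylor a (by rw [ha, norm_smul]; norm_num; ring)
  have tb := taylor b (by rw [hb', norm_neg, norm_smul]; norm_num; ring)
  rw [ha] at ta
  rw [hb', map_neg] at tb
  have tc := lip m c
  have hc : ‖m - c‖ = ‖a + b - (2 : ℝ) • c‖ / 2 := by
    rw [show m - c = (1 / 2 : ℝ) • (a + b - (2 : ℝ) • c) by rw [hm]; module, norm_smul]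
    norm_num; ring
  rw [hc] at tc
  set T := f' m ((1 / 2 : ℝ) • (a - b))
  have e : f a + f b - (2 : ℝ) • f c =
    (f a - f m - T) + (f b - f m - -T) + (2 : ℝ) • (f m - f c) := by
    module
  rw [e]
  refine (norm_add₃_le).trans ?_
  rw [norm_smul, Real.norm_eq_abs, abs_two]
  have : 0 ≤ L * ‖a - b‖ ^ 2 := by positivity
  nlinarith

theorem exists_of_hasCompactSupport (hf : ContDiff ℝ 2 f) (hc : HasCompactSupport f) :
    ∃ ℓ L : ℝ, 0 ≤ ℓ ∧ 0 ≤ L ∧ ThreePt ℓ L f := by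
  obtain ⟨C, hC⟩ := (hc.fderiv ℝ).exists_bound_of_continuous (hf.continuous_fderiv (by norm_num))
  obtain ⟨D, hD⟩ := ContDiff.lipschitzWith_of_hasCompactSupport (n := 1) (hc.fderiv ℝ)
    (hf.fderiv_right (m := 1) (by norm_num)) (by norm_num)
  refine ⟨C, D, (norm_nonneg _).trans (hC 0), D.2, of_hasFDerivAt
    (fun x => (hf.differentiable (by norm_num) x).hasFDerivAt) hC (fun x y => ?_) D.2⟩
  simpa [dist_eq_norm] using hD.dist_le_mul x y

/-- Both pairs are compared with their common midpoint, where the `ℓ` terms vanish. This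
second-order bound yields both additivity and Lipschitz dependence of the derivative. -/
theorem parallelogram (hf : ThreePt ℓ L f) {a b c d : X} (h : a + b = c + d) :
    ‖f a + f b - f c - f d‖ ≤ L * (‖a - b‖ ^ 2 + ‖c - d‖ ^ 2) := by
  have h1 := hf.three a b ((1 / 2 : ℝ) • (a + b))
  have h2 := hf.three c d ((1 / 2 : ℝ) • (a + b))
  rw [smul_smul] at h1 h2
  norm_num at h1
  rw [← h] at h2
  norm_num at h2
  have := norm_sub_le (f a + f b - (2 : ℝ) • f ((1 / 2 : ℝ) • (a + b)))
    (f c + f d - (2 : ℝ) • f ((1 / 2 : ℝ) • (a + b)))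
  rw [sub_sub_sub_cancel_right, ← sub_sub] at this
  norm_num at this
  linarith

/-- A map with the three-point estimate is differentiable with Lipschitz derivative, with a
quantitative Taylor formula. -/
theorem exists_fderiv [CompleteSpace Y] (hf : ThreePt ℓ L f) (hℓ : 0 ≤ ℓ) (hL : 0 ≤ L) :
    ∃ f' : X → X →L[ℝ] Y, (∀ x, HasFDerivAt f (f' x) x) ∧ (∀ x, ‖f' x‖ ≤ ℓ) ∧
      (∀ x y, ‖f' x - f' y‖ ≤ 12 * L * ‖x - y‖) ∧
      ∀ x v, ‖f (x + v) - f x - f' x v‖ ≤ 2 * L * ‖v‖ ^ 2 := by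
  -- Dyadic difference quotients in the direction `v`. The three-point estimate at `x`, `x + w` and
  -- their midpoint makes consecutive quotients differ by `O(2 ^ (-k))`, so they converge; summing
  -- the series also gives the Taylor remainder.
  let D : X → X → ℕ → Y := fun x v k => (2 : ℝ) ^ k • (f (x + ((2 : ℝ) ^ k)⁻¹ • v) - f x)
  have step : ∀ x v k, dist (D x v k) (D x v (k + 1)) ≤ (2 * L * ‖v‖ ^ 2) / 2 / 2 ^ k := by
    intro x v k
    have h2 : (0 : ℝ) < 2 ^ k := by positivity
    set w := ((2 : ℝ) ^ k)⁻¹ • v with hw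
    have e1 : ((2 : ℝ) ^ (k + 1))⁻¹ • v = (1 / 2 : ℝ) • w := by
      rw [hw, smul_smul]; congr 1; rw [pow_succ]; field_simp
    have e2 : D x v k - D x v (k + 1) =
        (2 : ℝ) ^ k • (f x + f (x + w) - (2 : ℝ) • f (x + (1 / 2 : ℝ) • w)) := by
      simp only [D, e1, ← hw]; rw [pow_succ]; module
    rw [dist_eq_norm, e2, norm_smul, Real.norm_of_nonneg h2.le]
    have := hf.three x (x + w) (x + (1 / 2 : ℝ) • w)
    rw [show x + (x + w) - (2 : ℝ) • (x + (1 / 2 : ℝ) • w) = 0 by module,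
      show x - (x + w) = -w by abel, norm_neg, norm_zero, mul_zero, zero_add] at this
    have hwn : ‖w‖ = ‖v‖ / 2 ^ k := by
      rw [hw, norm_smul, norm_inv, Real.norm_of_nonneg h2.le]; ring
    rw [hwn] at this
    calc _ ≤ (2 : ℝ) ^ k * (L * (‖v‖ / 2 ^ k) ^ 2) := by gcongr
      _ = _ := by field_simp
  have lim : ∀ x v, ∃ y, Tendsto (D x v) atTop (𝓝 y) := fun x v =>
    cauchySeq_tendsto_of_complete (cauchySeq_of_le_geometric_two (step x v))
  choose T hT using lim
  have taylor : ∀ x v, ‖f (x + v) - f x - T x v‖ ≤ 2 * L * ‖v‖ ^ 2 := by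
    intro x v
    have := dist_le_of_le_geometric_two_of_tendsto₀ (step x v) (hT x v)
    simpa [D, dist_eq_norm] using this
  have bound : ∀ x v, ‖T x v‖ ≤ ℓ * ‖v‖ := by
    intro x v
    refine le_of_tendsto (hT x v).norm (Eventually.of_forall fun k => ?_)
    have h2 : (0 : ℝ) < 2 ^ k := by positivity
    have := hf.lip (x + ((2 : ℝ) ^ k)⁻¹ • v) x
    rw [add_sub_cancel_left, norm_smul, norm_inv, Real.norm_of_nonneg h2.le] at this
    simp only [D]
    rw [norm_smul, Real.norm_of_nonneg h2.le]
    calc _ ≤ (2 : ℝ) ^ k * (ℓ * ((2 ^ k)⁻¹ * ‖v‖)) := by gcongr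
      _ = _ := by field_simp
  -- The defect of additivity of the quotients is `2 ^ k` times a parallelogram defect of size `O(4
  -- ^ (-k))`.
  have add : ∀ x u v, T x (u + v) = T x u + T x v := by
    intro x u v
    have h1 := ((hT x u).add (hT x v)).sub (hT x (u + v))
    have h0 : Tendsto (fun k : ℕ => L * (‖u - v‖ ^ 2 + ‖u + v‖ ^ 2) * (1 / 2 : ℝ) ^ k) atTop
        (𝓝 0) := by
      simpa using (tendsto_pow_atTop_nhds_zero_of_lt_one (r := (1 / 2 : ℝ)) (by norm_num)
        (by norm_num)).const_mul (L * (‖u - v‖ ^ 2 + ‖u + v‖ ^ 2))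
    have h2 : Tendsto (fun k => D x u k + D x v k - D x (u + v) k) atTop (𝓝 0) := by
      refine squeeze_zero_norm (fun k => ?_) h0
      have h2 : (0 : ℝ) < 2 ^ k := by positivity
      obtain ⟨r, hr⟩ : ∃ r : ℝ, r = ((2 : ℝ) ^ k)⁻¹ := ⟨_, rfl⟩
      have hr0 : 0 < r := by rw [hr]; positivity
      have e : D x u k + D x v k - D x (u + v) k =
          (2 : ℝ) ^ k • (f (x + r • u) + f (x + r • v) - f (x + r • (u + v)) - f x) := by
        simp only [D, ← hr]; module
      have := hf.parallelogram (a := x + r • u) (b := x + r • v) (c := x + r • (u + v)) (d := x)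
        (by module)
      rw [show x + r • u - (x + r • v) = r • (u - v) by module, add_sub_cancel_left,
        norm_smul, norm_smul, Real.norm_of_nonneg hr0.le] at this
      rw [e, norm_smul, Real.norm_of_nonneg h2.le]
      calc _ ≤ (2 : ℝ) ^ k * (L * ((r * ‖u - v‖) ^ 2 + (r * ‖u + v‖) ^ 2)) := by gcongr
        _ = _ := by rw [hr, one_div, inv_pow]; field_simp
    have := tendsto_nhds_unique h1 h2
    rw [sub_eq_zero] at this
    exact this.symm
  let A : X → X →+ Y := fun x => AddMonoidHom.mk' (T x) (add x)
  have hA : ∀ x, Continuous (A x) := fun x =>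
    AddMonoidHomClass.continuous_of_bound (A x) ℓ (bound x)
  let f' : X → X →L[ℝ] Y := fun x => (A x).toRealLinearMap (hA x)
  have hf' : ∀ x v, f' x v = T x v := fun x v => rfl
  refine ⟨f', fun x => ?_, fun x => ?_, fun x y => ?_, fun x v => ?_⟩
  · rw [hasFDerivAt_iff_isLittleO_nhds_zero]
    refine Asymptotics.IsBigO.trans_isLittleO (g := fun v : X => ‖v‖ ^ 2)
      (Asymptotics.IsBigO.of_bound (2 * L) (Eventually.of_forall fun v => ?_))
      (Asymptotics.isLittleO_norm_pow_id one_lt_two)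
    rw [hf', norm_pow, norm_norm]
    exact taylor x v
  · exact ContinuousLinearMap.opNorm_le_bound _ hℓ (bound x)
  · refine ContinuousLinearMap.opNorm_le_bound _ (by positivity) fun v => ?_
    rcases eq_or_ne v 0 with rfl | hv
    · simp
    rcases eq_or_ne x y with rfl | hxy
    · simp
    have hv' : 0 < ‖v‖ := norm_pos_iff.2 hv
    have hd : 0 < ‖x - y‖ := norm_pos_iff.2 (sub_ne_zero.2 hxy)
    -- The direction is rescaled to the length of `x - y`. The constant `12` is `8` from the
    -- parallelogram estimate, whose two diagonals are at most `2 ‖x - y‖`, plus `2 + 2` from the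
    -- Taylor remainders at `x` and `y`.
    set s := ‖x - y‖ / ‖v‖ with hs
    have hs0 : 0 < s := by positivity
    have hn : ‖s • v‖ = ‖x - y‖ := by
      rw [norm_smul, Real.norm_of_nonneg hs0.le, hs]; field_simp
    have t1 := taylor x (s • v)
    have t2 := taylor y (s • v)
    have t3 := hf.parallelogram (a := x + s • v) (b := y) (c := y + s • v) (d := x) (by abel)
    have n1 : ‖x + s • v - y‖ ≤ 2 * ‖x - y‖ := by
      rw [show x + s • v - y = (x - y) + s • v by abel]
      linarith [norm_add_le (x - y) (s • v)]
    have n2 : ‖y + s • v - x‖ ≤ 2 * ‖x - y‖ := by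
      rw [show y + s • v - x = s • v - (x - y) by abel]
      linarith [norm_sub_le (s • v) (x - y)]
    have n1' := pow_le_pow_left₀ (norm_nonneg _) n1 2
    have n2' := pow_le_pow_left₀ (norm_nonneg _) n2 2
    have t4 : L * (‖x + s • v - y‖ ^ 2 + ‖y + s • v - x‖ ^ 2) ≤ L * (8 * ‖x - y‖ ^ 2) := by
      gcongr; nlinarith
    have key : ‖(f' x - f' y) (s • v)‖ ≤ 12 * L * ‖x - y‖ ^ 2 := by
      rw [sub_apply, hf', hf']
      rw [show T x (s • v) - T y (s • v) =
        (f (x + s • v) + f y - f (y + s • v) - f x) - (f (x + s • v) - f x - T x (s • v))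
          + (f (y + s • v) - f y - T y (s • v)) by abel]
      refine (norm_add_le _ _).trans ?_
      have := norm_sub_le (f (x + s • v) + f y - f (y + s • v) - f x)
        (f (x + s • v) - f x - T x (s • v))
      rw [hn] at t1 t2
      linarith
    rw [map_smul, norm_smul, Real.norm_of_nonneg hs0.le] at key
    have : ‖(f' x - f' y) v‖ ≤ 12 * L * ‖x - y‖ ^ 2 / s := by
      rw [le_div_iff₀ hs0]; linarith
    refine this.trans (le_of_eq ?_)
    rw [hs]; field_simp
  · exact taylor x v

/-- Interpolation between the supremum norm and the three-point constant. -/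
theorem norm_fderiv_le_of_small [CompleteSpace Y] (hf : ThreePt ℓ L f) (hℓ : 0 ≤ ℓ) (hL : 0 ≤ L)
    {β s : ℝ} (hs : 0 < s) (hs1 : s ≤ 1) (hβ : ∀ x : X, ‖x‖ ≤ 2 → ‖f x‖ ≤ β)
    {q : X} (hq : ‖q‖ ≤ 1) : ‖fderiv ℝ f q‖ ≤ 2 * β / s + 2 * L * s := by
  obtain ⟨f', h1, -, -, h4⟩ := hf.exists_fderiv hℓ hL
  have hβ0 : 0 ≤ β := (norm_nonneg _).trans (hβ 0 (by simp))
  rw [(h1 q).fderiv]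
  refine ContinuousLinearMap.opNorm_le_bound _ (by positivity) fun v => ?_
  rcases eq_or_ne v 0 with rfl | hv
  · simp
  have hv' : 0 < ‖v‖ := norm_pos_iff.2 hv
  -- A step of length `s` keeps `q + r • v` in the ball of radius `2`; the finite difference is at
  -- most `2 * β` and the Taylor remainder at most `2 * L * s ^ 2`.
  set r := s / ‖v‖ with hr
  have hr0 : 0 < r := by positivity
  have hn : ‖r • v‖ = s := by
    rw [norm_smul, Real.norm_of_nonneg hr0.le, hr]; field_simp
  have t := h4 q (r • v)
  rw [hn] at t
  have b1 := hβ q (hq.trans (by norm_num))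
  have b2 := hβ (q + r • v) (by linarith [norm_add_le q (r • v)])
  have key : ‖f' q (r • v)‖ ≤ 2 * β + 2 * L * s ^ 2 := by
    rw [show f' q (r • v) = f (q + r • v) - f q - (f (q + r • v) - f q - f' q (r • v)) by abel]
    linarith [norm_sub_le (f (q + r • v) - f q) (f (q + r • v) - f q - f' q (r • v)),
      norm_sub_le (f (q + r • v)) (f q)]
  rw [map_smul, norm_smul, Real.norm_of_nonneg hr0.le] at key
  have : ‖f' q v‖ ≤ (2 * β + 2 * L * s ^ 2) / r := by
    rw [le_div_iff₀ hr0]; linarith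
  refine this.trans (le_of_eq ?_)
  rw [hr]; field_simp

end ThreePt

end

/-! ### Reversed-time dichotomy and the Lyapunov-Perron fixed point. -/

section

open Filter Topology MeasureTheory Set

section SlowManifold

variable {E H : Type*} [NormedAddCommGroup E] [NormedSpace ℝ E]
  [NormedAddCommGroup H] [NormedSpace ℝ H]

theorem hasDerivAt_exp_const_mul (c t : ℝ) :
    HasDerivAt (fun τ => Real.exp (c * τ)) (c * Real.exp (c * t)) t := by
  simpa [mul_comm] using ((hasDerivAt_id' t).const_mul c).exp

theorem norm_le_of_deriv_le_exp {u a : ℝ → E} {A ν : ℝ} (hν : 0 < ν)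
    (hu : ∀ t, 0 ≤ t → HasDerivAt u (a t) t) (ha : ∀ t, 0 ≤ t → ‖a t‖ ≤ A * Real.exp (ν * t))
    {t : ℝ} (ht : 0 ≤ t) : ‖u t‖ ≤ (‖u 0‖ + A / ν) * Real.exp (ν * t) := by
  have h1 := image_norm_le_of_norm_deriv_right_le_deriv_boundary (f := u) (f' := a) (a := 0) (b := t)
    (B := fun s => ‖u 0‖ + A / ν * (Real.exp (ν * s) - 1)) (B' := fun s => A * Real.exp (ν * s))
    (fun s hs => (hu s hs.1).continuousAt.continuousWithinAt)
    (fun s hs => (hu s hs.1).hasDerivWithinAt) (by simp)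
    (fun s => by
      refine ((((hasDerivAt_exp_const_mul ν s).sub_const 1).const_mul (A / ν)).const_add
        ‖u 0‖).congr_deriv ?_
      field_simp)
    (fun s hs => ha s hs.1) (right_mem_Icc.2 ht)
  have hA : 0 ≤ A := by simpa using (norm_nonneg _).trans (ha 0 le_rfl)
  have h2 : 0 ≤ A / ν := by positivity
  have h3 : 1 ≤ Real.exp (ν * t) := Real.one_le_exp (by positivity)
  nlinarith [norm_nonneg (u 0)]

/-- The factor `exp (-Λ τ)` removes the homogeneous term, so `exp (-Λ τ) • w τ` changes only through
`b`. Integrating from `t` to `T` and letting `T → ∞`, the boundedness of `w` kills the boundary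
term: `w t` is controlled by future values of `b` alone. The constant `C` does not enter the bound.
-/
theorem norm_le_of_bounded_of_deriv {w b : ℝ → H} {Λ ν B C : ℝ} (hνΛ : ν < Λ) (hΛ : 0 < Λ)
    (hw : ∀ t, 0 ≤ t → HasDerivAt w (Λ • (w t - b t)) t)
    (hb : ∀ t, 0 ≤ t → ‖b t‖ ≤ B * Real.exp (ν * t)) (hC : ∀ t, 0 ≤ t → ‖w t‖ ≤ C)
    {t : ℝ} (ht : 0 ≤ t) : ‖w t‖ ≤ Λ * B / (Λ - ν) * Real.exp (ν * t) := by
  have hB : 0 ≤ B := by simpa using (norm_nonneg _).trans (hb 0 le_rfl)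
  have hd : 0 < Λ - ν := sub_pos.2 hνΛ
  let g : ℝ → H := fun τ => Real.exp (-Λ * τ) • w τ
  have hg : ∀ τ, 0 ≤ τ → HasDerivAt g (-(Λ * Real.exp (-Λ * τ)) • b τ) τ := by
    intro τ hτ
    refine ((hasDerivAt_exp_const_mul (-Λ) τ).smul (hw τ hτ)).congr_deriv ?_
    module
  have key : ∀ T, t ≤ T → ‖g t‖ ≤ Real.exp (-Λ * T) * C +
      Λ * B / (Λ - ν) * Real.exp ((ν - Λ) * t) := by
    intro T hT
    have h1 := image_norm_le_of_norm_deriv_right_le_deriv_boundary (f := fun τ => g τ - g t)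
      (f' := fun τ => -(Λ * Real.exp (-Λ * τ)) • b τ) (a := t) (b := T)
      (B := fun s => Λ * B / (Λ - ν) * (Real.exp ((ν - Λ) * t) - Real.exp ((ν - Λ) * s)))
      (B' := fun s => Λ * B * Real.exp ((ν - Λ) * s))
      (fun s hs => ((hg s (ht.trans hs.1)).sub_const _).continuousAt.continuousWithinAt)
      (fun s hs => ((hg s (ht.trans hs.1)).sub_const _).hasDerivWithinAt) (by simp)
      (fun s => by
        refine (((hasDerivAt_exp_const_mul (ν - Λ) s).const_sub
          (Real.exp ((ν - Λ) * t))).const_mul (Λ * B / (Λ - ν))).congr_deriv ?_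
        have := hd.ne'
        rw [div_mul_eq_mul_div, div_eq_iff this]; ring)
      (fun s hs => by
        have := hb s (ht.trans hs.1)
        rw [norm_smul, norm_neg, Real.norm_of_nonneg (by positivity)]
        calc _ ≤ Λ * Real.exp (-Λ * s) * (B * Real.exp (ν * s)) := by gcongr
          _ = Λ * B * (Real.exp (-Λ * s) * Real.exp (ν * s)) := by ring
          _ = _ := by rw [← Real.exp_add]; congr 2; ring) (right_mem_Icc.2 hT)
    have h2 : ‖g T‖ ≤ Real.exp (-Λ * T) * C := by
      rw [norm_smul, Real.norm_of_nonneg (Real.exp_pos _).le]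
      gcongr
      exact hC T (ht.trans hT)
    have h3 : ‖g t‖ ≤ ‖g T‖ + ‖g T - g t‖ := by
      rw [show g t = g T - (g T - g t) by abel]
      refine (norm_sub_le _ _).trans (by simp)
    have h4 : 0 ≤ Λ * B / (Λ - ν) * Real.exp ((ν - Λ) * T) := by positivity
    simp only [mul_sub] at h1
    linarith
  have lim : Tendsto (fun T => Real.exp (-Λ * T) * C +
      Λ * B / (Λ - ν) * Real.exp ((ν - Λ) * t)) atTop
      (𝓝 (0 * C + Λ * B / (Λ - ν) * Real.exp ((ν - Λ) * t))) := by
    refine Tendsto.add_const _ (Tendsto.mul_const _ ?_)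
    refine Real.tendsto_exp_atBot.comp ?_
    exact tendsto_id.const_mul_atTop_of_neg (neg_lt_zero.2 hΛ)
  have h5 := ge_of_tendsto lim ((eventually_ge_atTop t).mono key)
  rw [zero_mul, zero_add, norm_smul, Real.norm_of_nonneg (Real.exp_pos _).le] at h5
  have h6 : Real.exp (Λ * t) * (Real.exp (-Λ * t) * ‖w t‖) ≤
      Real.exp (Λ * t) * (Λ * B / (Λ - ν) * Real.exp ((ν - Λ) * t)) := by gcongr
  have e1 : Real.exp (Λ * t) * Real.exp (-Λ * t) = 1 := by rw [← Real.exp_add]; simp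
  have e2 : Real.exp (Λ * t) * Real.exp ((ν - Λ) * t) = Real.exp (ν * t) := by
    rw [← Real.exp_add]; congr 1; ring
  calc ‖w t‖ = Real.exp (Λ * t) * (Real.exp (-Λ * t) * ‖w t‖) := by rw [← mul_assoc, e1, one_mul]
    _ ≤ _ := h6
    _ = Λ * B / (Λ - ν) * (Real.exp (Λ * t) * Real.exp ((ν - Λ) * t)) := by ring
    _ = _ := by rw [e2]

/-- Estimate of a solution of the linear inhomogeneous dichotomy on the half line, the
inhomogeneities being controlled by half of the solution itself. -/
theorem norm_le_of_dichotomy {u a : ℝ → E} {w b : ℝ → H} {Λ ν α α₂ β β₂ C A₀ : ℝ}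
    (hν : 0 < ν) (hνΛ : 2 * ν ≤ Λ) (hα : 2 * α ≤ ν) (hβ : 4 * β ≤ 1)
    (hα₂ : 0 ≤ α₂) (hβ₂ : 0 ≤ β₂) (hα0 : 0 ≤ α) (hβ0 : 0 ≤ β)
    (hu : ∀ t, 0 ≤ t → HasDerivAt u (-a t) t)
    (hw : ∀ t, 0 ≤ t → HasDerivAt w (Λ • (w t - b t)) t)
    (ha : ∀ t, 0 ≤ t → ‖a t‖ ≤ α * ‖(u t, w t)‖ + α₂ * Real.exp (ν * t))
    (hb : ∀ t, 0 ≤ t → ‖b t‖ ≤ β * ‖(u t, w t)‖ + β₂ * Real.exp (ν * t))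
    (hC : ∀ t, 0 ≤ t → ‖w t‖ ≤ C) (hA : ∀ t, 0 ≤ t → ‖u t‖ ≤ A₀ * Real.exp (ν * t))
    {t : ℝ} (ht : 0 ≤ t) :
    ‖(u t, w t)‖ ≤ 2 * (‖u 0‖ + α₂ / ν + 2 * β₂) * Real.exp (ν * t) := by
  set d := ‖u 0‖ + α₂ / ν + 2 * β₂ with hd
  have hd1 : 0 ≤ α₂ / ν := by positivity
  -- A bound with constant `A` improves to one with `d + A / 2`. Iteration from the a priori bound
  -- `h0` converges to the fixed point `2 * d`, in which `A₀` and `C` no longer occur.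
  have improve : ∀ A, (∀ t, 0 ≤ t → ‖(u t, w t)‖ ≤ A * Real.exp (ν * t)) →
      ∀ t, 0 ≤ t → ‖(u t, w t)‖ ≤ (d + A / 2) * Real.exp (ν * t) := by
    intro A h t ht
    have hA0 : 0 ≤ A := by simpa using (norm_nonneg _).trans (h 0 le_rfl)
    have h1 := norm_le_of_deriv_le_exp (A := α * A + α₂) hν hu (fun t ht => by
      rw [norm_neg]
      have := mul_le_mul_of_nonneg_left (h t ht) hα0
      linarith [ha t ht]) ht
    have h2 := norm_le_of_bounded_of_deriv (B := β * A + β₂) (ν := ν) (Λ := Λ) (by linarith)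
      (by linarith) hw
      (fun t ht => by
        have := mul_le_mul_of_nonneg_left (h t ht) hβ0
        linarith [hb t ht]) hC ht
    have h3 : (α * A + α₂) / ν ≤ A / 2 + α₂ / ν := by
      rw [add_div]
      have : α * A / ν ≤ A / 2 := by
        rw [div_le_iff₀ hν]
        nlinarith
      linarith
    have h4 : Λ * (β * A + β₂) / (Λ - ν) ≤ A / 2 + 2 * β₂ := by
      rw [div_le_iff₀ (by linarith)]
      have : (0 : ℝ) ≤ β * A + β₂ := by positivity
      have : Λ * (β * A + β₂) ≤ (2 * (Λ - ν)) * (β * A + β₂) := by gcongr; linarith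
      nlinarith [mul_nonneg hA0 (by linarith : 0 ≤ Λ - ν)]
    rw [Prod.norm_def]
    refine max_le (h1.trans ?_) (h2.trans ?_)
    · exact mul_le_mul_of_nonneg_right (by linarith) (Real.exp_pos _).le
    · exact mul_le_mul_of_nonneg_right (by linarith [norm_nonneg (u 0)]) (Real.exp_pos _).le
  have h0 : ∀ t, 0 ≤ t → ‖(u t, w t)‖ ≤ max A₀ C * Real.exp (ν * t) := by
    intro t ht
    rw [Prod.norm_def]
    have h1 : 1 ≤ Real.exp (ν * t) := Real.one_le_exp (by positivity)
    have hC0 : 0 ≤ C := (norm_nonneg _).trans (hC 0 le_rfl)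
    refine max_le ((hA t ht).trans (by gcongr; exact le_max_left _ _)) ((hC t ht).trans ?_)
    nlinarith [le_max_right A₀ C]
  have hk : ∀ k : ℕ, ∀ t, 0 ≤ t →
      ‖(u t, w t)‖ ≤ (2 * d + (max A₀ C - 2 * d) * (1 / 2) ^ k) * Real.exp (ν * t) := by
    intro k
    induction k with
    | zero => intro t ht; simpa using h0 t ht
    | succ k ih =>
      intro t ht
      convert improve _ ih t ht using 2
      rw [pow_succ]; ring
  have lim : Tendsto (fun k : ℕ => (2 * d + (max A₀ C - 2 * d) * (1 / 2) ^ k) * Real.exp (ν * t))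
      atTop (𝓝 ((2 * d + (max A₀ C - 2 * d) * 0) * Real.exp (ν * t))) :=
    (((tendsto_pow_atTop_nhds_zero_of_lt_one (by norm_num) (by norm_num)).const_mul _).const_add
      _).mul_const _
  rw [mul_zero, add_zero] at lim
  exact ge_of_tendsto lim (Eventually.of_forall fun k => hk k t ht)

/-- Solutions of `q' = F(q,w)`, `w' = Λ(G(q,w) - w)` on the negative half line, in reversed time,
that have bounded `w` and do not grow faster than `exp (μ t)`. -/
structure IsBackwardSolution (F : E × H → E) (G : E × H → H) (Λ μ : ℝ) (q : ℝ → E) (w : ℝ → H) :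
    Prop where
  fst : ∀ t, 0 ≤ t → HasDerivAt q (-F (q t, w t)) t
  snd : ∀ t, 0 ≤ t → HasDerivAt w (Λ • (w t - G (q t, w t))) t
  bounded : ∃ C, ∀ t, 0 ≤ t → ‖w t‖ ≤ C
  growth : ∃ A, ∀ t, 0 ≤ t → ‖q t‖ ≤ A * Real.exp (μ * t)

/-- The solution is `w t = exp (Λ t) ∫ τ in Ioi t, Λ exp (-Λ τ) b τ`, an average of the future of
`b`; hence the bound by the same `B`. -/
theorem exists_bounded_solution [CompleteSpace H] {b : ℝ → H} (hb : Continuous b) {B Λ : ℝ}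
    (hB : ∀ t, ‖b t‖ ≤ B) (hΛ : 0 < Λ) :
    ∃ w : ℝ → H, (∀ t, HasDerivAt w (Λ • (w t - b t)) t) ∧ ∀ t, ‖w t‖ ≤ B := by
  let k : ℝ → H := fun τ => (Λ * Real.exp (-Λ * τ)) • b τ
  have hk : Continuous k := by fun_prop
  have hdom : ∀ c, IntegrableOn (fun τ => Λ * B * Real.exp (-Λ * τ)) (Ioi c) := fun c =>
    (integrableOn_exp_mul_Ioi (neg_lt_zero.2 hΛ) c).const_mul _
  have hkb : ∀ τ, ‖k τ‖ ≤ Λ * B * Real.exp (-Λ * τ) := fun τ => by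
    rw [norm_smul, Real.norm_of_nonneg (by positivity)]
    nlinarith [mul_le_mul_of_nonneg_left (hB τ) (by positivity : 0 ≤ Λ * Real.exp (-Λ * τ))]
  have hki : ∀ c, IntegrableOn k (Ioi c) := fun c =>
    (hdom c).mono' hk.aestronglyMeasurable (Eventually.of_forall hkb)
  let J : ℝ → H := fun t => ∫ τ in Ioi t, k τ
  have hJ : ∀ t, HasDerivAt J (-k t) t := by
    intro t
    have e : J = fun t => (∫ τ in Ioi 0, k τ) - ∫ τ in (0 : ℝ)..t, k τ := by
      funext t
      rw [← intervalIntegral.integral_interval_add_Ioi (hki 0) (hki t)]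
      simp [J]
    rw [e]
    exact (intervalIntegral.integral_hasDerivAt_right (hk.intervalIntegrable _ _)
      (hk.stronglyMeasurableAtFilter _ _) hk.continuousAt).const_sub _
  refine ⟨fun t => Real.exp (Λ * t) • J t, fun t => ?_, fun t => ?_⟩
  · refine ((hasDerivAt_exp_const_mul Λ t).smul (hJ t)).congr_deriv ?_
    have e1 : Real.exp (Λ * t) * Real.exp (-Λ * t) = 1 := by rw [← Real.exp_add]; simp
    simp only [k]
    rw [smul_neg, smul_smul, show Real.exp (Λ * t) * (Λ * Real.exp (-Λ * t)) =
      Λ * (Real.exp (Λ * t) * Real.exp (-Λ * t)) by ring, e1]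
    module
  · rw [norm_smul, Real.norm_of_nonneg (Real.exp_pos _).le]
    have h1 : ‖J t‖ ≤ ∫ τ in Ioi t, Λ * B * Real.exp (-Λ * τ) :=
      norm_integral_le_of_norm_le (hdom t) (Eventually.of_forall hkb)
    rw [integral_const_mul, integral_exp_mul_Ioi (neg_lt_zero.2 hΛ)] at h1
    have e1 : Real.exp (Λ * t) * Real.exp (-Λ * t) = 1 := by rw [← Real.exp_add]; simp
    calc _ ≤ Real.exp (Λ * t) * (Λ * B * (-Real.exp (-Λ * t) / -Λ)) := by gcongr
      _ = (Real.exp (Λ * t) * Real.exp (-Λ * t)) * B := by field_simp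
      _ = B := by rw [e1, one_mul]

/-- Lyapunov-Perron: `q` is integrated forward from `q₀`, while `w` is the bounded solution of its
unstable equation. In the norm weighted by `exp (-μ |t|)` this map is a contraction with factor `1 /
2`: `ℓF / μ ≤ 1 / 2` for the first component, `Λ ℓG / (Λ - μ) ≤ 1 / 2` for the second. -/
theorem exists_isBackwardSolution [CompleteSpace E] [CompleteSpace H] {F : E × H → E}
    {G : E × H → H} {ℓF ℓG B Λ μ : ℝ} (hF : ∀ a b, ‖F a - F b‖ ≤ ℓF * ‖a - b‖)
    (hG : ∀ a b, ‖G a - G b‖ ≤ ℓG * ‖a - b‖) (hGB : ∀ a, ‖G a‖ ≤ B) (hμ : 0 < μ)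
    (hμΛ : 2 * μ ≤ Λ) (hFμ : 2 * ℓF ≤ μ) (hG4 : 4 * ℓG ≤ 1) (hℓF : 0 ≤ ℓF) (hℓG : 0 ≤ ℓG)
    (q₀ : E) :
    ∃ q w, IsBackwardSolution F G Λ μ q w ∧ q 0 = q₀ ∧ ∀ t, ‖w t‖ ≤ B := by
  have hΛ : 0 < Λ := by linarith
  have Fc : Continuous F := (LipschitzWith.of_dist_le' (K := ℓF) fun a b => by
    simpa [dist_eq_norm] using hF a b).continuous
  have Gc : Continuous G := (LipschitzWith.of_dist_le' (K := ℓG) fun a b => by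
    simpa [dist_eq_norm] using hG a b).continuous
  let x : BoundedContinuousFunction ℝ (E × H) → ℝ → E × H := fun ξ t => Real.exp (μ * |t|) • ξ t
  have xc : ∀ ξ, Continuous (x ξ) := fun ξ => by
    have := ξ.continuous
    fun_prop
  have exU : ∀ ξ, ∃ u : ℝ → E, u 0 = q₀ ∧ ∀ t, HasDerivAt u (-F (x ξ t)) t := by
    intro ξ
    have hc : Continuous fun t => F (x ξ t) := Fc.comp (xc ξ)
    refine ⟨fun t => q₀ - ∫ τ in (0 : ℝ)..t, F (x ξ τ), by simp, fun t => ?_⟩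
    exact (intervalIntegral.integral_hasDerivAt_right (hc.intervalIntegrable _ _)
      (hc.stronglyMeasurableAtFilter _ _) hc.continuousAt).const_sub _
  choose u hu0 hu using exU
  have exW : ∀ ξ, ∃ w : ℝ → H, (∀ t, HasDerivAt w (Λ • (w t - G (x ξ t))) t) ∧ ∀ t, ‖w t‖ ≤ B :=
    fun ξ => exists_bounded_solution (Gc.comp (xc ξ)) (fun t => hGB _) hΛ
  choose w hw hwB using exW
  have uc : ∀ ξ, Continuous (u ξ) := fun ξ =>
    continuous_iff_continuousAt.2 fun t => (hu ξ t).continuousAt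
  have wc : ∀ ξ, Continuous (w ξ) := fun ξ =>
    continuous_iff_continuousAt.2 fun t => (hw ξ t).continuousAt
  have xn : ∀ ξ t, ‖x ξ t‖ ≤ Real.exp (μ * |t|) * ‖ξ‖ := fun ξ t => by
    simp only [x]
    rw [norm_smul, Real.norm_of_nonneg (Real.exp_pos _).le]
    gcongr
    exact ξ.norm_coe_le_norm t
  have growth : ∀ ξ t, 0 ≤ t →
      ‖u ξ t‖ ≤ (‖q₀‖ + (‖F 0‖ + ℓF * ‖ξ‖) / μ) * Real.exp (μ * t) := by
    intro ξ t ht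
    have := norm_le_of_deriv_le_exp (A := ‖F 0‖ + ℓF * ‖ξ‖) hμ (fun t _ => hu ξ t) (fun t ht => by
      have h1 := hF (x ξ t) 0
      have h2 := xn ξ t
      rw [abs_of_nonneg ht] at h2
      rw [sub_zero] at h1
      have h3 : ‖F (x ξ t)‖ ≤ ‖F 0‖ + ‖F (x ξ t) - F 0‖ := by
        have := norm_add_le (F 0) (F (x ξ t) - F 0)
        rwa [add_sub_cancel] at this
      have h4 : 1 ≤ Real.exp (μ * t) := Real.one_le_exp (by positivity)
      have h5 := mul_le_mul_of_nonneg_left h2 hℓF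
      rw [norm_neg]
      nlinarith [norm_nonneg (F 0)]) ht
    rwa [hu0] at this
  have eabs : ∀ t : ℝ, Real.exp (-(μ * |t|)) * Real.exp (μ * |t|) = 1 := fun t => by
    rw [← Real.exp_add]; simp
  have bd : ∀ ξ t, ‖Real.exp (-(μ * |t|)) • (u ξ |t|, w ξ |t|)‖ ≤
      max (‖q₀‖ + (‖F 0‖ + ℓF * ‖ξ‖) / μ) B := by
    intro ξ t
    have h0 := (growth ξ |t| (abs_nonneg t))
    have h1 : Real.exp (-(μ * |t|)) ≤ 1 := Real.exp_le_one_iff.2 (by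
      have := abs_nonneg t; nlinarith)
    rw [Prod.smul_mk, Prod.norm_def, norm_smul, norm_smul, Real.norm_of_nonneg (Real.exp_pos _).le]
    refine max_le_max ?_ ?_
    · calc _ ≤ Real.exp (-(μ * |t|)) *
          ((‖q₀‖ + (‖F 0‖ + ℓF * ‖ξ‖) / μ) * Real.exp (μ * |t|)) := by gcongr
        _ = (‖q₀‖ + (‖F 0‖ + ℓF * ‖ξ‖) / μ) *
          (Real.exp (-(μ * |t|)) * Real.exp (μ * |t|)) := by ring
        _ = _ := by rw [eabs, mul_one]
    · calc _ ≤ 1 * ‖w ξ |t|‖ := by gcongr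
        _ ≤ B := by rw [one_mul]; exact hwB ξ _
  -- Only `t ≥ 0` matters; the even extension through `|t|` allows bounded continuous functions on
  -- all of `ℝ` to be used.
  let Γ : BoundedContinuousFunction ℝ (E × H) → BoundedContinuousFunction ℝ (E × H) := fun ξ =>
    BoundedContinuousFunction.ofNormedAddCommGroup
      (fun t => Real.exp (-(μ * |t|)) • (u ξ |t|, w ξ |t|))
      (by have := uc ξ; have := wc ξ; fun_prop) _ (bd ξ)
  have contr : ContractingWith (1 / 2) Γ := by
    refine ⟨by rw [← NNReal.coe_lt_coe]; norm_num, LipschitzWith.of_dist_le_mul fun ξ η => ?_⟩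
    rw [BoundedContinuousFunction.dist_le (by positivity)]
    intro t
    have hs := abs_nonneg t
    generalize hst : |t| = s at hs
    have xd : ∀ t, 0 ≤ t → ‖x ξ t - x η t‖ ≤ dist ξ η * Real.exp (μ * t) := by
      intro t ht
      simp only [x]
      rw [← smul_sub, norm_smul, Real.norm_of_nonneg (Real.exp_pos _).le, abs_of_nonneg ht, mul_comm]
      gcongr
      rw [← dist_eq_norm]
      exact BoundedContinuousFunction.dist_coe_le_dist t
    have h1 := norm_le_of_deriv_le_exp (u := fun t => u ξ t - u η t) (A := ℓF * dist ξ η) hμ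
      (fun t _ => (hu ξ t).sub (hu η t)) (fun t ht => by
        rw [show -F (x ξ t) - -F (x η t) = -(F (x ξ t) - F (x η t)) by abel, norm_neg]
        nlinarith [hF (x ξ t) (x η t), mul_le_mul_of_nonneg_left (xd t ht) hℓF]) hs
    have h2 := norm_le_of_bounded_of_deriv (w := fun t => w ξ t - w η t)
      (b := fun t => G (x ξ t) - G (x η t)) (B := ℓG * dist ξ η) (C := 2 * B) (ν := μ) (Λ := Λ)
      (by linarith) hΛ
      (fun t _ => by
        refine ((hw ξ t).sub (hw η t)).congr_deriv ?_
        module)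
      (fun t ht => by
        nlinarith [hG (x ξ t) (x η t), mul_le_mul_of_nonneg_left (xd t ht) hℓG])
      (fun t _ => (norm_sub_le _ _).trans (by linarith [hwB ξ t, hwB η t])) hs
    have h3 : ‖u ξ s - u η s‖ ≤ (1 / 2 * dist ξ η) * Real.exp (μ * s) := by
      refine h1.trans ?_
      rw [hu0, hu0, sub_self, norm_zero, zero_add]
      gcongr
      rw [div_le_iff₀ hμ]
      nlinarith [dist_nonneg (x := ξ) (y := η)]
    have h4 : ‖w ξ s - w η s‖ ≤ (1 / 2 * dist ξ η) * Real.exp (μ * s) := by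
      refine h2.trans ?_
      gcongr
      rw [div_le_iff₀ (by linarith)]
      have hd := dist_nonneg (x := ξ) (y := η)
      have : Λ * (ℓG * dist ξ η) ≤ 2 * (Λ - μ) * (1 / 4 * dist ξ η) := by gcongr <;> linarith
      linarith
    change dist (Real.exp (-(μ * |t|)) • (u ξ |t|, w ξ |t|))
      (Real.exp (-(μ * |t|)) • (u η |t|, w η |t|)) ≤ _
    rw [dist_eq_norm, ← smul_sub, norm_smul, Real.norm_of_nonneg (Real.exp_pos _).le,
      Prod.mk_sub_mk, hst]
    have h5 : ‖(u ξ s - u η s, w ξ s - w η s)‖ ≤ (1 / 2 * dist ξ η) * Real.exp (μ * s) :=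
      max_le h3 h4
    calc _ ≤ Real.exp (-(μ * s)) * ((1 / 2 * dist ξ η) * Real.exp (μ * s)) := by gcongr
      _ = (1 / 2 * dist ξ η) * (Real.exp (-(μ * s)) * Real.exp (μ * s)) := by ring
      _ = _ := by rw [← Real.exp_add]; simp
  obtain ⟨ξ, hξ⟩ : ∃ ξ, Γ ξ = ξ := ⟨_, contr.fixedPoint_isFixedPt⟩
  have hx : ∀ t, 0 ≤ t → x ξ t = (u ξ t, w ξ t) := by
    intro t ht
    have h1 : ξ t = Real.exp (-(μ * |t|)) • (u ξ |t|, w ξ |t|) := by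
      conv_lhs => rw [← hξ]
      rfl
    simp only [x]
    rw [h1, smul_smul, ← Real.exp_add, abs_of_nonneg ht]
    simp
  refine ⟨u ξ, w ξ, ⟨fun t ht => ?_, fun t ht => ?_, ⟨B, fun t _ => hwB ξ t⟩, ⟨_, growth ξ⟩⟩,
    hu0 ξ, hwB ξ⟩
  · rw [← hx t ht]; exact hu ξ t
  · rw [← hx t ht]; exact hw ξ t

end SlowManifold

end

/-! ### The slow manifold and its `C^{1,1}` bounds. -/

section

open Filter Topology MeasureTheory Set

section SlowManifold

variable {E H : Type*} [NormedAddCommGroup E] [NormedSpace ℝ E]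
  [NormedAddCommGroup H] [NormedSpace ℝ H]

theorem norm_add_sub_two_smul_le (a b c : E) : ‖a + b - (2 : ℝ) • c‖ ≤ ‖a‖ + ‖b‖ + 2 * ‖c‖ := by
  have h1 := norm_sub_le (a + b) ((2 : ℝ) • c)
  have h2 := norm_add_le a b
  rw [norm_smul, Real.norm_eq_abs, abs_two] at h1
  linarith

namespace IsBackwardSolution

variable {F : E × H → E} {G : E × H → H} {ℓF LF ℓG LG Λ μ : ℝ} {q q₁ q₂ q₃ : ℝ → E}
  {w w₁ w₂ w₃ : ℝ → H}

theorem shift (h : IsBackwardSolution F G Λ μ q w) {s : ℝ} (hs : 0 ≤ s) :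
    IsBackwardSolution F G Λ μ (fun t => q (t + s)) (fun t => w (t + s)) where
  fst t ht := (h.fst (t + s) (by linarith)).comp_add_const t s
  snd t ht := (h.snd (t + s) (by linarith)).comp_add_const t s
  bounded := by
    obtain ⟨C, hC⟩ := h.bounded
    exact ⟨C, fun t ht => hC _ (by linarith)⟩
  growth := by
    obtain ⟨A, hA⟩ := h.growth
    refine ⟨A * Real.exp (μ * s), fun t ht => (hA (t + s) (by linarith)).trans (le_of_eq ?_)⟩
    rw [mul_add, Real.exp_add]; ring

/-- The difference of two solutions obeys the dichotomy estimate without inhomogeneity, so it is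
controlled by `q₁ 0 - q₂ 0` alone. This contains uniqueness as well as the Lipschitz bound for the
manifold. -/
theorem norm_sub_le (h₁ : IsBackwardSolution F G Λ μ q₁ w₁)
    (h₂ : IsBackwardSolution F G Λ μ q₂ w₂)
    (hF : ∀ a b, ‖F a - F b‖ ≤ ℓF * ‖a - b‖) (hG : ∀ a b, ‖G a - G b‖ ≤ ℓG * ‖a - b‖)
    (hμ : 0 < μ) (hμΛ : 2 * μ ≤ Λ) (hFμ : 2 * ℓF ≤ μ) (hG4 : 4 * ℓG ≤ 1)
    (hℓF : 0 ≤ ℓF) (hℓG : 0 ≤ ℓG) {t : ℝ} (ht : 0 ≤ t) :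
    ‖(q₁ t - q₂ t, w₁ t - w₂ t)‖ ≤ 2 * ‖q₁ 0 - q₂ 0‖ * Real.exp (μ * t) := by
  obtain ⟨C₁, hC₁⟩ := h₁.bounded
  obtain ⟨C₂, hC₂⟩ := h₂.bounded
  obtain ⟨A₁, hA₁⟩ := h₁.growth
  obtain ⟨A₂, hA₂⟩ := h₂.growth
  have := norm_le_of_dichotomy (u := fun t => q₁ t - q₂ t) (w := fun t => w₁ t - w₂ t)
    (a := fun t => F (q₁ t, w₁ t) - F (q₂ t, w₂ t)) (b := fun t => G (q₁ t, w₁ t) - G (q₂ t, w₂ t))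
    (α₂ := 0) (β₂ := 0) (C := C₁ + C₂) (A₀ := A₁ + A₂) hμ hμΛ hFμ hG4 le_rfl le_rfl hℓF hℓG
    (fun t ht => ((h₁.fst t ht).sub (h₂.fst t ht)).congr_deriv (by abel))
    (fun t ht => ((h₁.snd t ht).sub (h₂.snd t ht)).congr_deriv (by module))
    (fun t ht => by simpa using hF (q₁ t, w₁ t) (q₂ t, w₂ t))
    (fun t ht => by simpa using hG (q₁ t, w₁ t) (q₂ t, w₂ t))
    (fun t ht => (_root_.norm_sub_le _ _).trans (add_le_add (hC₁ t ht) (hC₂ t ht)))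
    (fun t ht => (_root_.norm_sub_le _ _).trans (by linarith [hA₁ t ht, hA₂ t ht])) ht
  simpa using this

/-- The second difference of three solutions obeys the same dichotomy, with inhomogeneity the
squared first difference. The latter grows like `exp (2 μ t)`, so the dichotomy is used with rate `2
* μ`; this is why `4 * μ ≤ Λ` is needed. -/
theorem norm_three_le (h₁ : IsBackwardSolution F G Λ μ q₁ w₁)
    (h₂ : IsBackwardSolution F G Λ μ q₂ w₂) (h₃ : IsBackwardSolution F G Λ μ q₃ w₃)
    (hF : ThreePt ℓF LF F) (hG : ThreePt ℓG LG G)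
    (hμ : 0 < μ) (hμΛ : 4 * μ ≤ Λ) (hFμ : 2 * ℓF ≤ μ) (hG4 : 4 * ℓG ≤ 1)
    (hℓF : 0 ≤ ℓF) (hℓG : 0 ≤ ℓG) (hLF : 0 ≤ LF) (hLG : 0 ≤ LG) {t : ℝ} (ht : 0 ≤ t) :
    ‖(q₁ t + q₂ t - (2 : ℝ) • q₃ t, w₁ t + w₂ t - (2 : ℝ) • w₃ t)‖ ≤
      2 * (‖q₁ 0 + q₂ 0 - (2 : ℝ) • q₃ 0‖ + (2 * LF / μ + 8 * LG) * ‖q₁ 0 - q₂ 0‖ ^ 2) *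
        Real.exp (2 * μ * t) := by
  obtain ⟨C₁, hC₁⟩ := h₁.bounded
  obtain ⟨C₂, hC₂⟩ := h₂.bounded
  obtain ⟨C₃, hC₃⟩ := h₃.bounded
  obtain ⟨A₁, hA₁⟩ := h₁.growth
  obtain ⟨A₂, hA₂⟩ := h₂.growth
  obtain ⟨A₃, hA₃⟩ := h₃.growth
  have sq : ∀ t, 0 ≤ t → ‖(q₁ t, w₁ t) - (q₂ t, w₂ t)‖ ^ 2 ≤
      4 * ‖q₁ 0 - q₂ 0‖ ^ 2 * Real.exp (2 * μ * t) := by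
    intro t ht
    have := pow_le_pow_left₀ (norm_nonneg _) (h₁.norm_sub_le h₂ hF.lip hG.lip hμ (by linarith) hFμ
      hG4 hℓF hℓG ht) 2
    refine this.trans (le_of_eq ?_)
    rw [show 2 * μ * t = μ * t + μ * t by ring, Real.exp_add]; ring
  have := norm_le_of_dichotomy (u := fun t => q₁ t + q₂ t - (2 : ℝ) • q₃ t)
    (w := fun t => w₁ t + w₂ t - (2 : ℝ) • w₃ t)
    (a := fun t => F (q₁ t, w₁ t) + F (q₂ t, w₂ t) - (2 : ℝ) • F (q₃ t, w₃ t))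
    (b := fun t => G (q₁ t, w₁ t) + G (q₂ t, w₂ t) - (2 : ℝ) • G (q₃ t, w₃ t))
    (ν := 2 * μ) (Λ := Λ) (α := ℓF) (β := ℓG)
    (α₂ := LF * (4 * ‖q₁ 0 - q₂ 0‖ ^ 2)) (β₂ := LG * (4 * ‖q₁ 0 - q₂ 0‖ ^ 2))
    (C := C₁ + C₂ + 2 * C₃) (A₀ := |A₁| + |A₂| + 2 * |A₃|) (by linarith) (by linarith)
    (by linarith) hG4 (by positivity) (by positivity) hℓF hℓG
    (fun t ht => (((h₁.fst t ht).add (h₂.fst t ht)).sub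
      ((h₃.fst t ht).const_smul (2 : ℝ))).congr_deriv (by module))
    (fun t ht => (((h₁.snd t ht).add (h₂.snd t ht)).sub
      ((h₃.snd t ht).const_smul (2 : ℝ))).congr_deriv (by module))
    (fun t ht => by
      have h1 := hF.three (q₁ t, w₁ t) (q₂ t, w₂ t) (q₃ t, w₃ t)
      have h2 := mul_le_mul_of_nonneg_left (sq t ht) hLF
      refine h1.trans ?_
      rw [mul_assoc LF]
      exact add_le_add le_rfl h2)
    (fun t ht => by
      have h1 := hG.three (q₁ t, w₁ t) (q₂ t, w₂ t) (q₃ t, w₃ t)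
      have h2 := mul_le_mul_of_nonneg_left (sq t ht) hLG
      refine h1.trans ?_
      rw [mul_assoc LG]
      exact add_le_add le_rfl h2)
    (fun t ht => (norm_add_sub_two_smul_le _ _ _).trans (by linarith [hC₁ t ht, hC₂ t ht, hC₃ t ht]))
    (fun t ht => by
      have he : Real.exp (μ * t) ≤ Real.exp (2 * μ * t) := Real.exp_le_exp.2 (by nlinarith)
      have up : ∀ A : ℝ, A * Real.exp (μ * t) ≤ |A| * Real.exp (2 * μ * t) := fun A => by
        have := Real.exp_pos (μ * t)
        calc A * Real.exp (μ * t) ≤ |A| * Real.exp (μ * t) := by gcongr; exact le_abs_self A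
          _ ≤ _ := by gcongr
      refine (norm_add_sub_two_smul_le _ _ _).trans ?_
      linarith [hA₁ t ht, hA₂ t ht, hA₃ t ht, up A₁, up A₂, up A₃]) ht
  refine this.trans (le_of_eq ?_)
  field_simp
  ring

end IsBackwardSolution

/-- Existence of a globally attracting slow manifold `w = h q` for `q' = F(q,w)`,
`w' = Λ(G(q,w) - w)`, of class `C^{1,1}` with constants independent of `Λ`. -/
theorem exists_slow_manifold [CompleteSpace E] [CompleteSpace H] {F : E × H → E} {G : E × H → H}
    {ℓF LF ℓG LG B Λ : ℝ} (hF : ThreePt ℓF LF F) (hG : ThreePt ℓG LG G) (hGB : ∀ a, ‖G a‖ ≤ B)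
    (hℓF : 0 < ℓF) (hLF : 0 ≤ LF) (hℓG : 0 ≤ ℓG) (hLG : 0 ≤ LG) (hG4 : 4 * ℓG ≤ 1)
    (hΛ : 8 * ℓF ≤ Λ) :
    ∃ h : E → H, ThreePt 2 (2 * (LF / ℓF + 8 * LG)) h ∧ (∀ q, ‖h q‖ ≤ B) ∧
      ∀ q, fderiv ℝ h q (F (q, h q)) = Λ • (G (q, h q) - h q) := by
  -- With `μ = 2 * ℓF` the condition `4 * μ ≤ Λ` of `norm_three_le` is exactly `8 * ℓF ≤ Λ`.
  have ex := exists_isBackwardSolution (μ := 2 * ℓF) (Λ := Λ) hF.lip hG.lip hGB (by linarith)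
    (by linarith) le_rfl hG4 hℓF.le hℓG
  choose q w hs h0 hB using ex
  have hThree : ThreePt 2 (2 * (LF / ℓF + 8 * LG)) (fun x => w x 0) := by
    constructor
    · intro a b
      have := (hs a).norm_sub_le (hs b) hF.lip hG.lip (by linarith)
        (by linarith) le_rfl hG4 hℓF.le hℓG le_rfl
      rw [h0, h0, mul_zero, Real.exp_zero, mul_one] at this
      exact (norm_snd_le (_ : E × H)).trans this
    · intro a b c
      have := (hs a).norm_three_le (hs b) (hs c) hF hG (by linarith)
        (by linarith) le_rfl hG4 hℓF.le hℓG hLF hLG le_rfl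
      rw [h0, h0, h0, mul_zero, Real.exp_zero, mul_one] at this
      refine ((norm_snd_le (_ : E × H)).trans this).trans (le_of_eq ?_)
      field_simp
  -- A time shift of the solution through `x` is again a backward solution, so by uniqueness it is
  -- the one through `q x s`: the graph is invariant.
  have hinv : ∀ x s, 0 ≤ s → w x s = w (q x s) 0 := by
    intro x s hs0
    have := ((hs x).shift hs0).norm_sub_le (hs (q x s)) hF.lip hG.lip (by linarith)
        (by linarith) le_rfl hG4 hℓF.le hℓG le_rfl
    simp only [zero_add, h0, sub_self, norm_zero, mul_zero, zero_mul] at this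
    have h2 := (norm_snd_le (_ : E × H)).trans this
    exact sub_eq_zero.1 (norm_le_zero_iff.1 h2)
  refine ⟨fun x => w x 0, hThree, fun x => hB x 0, fun x => ?_⟩
  obtain ⟨h', hh', -⟩ := hThree.exists_fderiv (by norm_num) (by positivity)
  rw [(hh' x).fderiv]
  have d1 : HasDerivWithinAt (w x) (Λ • (w x 0 - G (x, w x 0))) (Ici 0) 0 := by
    have := (hs x).snd 0 le_rfl
    rw [h0] at this
    exact this.hasDerivWithinAt
  -- Along the trajectory `w` equals `h ∘ q`. Comparing the chain rule with the equation for `w` at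
  -- time `0` gives the invariance equation; one-sided derivatives are used because invariance is
  -- known only for `s ≥ 0`.
  have d2 : HasDerivWithinAt (w x) (h' x (-F (x, w x 0))) (Ici 0) 0 := by
    have e := (hs x).fst 0 le_rfl
    rw [h0] at e
    have h1 := hh' x
    rw [← h0 x] at h1
    have := h1.comp_hasDerivAt (0 : ℝ) e
    rw [h0] at this
    exact this.hasDerivWithinAt.congr (fun s hs' => hinv x s hs') (hinv x 0 le_rfl)
  have := (uniqueDiffWithinAt_Ici (0 : ℝ)).eq_deriv _ d2 d1
  rw [map_neg] at this
  rw [← neg_neg (h' x _), this]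
  module

/-- Globally Lipschitz vector fields have global forward solutions. -/
theorem exists_forward_solution [CompleteSpace E] {V : E → E} {ℓ : ℝ}
    (hV : ∀ a b, ‖V a - V b‖ ≤ ℓ * ‖a - b‖) (x₀ : E) :
    ∃ x : ℝ → E, x 0 = x₀ ∧ ∀ t, 0 ≤ t → HasDerivAt x (V (x t)) t := by
  -- The forward problem for `V` is the reversed-time problem for `-V` with a trivial fast
  -- component.
  obtain ⟨q, w, h, h0, -⟩ := exists_isBackwardSolution (E := E) (H := ℝ) (F := fun p => -V p.1)
    (G := fun _ => 0) (ℓF := |ℓ|) (ℓG := 0) (B := 0) (μ := 2 * |ℓ| + 1) (Λ := 4 * |ℓ| + 2)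
    (fun a b => by
      rw [show -V a.1 - -V b.1 = -(V a.1 - V b.1) by abel, norm_neg]
      calc _ ≤ ℓ * ‖a.1 - b.1‖ := hV _ _
        _ ≤ |ℓ| * ‖a - b‖ := by
          gcongr
          · exact le_abs_self _
          · exact norm_fst_le (a - b))
    (by simp) (by simp) (by positivity) (by linarith) (by linarith) (by norm_num) (abs_nonneg _)
    le_rfl x₀
  exact ⟨q, h0, fun t ht => by simpa using h.fst t ht⟩

end SlowManifold

end

/-! ### Attraction to the graph, inward fields, uniqueness. -/

section

open Filter Topology MeasureTheory Set
open scoped RealInnerProductSpace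

section Attraction

variable {E H : Type*} [NormedAddCommGroup E] [InnerProductSpace ℝ E]
  [NormedAddCommGroup H] [InnerProductSpace ℝ H]

/-- By the invariance equation, `ρ = w - h q` satisfies `ρ' = -Λ ρ + error`. The error is at most
`(Λ ℓG + 2 ℓF) ‖ρ‖ ≤ Λ / 2 * ‖ρ‖`, so `‖ρ‖ ^ 2` decays at least at rate `Λ`. -/
theorem norm_sub_graph_sq_le {F : E × H → E} {G : E × H → H} {ℓF ℓG Λ : ℝ}
    {h : E → H} {h' : E → E →L[ℝ] H} (hF : ∀ a b, ‖F a - F b‖ ≤ ℓF * ‖a - b‖)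
    (hG : ∀ a b, ‖G a - G b‖ ≤ ℓG * ‖a - b‖) (hh : ∀ x, HasFDerivAt h (h' x) x)
    (hb : ∀ x, ‖h' x‖ ≤ 2) (hinv : ∀ q, h' q (F (q, h q)) = Λ • (G (q, h q) - h q))
    (hG4 : 4 * ℓG ≤ 1) (hΛ0 : 0 ≤ Λ) (hΛ : 8 * ℓF ≤ Λ) {q : ℝ → E} {w : ℝ → H}
    (hq : ∀ t, 0 ≤ t → HasDerivAt q (F (q t, w t)) t)
    (hw : ∀ t, 0 ≤ t → HasDerivAt w (Λ • (G (q t, w t) - w t)) t) {t : ℝ} (ht : 0 ≤ t) :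
    ‖w t - h (q t)‖ ^ 2 ≤ ‖w 0 - h (q 0)‖ ^ 2 * Real.exp (-Λ * t) := by
  let ρ : ℝ → H := fun t => w t - h (q t)
  have hρ : ∀ t, 0 ≤ t → HasDerivAt ρ (Λ • (G (q t, w t) - w t) - h' (q t) (F (q t, w t))) t :=
    fun t ht => (hw t ht).sub ((hh (q t)).comp_hasDerivAt t (hq t ht))
  have hφ : ∀ t, 0 ≤ t → HasDerivAt (fun t => Real.exp (Λ * t) * ‖ρ t‖ ^ 2)
      (Λ * Real.exp (Λ * t) * ‖ρ t‖ ^ 2 + Real.exp (Λ * t) *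
        (2 * ⟪ρ t, Λ • (G (q t, w t) - w t) - h' (q t) (F (q t, w t))⟫)) t := fun t ht =>
    (hasDerivAt_exp_const_mul Λ t).mul (hρ t ht).norm_sq
  have neg : ∀ t, 2 * ⟪ρ t, Λ • (G (q t, w t) - w t) - h' (q t) (F (q t, w t))⟫ ≤
      -Λ * ‖ρ t‖ ^ 2 := by
    intro t
    have e : Λ • (G (q t, w t) - w t) - h' (q t) (F (q t, w t)) =
        -(Λ • ρ t) + (Λ • (G (q t, w t) - G (q t, h (q t))) -
          h' (q t) (F (q t, w t) - F (q t, h (q t)))) := by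
      rw [map_sub, hinv]
      simp only [ρ]
      module
    have d : ‖(q t, w t) - (q t, h (q t))‖ = ‖ρ t‖ := by
      simp [Prod.norm_def, ρ]
    have h1 := hG (q t, w t) (q t, h (q t))
    have h2 := hF (q t, w t) (q t, h (q t))
    rw [d] at h1 h2
    have h3 : ‖h' (q t) (F (q t, w t) - F (q t, h (q t)))‖ ≤ 2 * (ℓF * ‖ρ t‖) :=
      ((h' (q t)).le_opNorm _).trans (mul_le_mul (hb _) h2 (norm_nonneg _) (by norm_num))
    have h4 : ‖Λ • (G (q t, w t) - G (q t, h (q t))) -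
          h' (q t) (F (q t, w t) - F (q t, h (q t)))‖ ≤ Λ / 2 * ‖ρ t‖ := by
      refine (norm_sub_le _ _).trans ?_
      rw [norm_smul, Real.norm_of_nonneg hΛ0]
      have := mul_le_mul_of_nonneg_left h1 hΛ0
      have h5 := norm_nonneg (ρ t)
      have h6 := mul_le_mul_of_nonneg_right hΛ h5
      have h7 := mul_le_mul_of_nonneg_right hG4 (mul_nonneg hΛ0 h5)
      nlinarith
    have h5 := (real_inner_le_norm (ρ t) (Λ • (G (q t, w t) - G (q t, h (q t))) -
          h' (q t) (F (q t, w t) - F (q t, h (q t))))).trans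
            (mul_le_mul_of_nonneg_left h4 (norm_nonneg _))
    rw [e, inner_add_right, inner_neg_right, inner_smul_right, real_inner_self_eq_norm_sq]
    nlinarith
  have mono := image_le_of_deriv_right_le_deriv_boundary
    (f := fun t => Real.exp (Λ * t) * ‖ρ t‖ ^ 2) (B := fun _ => ‖ρ 0‖ ^ 2) (B' := fun _ => 0)
    (a := 0) (b := t) (fun s hs => (hφ s hs.1).continuousAt.continuousWithinAt)
    (fun s hs => (hφ s hs.1).hasDerivWithinAt) (by simp) continuousOn_const
    (fun s _ => hasDerivWithinAt_const _ _ _)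
    (fun s _ => by
      have := mul_le_mul_of_nonneg_left (neg s) (Real.exp_pos (Λ * s)).le
      linarith) (right_mem_Icc.2 ht)
  have e1 : Real.exp (-Λ * t) * Real.exp (Λ * t) = 1 := by rw [← Real.exp_add]; simp
  calc ‖ρ t‖ ^ 2 = Real.exp (-Λ * t) * (Real.exp (Λ * t) * ‖ρ t‖ ^ 2) := by
        rw [← mul_assoc, e1, one_mul]
    _ ≤ Real.exp (-Λ * t) * ‖ρ 0‖ ^ 2 := by gcongr
    _ = _ := by rw [mul_comm]

end Attraction

/-- A field that points inwards on the unit sphere along the graph of `h` points inwards, with a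
uniform rate, on a neighbourhood. -/
theorem exists_inward_nhds {E H : Type*} [NormedAddCommGroup E] [InnerProductSpace ℝ E]
    [NormedAddCommGroup H] [ProperSpace E] {F : E × H → E} {ℓF : ℝ} {h : E → H}
    (hF : ∀ a b, ‖F a - F b‖ ≤ ℓF * ‖a - b‖) (hℓF : 0 ≤ ℓF)
    (hh : ∀ a b, ‖h a - h b‖ ≤ 2 * ‖a - b‖)
    (hin : ∀ q, ‖q‖ = 1 → ⟪F (q, h q), q⟫ < 0) :
    ∃ η c : ℝ, 0 < η ∧ η ≤ 1 ∧ 0 < c ∧ ∀ q w, 1 ≤ ‖q‖ → ‖q‖ ≤ 1 + η → ‖w - h q‖ ≤ η →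
      ⟪F (q, w), q⟫ ≤ -c := by
  have hc : Continuous h := (LipschitzWith.of_dist_le' (K := 2) fun a b => by
    simpa [dist_eq_norm] using hh a b).continuous
  have Fc : Continuous F := (LipschitzWith.of_dist_le' (K := ℓF) fun a b => by
    simpa [dist_eq_norm] using hF a b).continuous
  obtain ⟨c, hc0, hcb⟩ : ∃ c : ℝ, 0 < c ∧ ∀ q, ‖q‖ = 1 → ⟪F (q, h q), q⟫ ≤ -c := by
    rcases (Metric.sphere (0 : E) 1).eq_empty_or_nonempty with he | hne
    · refine ⟨1, one_pos, fun q hq => ?_⟩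
      have : q ∈ Metric.sphere (0 : E) 1 := by simpa using hq
      rw [he] at this
      exact this.elim
    · obtain ⟨x, hx, hmax⟩ := (isCompact_sphere (0 : E) 1).exists_isMaxOn hne
        (f := fun q => ⟪F (q, h q), q⟫) (Continuous.continuousOn (by fun_prop))
      refine ⟨-⟪F (x, h x), x⟫, by linarith [hin x (by simpa using hx)], fun q hq => ?_⟩
      rw [neg_neg]
      exact hmax (show q ∈ Metric.sphere (0 : E) 1 by simpa using hq)
  set M := ‖F (0, h 0)‖ + 2 * ℓF with hM
  have hM0 : 0 ≤ M := by positivity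
  -- Passing from `(q, w)` to the point `(p, h p)` over the unit sphere changes the inner product by
  -- at most `6 ℓF η + M η`, which this `η` keeps below `c / 2`.
  refine ⟨min 1 (c / (2 * (6 * ℓF + M + 1))), c / 2, by positivity, min_le_left _ _, by positivity,
    fun q w hq1 hq2 hw => ?_⟩
  set η := min 1 (c / (2 * (6 * ℓF + M + 1))) with hη
  have hη1 : η ≤ 1 := min_le_left _ _
  have hη2 : η * (2 * (6 * ℓF + M + 1)) ≤ c := by
    rw [← le_div_iff₀ (by positivity)]; exact min_le_right _ _
  have hη0 : 0 < η := by positivity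
  have hq0 : 0 < ‖q‖ := by linarith
  set p := (1 / ‖q‖) • q with hp
  have hpn : ‖p‖ = 1 := by
    rw [hp, norm_smul, Real.norm_of_nonneg (by positivity)]; field_simp
  have hqp : ‖q - p‖ ≤ η := by
    rw [show q - p = (1 - 1 / ‖q‖) • q by rw [hp]; module, norm_smul, Real.norm_of_nonneg
      (by rw [sub_nonneg, div_le_one hq0]; exact hq1), sub_mul, one_div, inv_mul_cancel₀ hq0.ne']
    linarith
  have h1 : ‖F (q, w) - F (p, h p)‖ ≤ 3 * ℓF * η := by
    have h2 : ‖w - h p‖ ≤ 3 * η := by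
      have := norm_add_le (w - h q) (h q - h p)
      rw [sub_add_sub_cancel] at this
      linarith [hh q p]
    have h3 : ‖(q, w) - (p, h p)‖ ≤ 3 * η := max_le (by simp; linarith) h2
    calc _ ≤ ℓF * ‖(q, w) - (p, h p)‖ := hF _ _
      _ ≤ ℓF * (3 * η) := by gcongr
      _ = _ := by ring
  have h4 : ‖F (p, h p)‖ ≤ M := by
    have h2 : ‖(p, h p) - ((0 : E), h 0)‖ ≤ 2 := by
      refine max_le (by simp [hpn]) ?_
      have := hh p 0
      rw [sub_zero, hpn, mul_one] at this
      exact this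
    have h3 := norm_add_le (F (0, h 0)) (F (p, h p) - F (0, h 0))
    rw [add_sub_cancel] at h3
    have := mul_le_mul_of_nonneg_left h2 hℓF
    linarith [hF (p, h p) (0, h 0)]
  have e : ⟪F (q, w), q⟫ = ⟪F (q, w) - F (p, h p), q⟫ + ⟪F (p, h p), q - p⟫ + ⟪F (p, h p), p⟫ := by
    rw [inner_sub_left, inner_sub_right]; ring
  have i1 := (real_inner_le_norm (F (q, w) - F (p, h p)) q).trans
    (mul_le_mul h1 (show ‖q‖ ≤ 2 by linarith) (norm_nonneg _) (by positivity))
  have i2 := (real_inner_le_norm (F (p, h p)) (q - p)).trans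
    (mul_le_mul h4 hqp (norm_nonneg _) hM0)
  have i3 := hcb p hpn
  rw [e]
  nlinarith

/-- A barrier argument: where `‖q‖ ^ 2` meets `1 + κ exp (-c t / 2)`, its derivative is at most `-2
c`, while the barrier decreases at rate at most `κ c / 2 ≤ 3 c / 2`. The case `κ = 0` gives
invariance of the ball, `κ > 0` attraction to it. -/
theorem norm_sq_le_of_inward {E H : Type*} [NormedAddCommGroup E] [InnerProductSpace ℝ E]
    [NormedAddCommGroup H] {F : E × H → E} {h : E → H} {η c : ℝ} (hη0 : 0 < η) (hη1 : η ≤ 1)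
    (hc : 0 < c)
    (hin : ∀ q w, 1 ≤ ‖q‖ → ‖q‖ ≤ 1 + η → ‖w - h q‖ ≤ η → ⟪F (q, w), q⟫ ≤ -c)
    {q : ℝ → E} {w : ℝ → H} (hq : ∀ t, 0 ≤ t → HasDerivAt q (F (q t, w t)) t)
    (hw : ∀ t, 0 ≤ t → ‖w t - h (q t)‖ ≤ η) {κ : ℝ} (hκ0 : 0 ≤ κ) (hκ : κ ≤ (1 + η) ^ 2 - 1)
    (h0 : ‖q 0‖ ^ 2 ≤ 1 + κ) {t : ℝ} (ht : 0 ≤ t) :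
    ‖q t‖ ^ 2 ≤ 1 + κ * Real.exp (-(c / 2) * t) := by
  have hκ3 : κ ≤ 3 := by nlinarith
  refine image_le_of_deriv_right_lt_deriv_boundary (f := fun t => ‖q t‖ ^ 2)
    (f' := fun t => 2 * ⟪q t, F (q t, w t)⟫) (a := 0) (b := t)
    (B := fun t => 1 + κ * Real.exp (-(c / 2) * t))
    (B' := fun t => κ * (-(c / 2) * Real.exp (-(c / 2) * t)))
    (fun s hs => ((hq s hs.1).norm_sq).continuousAt.continuousWithinAt)
    (fun s hs => ((hq s hs.1).norm_sq).hasDerivWithinAt) (by simpa using h0)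
    (fun s => ((hasDerivAt_exp_const_mul _ s).const_mul κ).const_add 1)
    (fun s hs hB => ?_) (right_mem_Icc.2 ht)
  have he0 := Real.exp_pos (-(c / 2) * s)
  have he1 : Real.exp (-(c / 2) * s) ≤ 1 := Real.exp_le_one_iff.2 (by nlinarith [hs.1])
  have hp : 0 ≤ κ * Real.exp (-(c / 2) * s) := by positivity
  have hp' : κ * Real.exp (-(c / 2) * s) ≤ κ := by nlinarith
  have hB' : ‖q s‖ ^ 2 = 1 + κ * Real.exp (-(c / 2) * s) := hB
  have n1 : 1 ≤ ‖q s‖ := by nlinarith [norm_nonneg (q s)]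
  have n2 : ‖q s‖ ≤ 1 + η := by nlinarith [norm_nonneg (q s)]
  have := hin (q s) (w s) n1 n2 (hw s hs.1)
  rw [real_inner_comm]
  nlinarith

/-- A quadratic field is only locally Lipschitz, so a Lipschitz constant is taken on the compact
union of the two trajectories. It identifies an arbitrary solution near the manifold with the one
constructed from the truncated system. -/
theorem ODE_unique_of_contDiff {X : Type*} [NormedAddCommGroup X] [NormedSpace ℝ X] [ProperSpace X]
    {V : X → X} (hV : ContDiff ℝ 1 V) {T : ℝ} {f g : ℝ → X}
    (hf : IsIntegralCurveOn f (fun _ => V) (Icc 0 T))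
    (hg : IsIntegralCurveOn g (fun _ => V) (Icc 0 T)) (h0 : f 0 = g 0) : EqOn f g (Icc 0 T) := by
  have fc : ContinuousOn f (Icc 0 T) := fun t ht => (hf t ht).continuousWithinAt
  have gc : ContinuousOn g (Icc 0 T) := fun t ht => (hg t ht).continuousWithinAt
  obtain ⟨K, hK⟩ := (hV.locallyLipschitz.locallyLipschitzOn).exists_lipschitzOnWith_of_compact
    ((isCompact_Icc.image_of_continuousOn fc).union (isCompact_Icc.image_of_continuousOn gc))
  have right : ∀ {γ : ℝ → X}, IsIntegralCurveOn γ (fun _ => V) (Icc 0 T) → ∀ t ∈ Ico 0 T,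
      HasDerivWithinAt γ (V (γ t)) (Ici t) t := fun hγ t ht =>
    (hγ t (Ico_subset_Icc_self ht)).mono_of_mem_nhdsWithin
      (mem_of_superset (Icc_mem_nhdsGE ht.2) (Icc_subset_Icc_left ht.1))
  exact ODE_solution_unique_of_mem_Icc_right (v := fun _ => V) (K := K) (fun _ _ => hK) fc
    (right hf) (fun t ht => Or.inl ⟨t, Ico_subset_Icc_self ht, rfl⟩) gc (right hg)
    (fun t ht => Or.inr ⟨t, Ico_subset_Icc_self ht, rfl⟩) h0

end

/-! ### From a slow manifold to a realization. -/

section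

open Filter Topology MeasureTheory Set
open scoped RealInnerProductSpace

theorem uniqueDiffOn_unitBall (n : ℕ) : UniqueDiffOn ℝ (unitBall n) :=
  uniqueDiffOn_convex (convex_closedBall _ _)
    ⟨0, Metric.ball_subset_interior_closedBall (Metric.mem_ball_self one_pos)⟩

theorem HasFDerivAt.fderivWithin_unitBall {n m : ℕ}
    {f : EuclideanSpace ℝ (Fin n) → EuclideanSpace ℝ (Fin m)}
    {f' : EuclideanSpace ℝ (Fin n) →L[ℝ] EuclideanSpace ℝ (Fin m)} {q : EuclideanSpace ℝ (Fin n)}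
    (hf : HasFDerivAt f f' q) (hq : q ∈ unitBall n) : fderivWithin ℝ f (unitBall n) q = f' :=
  hf.hasFDerivWithinAt.fderivWithin (uniqueDiffOn_unitBall n q hq)

theorem ThreePt.contDiff {X Y : Type*} [NormedAddCommGroup X] [NormedSpace ℝ X]
    [NormedAddCommGroup Y] [NormedSpace ℝ Y] [CompleteSpace Y] {ℓ L : ℝ} {f : X → Y}
    (hf : ThreePt ℓ L f) (hℓ : 0 ≤ ℓ) (hL : 0 ≤ L) : ContDiff ℝ 1 f := by
  obtain ⟨f', h1, -, h3, -⟩ := hf.exists_fderiv hℓ hL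
  have hc : Continuous f' := (LipschitzWith.of_dist_le' (K := 12 * L) fun a b => by
    simpa [dist_eq_norm] using h3 a b).continuous
  rw [contDiff_one_iff_fderiv]
  refine ⟨fun x => (h1 x).differentiableAt, ?_⟩
  rwa [show fderiv ℝ f = f' from funext fun x => (h1 x).fderiv]

theorem ThreePt.isC1Plus {n m : ℕ} {ℓ L : ℝ}
    {f : EuclideanSpace ℝ (Fin n) → EuclideanSpace ℝ (Fin m)}
    (hf : ThreePt ℓ L f) (hℓ : 0 ≤ ℓ) (hL : 0 ≤ L) : IsC1Plus f := by
  refine ⟨(hf.contDiff hℓ hL).contDiffOn, ?_⟩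
  obtain ⟨f', h1, -, h3, -⟩ := hf.exists_fderiv hℓ hL
  have lip : LipschitzOnWith (12 * L).toNNReal (fderivWithin ℝ f (unitBall n)) (unitBall n) :=
    LipschitzOnWith.of_dist_le' fun x hx y hy => by
      rw [(h1 x).fderivWithin_unitBall hx, (h1 y).fderivWithin_unitBall hy, dist_eq_norm,
        dist_eq_norm]
      exact h3 x y
  obtain ⟨C, hC⟩ := HolderOnWith.exists_holderOnWith_of_le (s := 1 / 2)
    ⟨_, lip.holderOnWith⟩ (by rw [← NNReal.coe_le_coe]; norm_num) Metric.isBounded_closedBall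
  exact ⟨1 / 2, C, by norm_num, by rw [← NNReal.coe_lt_coe]; norm_num, hC⟩

/-- A system that, in suitable linear coordinates, coincides with a slow-fast system near the slow
manifold `w = h q` realizes the reduced field `q ↦ F (q, h q)`. -/
theorem epsRealizes_of_slow_manifold {n N : ℕ} {H : Type*} [NormedAddCommGroup H]
    [InnerProductSpace ℝ H] [CompleteSpace H] {ε : ℝ}
    {Q : EuclideanSpace ℝ (Fin n) → EuclideanSpace ℝ (Fin n)}
    {V : EuclideanSpace ℝ (Fin N) → EuclideanSpace ℝ (Fin N)} (hV : ContDiff ℝ 1 V)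
    (T : EuclideanSpace ℝ (Fin n) × H →L[ℝ] EuclideanSpace ℝ (Fin N))
    (hT : Function.Surjective T) (π : EuclideanSpace ℝ (Fin N) →L[ℝ] EuclideanSpace ℝ (Fin n))
    (hπ : ∀ p, π (T p) = p.1)
    {F : EuclideanSpace ℝ (Fin n) × H → EuclideanSpace ℝ (Fin n)}
    {G : EuclideanSpace ℝ (Fin n) × H → H} {ℓF LF ℓG LG L B Λ R : ℝ}
    (hF : ThreePt ℓF LF F) (hG : ThreePt ℓG LG G)
    (hℓF : 0 < ℓF) (hLF : 0 ≤ LF) (hL : 0 ≤ L) (hG4 : 4 * ℓG ≤ 1)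
    (hΛ : 8 * ℓF ≤ Λ)
    {h : EuclideanSpace ℝ (Fin n) → H} (hh : ThreePt 2 L h) (hB : ∀ q, ‖h q‖ ≤ B)
    (hinv : ∀ q, fderiv ℝ h q (F (q, h q)) = Λ • (G (q, h q) - h q)) (hR : B + 1 ≤ R)
    (hVT : ∀ q w, ‖q‖ ≤ 2 → ‖w‖ ≤ R → V (T (q, w)) = T (F (q, w), Λ • (G (q, w) - w)))
    (hin : ∀ q, ‖q‖ = 1 → ⟪F (q, h q), q⟫ < 0) (hQ : ContDiffOn ℝ 1 Q (unitBall n))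
    (hε : c1Norm (fun q => F (q, h q) - Q q) < ε) : EpsRealizes ε Q V := by
  have hΛ0 : 0 < Λ := by linarith
  have hg : ThreePt 2 L (fun q => (q, h q)) := by
    have h1 := ((ThreePt.clm (ContinuousLinearMap.id ℝ (EuclideanSpace ℝ (Fin n)))).mono
      (ℓ' := 2) (L' := L) (ContinuousLinearMap.norm_id_le.trans (by norm_num)) hL).prodMk hh
    simpa using h1
  have hZ : ThreePt (‖T‖ * 2) (‖T‖ * L) (fun q => T (q, h q)) := by
    simpa using (ThreePt.clm T).comp hg (norm_nonneg _) le_rfl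
  have hf : ThreePt (ℓF * 2) (ℓF * L + LF * 2 ^ 2) (fun q => F (q, h q)) := hF.comp hg hℓF.le hLF
  obtain ⟨h', hh1, hh2, -, -⟩ := hh.exists_fderiv (by norm_num) hL
  replace hinv : ∀ q, h' q (F (q, h q)) = Λ • (G (q, h q) - h q) := fun q => by
    rw [← (hh1 q).fderiv]; exact hinv q
  obtain ⟨η, c, hη0, hη1, hc, hinw⟩ := exists_inward_nhds hF.lip hℓF.le hh.lip hin
  -- solutions on the manifold
  have onM : ∀ q₀ ∈ unitBall n, ∃ q : ℝ → EuclideanSpace ℝ (Fin n), q 0 = q₀ ∧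
      (∀ t, 0 ≤ t → q t ∈ unitBall n) ∧
      (∀ t, 0 ≤ t → HasDerivAt q (F (q t, h (q t))) t) ∧
      ∀ t, 0 ≤ t → HasDerivAt (fun t => T (q t, h (q t))) (V (T (q t, h (q t)))) t := by
    intro q₀ hq₀
    obtain ⟨q, hq0, hq⟩ := exists_forward_solution hf.lip q₀
    have hball : ∀ t, 0 ≤ t → q t ∈ unitBall n := by
      intro t ht
      have := norm_sq_le_of_inward hη0 hη1 hc hinw (w := fun t => h (q t)) (κ := 0) hq
        (fun t _ => by simp [hη0.le]) le_rfl (by nlinarith)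
        (by
          have : ‖q 0‖ ≤ 1 := by simpa [hq0] using hq₀
          nlinarith [norm_nonneg (q 0)]) ht
      have h2 : ‖q t‖ ≤ 1 := by nlinarith [norm_nonneg (q t)]
      simpa using h2
    refine ⟨q, hq0, hball, hq, fun t ht => ?_⟩
    have h1 : ‖q t‖ ≤ 1 := by simpa using hball t ht
    rw [hVT _ _ (h1.trans (by norm_num)) ((hB _).trans (by linarith)), ← hinv]
    exact T.hasFDerivAt.comp_hasDerivAt t
      ((hq t ht).prodMk ((hh1 (q t)).comp_hasDerivAt t (hq t ht)))
  -- solutions near the manifold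
  have near : ∀ (q₀ : EuclideanSpace ℝ (Fin n)) (w₀ : H), ‖q₀‖ < 1 + η → ‖w₀ - h q₀‖ < η →
      ∃ γ : ℝ → EuclideanSpace ℝ (Fin N), γ 0 = T (q₀, w₀) ∧
        (∀ t, 0 ≤ t → HasDerivAt γ (V (γ t)) t) ∧
        ∀ t, 0 ≤ t → Metric.infDist (γ t) ((fun q => T (q, h q)) '' unitBall n) ≤
          ‖T‖ * (Real.exp (-(Λ / 2) * t) + 9 * Real.exp (-(c / 2) * t)) := by
    intro q₀ w₀ hq₀ hw₀
    -- The truncated slow-fast field is globally Lipschitz, so its solutions are global. They are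
    -- shown to remain where it agrees with `V`, and hence become solutions of the original system.
    have hL1 := hF.prodMk ((hG.sub (ThreePt.clm (ContinuousLinearMap.snd ℝ _ H))).smul Λ)
    obtain ⟨x, hx0, hx⟩ := exists_forward_solution hL1.lip (q₀, w₀)
    have hq : ∀ t, 0 ≤ t → HasDerivAt (fun t => (x t).1) (F ((x t).1, (x t).2)) t :=
      fun t ht => (hx t ht).fst
    have hw : ∀ t, 0 ≤ t →
        HasDerivAt (fun t => (x t).2) (Λ • (G ((x t).1, (x t).2) - (x t).2)) t :=
      fun t ht => (hx t ht).snd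
    have dec : ∀ t, 0 ≤ t → ‖(x t).2 - h (x t).1‖ ≤ η * Real.exp (-(Λ / 2) * t) := by
      intro t ht
      have h1 := norm_sub_graph_sq_le hF.lip hG.lip hh1 hh2 hinv hG4 hΛ0.le hΛ hq hw ht
      simp only [hx0] at h1
      have h2 : ‖w₀ - h q₀‖ ^ 2 ≤ η ^ 2 := pow_le_pow_left₀ (norm_nonneg _) hw₀.le 2
      refine le_of_sq_le_sq ?_ (by positivity)
      rw [mul_pow, ← Real.exp_nat_mul]
      calc _ ≤ _ := h1
        _ ≤ η ^ 2 * Real.exp (-Λ * t) := by gcongr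
        _ = _ := by congr 2; push_cast; ring
    have dec' : ∀ t, 0 ≤ t → ‖(x t).2 - h (x t).1‖ ≤ η := by
      intro t ht
      have : Real.exp (-(Λ / 2) * t) ≤ 1 := Real.exp_le_one_iff.2 (by nlinarith)
      nlinarith [dec t ht]
    have qb : ∀ t, 0 ≤ t → ‖(x t).1‖ ^ 2 ≤ 1 + ((1 + η) ^ 2 - 1) * Real.exp (-(c / 2) * t) :=
      fun t ht => norm_sq_le_of_inward hη0 hη1 hc hinw hq dec' (by nlinarith) le_rfl
        (by
          simp only [hx0]
          have := pow_le_pow_left₀ (norm_nonneg _) hq₀.le 2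
          linarith) ht
    have qb3 : ∀ t, 0 ≤ t → ‖(x t).1‖ ^ 2 ≤ 1 + 3 * Real.exp (-(c / 2) * t) := by
      intro t ht
      have h1 : (1 + η) ^ 2 - 1 ≤ 3 := by nlinarith
      have h2 := mul_le_mul_of_nonneg_right h1 (Real.exp_pos (-(c / 2) * t)).le
      linarith [qb t ht]
    refine ⟨fun t => T (x t), by simp only [hx0], fun t ht => ?_, fun t ht => ?_⟩
    · have e1 : Real.exp (-(c / 2) * t) ≤ 1 := Real.exp_le_one_iff.2 (by nlinarith)
      have h1 := qb3 t ht
      have h2 : ‖(x t).1‖ ≤ 2 := by nlinarith [norm_nonneg (x t).1]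
      have h3 : ‖(x t).2‖ ≤ R := by
        have := norm_add_le ((x t).2 - h (x t).1) (h (x t).1)
        rw [sub_add_cancel] at this
        linarith [dec' t ht, hB (x t).1]
      have := hVT (x t).1 (x t).2 h2 h3
      change HasDerivAt _ (V (T ((x t).1, (x t).2))) t
      rw [this]
      exact T.hasFDerivAt.comp_hasDerivAt t (hx t ht)
    · have e0 := Real.exp_pos (-(c / 2) * t)
      -- The point `p` is the radial projection of the slow component to the ball; outside the ball
      -- `‖q‖ - 1 ≤ ‖q‖ ^ 2 - 1`, which decays exponentially.
      obtain ⟨p, hp, hqp⟩ : ∃ p ∈ unitBall n, ‖(x t).1 - p‖ ≤ 3 * Real.exp (-(c / 2) * t) := by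
        rcases le_or_gt ‖(x t).1‖ 1 with h1 | h1
        · exact ⟨(x t).1, by simpa using h1, by simp only [sub_self, norm_zero]; positivity⟩
        · have h0 : 0 < ‖(x t).1‖ := by linarith
          refine ⟨(1 / ‖(x t).1‖) • (x t).1, ?_, ?_⟩
          · rw [mem_closedBall_zero_iff, norm_smul, Real.norm_of_nonneg (by positivity)]
            field_simp; rfl
          · rw [show (x t).1 - (1 / ‖(x t).1‖) • (x t).1 = (1 - 1 / ‖(x t).1‖) • (x t).1 by module,
              norm_smul, Real.norm_of_nonneg (by rw [sub_nonneg, div_le_one h0]; exact h1.le),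
              sub_mul, one_div, inv_mul_cancel₀ h0.ne']
            nlinarith [qb3 t ht]
      have hm : T (p, h p) ∈ (fun q => T (q, h q)) '' unitBall n := ⟨p, hp, rfl⟩
      refine (Metric.infDist_le_dist_of_mem hm).trans ?_
      rw [dist_eq_norm, ← map_sub]
      refine (T.le_opNorm _).trans ?_
      gcongr
      have h1 : ‖(x t).2 - h p‖ ≤ Real.exp (-(Λ / 2) * t) + 6 * Real.exp (-(c / 2) * t) := by
        have h2 := norm_add_le ((x t).2 - h (x t).1) (h (x t).1 - h p)
        rw [sub_add_sub_cancel] at h2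
        have h3 := Real.exp_pos (-(Λ / 2) * t)
        nlinarith [hh.lip (x t).1 p, dec t ht]
      have h3 := Real.exp_pos (-(Λ / 2) * t)
      refine max_le ?_ ?_
      · exact hqp.trans (by linarith)
      · exact h1.trans (by linarith)
  refine ⟨fun q => T (q, h q), fun q => F (q, h q) - Q q, hZ.isC1Plus (by positivity)
    (by positivity), ⟨fun a _ b _ hab => ?_, fun q hq => ?_⟩, ?_, ?_,
    ((hf.contDiff (by positivity) (by positivity)).contDiffOn).sub hQ, hε, ?_⟩
  · have := congrArg π hab
    simpa [hπ] using this
  · have hd : HasFDerivAt (fun q => T (q, h q))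
        (T.comp ((ContinuousLinearMap.id ℝ _).prod (h' q))) q :=
      T.hasFDerivAt.comp q ((hasFDerivAt_id q).prodMk (hh1 q))
    rw [hd.fderivWithin_unitBall hq]
    intro u v huv
    have := congrArg π huv
    simpa [hπ] using this
  · rintro x ⟨q₀, hq₀, rfl⟩ t ht
    obtain ⟨q, h0, hb, -, hd⟩ := onM q₀ hq₀
    refine ⟨T (q t, h (q t)), ⟨q t, hb t ht, rfl⟩, fun t => T (q t, h (q t)), by simp only [h0], rfl,
      fun s hs => (hd s hs.1).hasDerivWithinAt⟩
  -- The neighbourhood is the image of a tube around the graph. It is open because `T`, being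
  -- surjective between complete spaces, is an open map; `T` need not be injective.
  · refine ⟨T '' {p | ‖p.1‖ < 1 + η ∧ ‖p.2 - h p.1‖ < η}, ?_, ?_, ?_, ?_⟩
    · refine T.isOpenMap hT _ ?_
      have hc := hh.continuous
      have o1 : IsOpen {p : EuclideanSpace ℝ (Fin n) × H | ‖p.1‖ < 1 + η} :=
        isOpen_lt (by fun_prop) continuous_const
      have o2 : IsOpen {p : EuclideanSpace ℝ (Fin n) × H | ‖p.2 - h p.1‖ < η} :=
        isOpen_lt (by fun_prop) continuous_const
      exact o1.inter o2
    · rintro _ ⟨q, hq, rfl⟩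
      have : ‖q‖ ≤ 1 := by simpa using hq
      exact ⟨(q, h q), ⟨by simp only; linarith, by simpa using hη0⟩, rfl⟩
    · rintro _ ⟨⟨q, w⟩, ⟨hq, hw⟩, rfl⟩ t ht
      obtain ⟨γ, h0, hd, -⟩ := near q w hq hw
      exact ⟨γ t, γ, h0, rfl, fun s hs => (hd s hs.1).hasDerivWithinAt⟩
    · intro δ hδ
      have lim : Tendsto (fun t => ‖T‖ * (Real.exp (-(Λ / 2) * t) + 9 * Real.exp (-(c / 2) * t)))
          atTop (𝓝 (‖T‖ * (0 + 9 * 0))) := by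
        have l : ∀ a : ℝ, 0 < a → Tendsto (fun t => Real.exp (-a * t)) atTop (𝓝 0) := fun a ha =>
          Real.tendsto_exp_atBot.comp (tendsto_id.const_mul_atTop_of_neg (neg_lt_zero.2 ha))
        exact ((l _ (by positivity)).add ((l _ (by positivity)).const_mul 9)).const_mul _
      rw [mul_zero, add_zero, mul_zero] at lim
      obtain ⟨T₀, hT₀⟩ := eventually_atTop.1 (lim.eventually (gt_mem_nhds hδ))
      refine ⟨max T₀ 0, le_max_right _ _, fun t ht x hx y hy => ?_⟩
      obtain ⟨⟨q, w⟩, ⟨hq, hw⟩, rfl⟩ := hx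
      obtain ⟨γ, h0, hd, hdist⟩ := near q w hq hw
      obtain ⟨β, hβ0, rfl, hβ⟩ := hy
      have ht0 : 0 ≤ t := (le_max_right _ _).trans ht
      have := ODE_unique_of_contDiff hV hβ (fun s hs => (hd s hs.1).hasDerivWithinAt)
        (hβ0.trans h0.symm) (right_mem_Icc.2 ht0)
      rw [this]
      exact (hdist t ht0).trans_lt (hT₀ t ((le_max_left _ _).trans ht))
  · intro q₀ hq₀
    obtain ⟨q, h0, hb, hd, hd'⟩ := onM q₀ hq₀
    refine ⟨q, h0, hb, fun t ht => ?_, fun t ht => (hd' t ht).hasDerivWithinAt⟩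
    simpa using (hd t ht).hasDerivWithinAt

end

/-! ### Polynomial approximation in `C¹` of the ball. -/

section

open Filter Topology MeasureTheory Set
open scoped Convolution

section PolynomialApproximation

variable {n : ℕ}

/-- A polynomial as a function on `ℝⁿ`. -/
noncomputable def polyFun (p : MvPolynomial (Fin n) ℝ) (x : EuclideanSpace ℝ (Fin n)) : ℝ :=
  MvPolynomial.eval x p

theorem contDiff_polyFun (p : MvPolynomial (Fin n) ℝ) {k : WithTop ℕ∞} :
    ContDiff ℝ k (polyFun p) := by
  unfold polyFun
  induction p using MvPolynomial.induction_on with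
  | C a => simpa using contDiff_const
  | add p q hp hq => simpa using hp.add hq
  | mul_X p i hp =>
    simp only [map_mul, MvPolynomial.eval_X]
    exact hp.mul (EuclideanSpace.proj (𝕜 := ℝ) i).contDiff

theorem continuous_polyFun (p : MvPolynomial (Fin n) ℝ) : Continuous (polyFun p) :=
  (contDiff_polyFun p (k := 0)).continuous

theorem polyFun_add (p q : MvPolynomial (Fin n) ℝ) (x : EuclideanSpace ℝ (Fin n)) :
    polyFun (p + q) x = polyFun p x + polyFun q x := by simp [polyFun]

theorem polyFun_sub (p q : MvPolynomial (Fin n) ℝ) (x : EuclideanSpace ℝ (Fin n)) :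
    polyFun (p - q) x = polyFun p x - polyFun q x := by simp [polyFun]

theorem polyFun_mul_X (p : MvPolynomial (Fin n) ℝ) (i : Fin n) (x : EuclideanSpace ℝ (Fin n)) :
    polyFun (p * MvPolynomial.X i) x = polyFun p x * x i := by simp [polyFun]

/-- Weierstrass approximation on a ball of `ℝⁿ`. -/
theorem exists_mvPolynomial_near {f : EuclideanSpace ℝ (Fin n) → ℝ} (hf : Continuous f) (R : ℝ)
    {η : ℝ} (hη : 0 < η) :
    ∃ p : MvPolynomial (Fin n) ℝ, ∀ x : EuclideanSpace ℝ (Fin n), ‖x‖ ≤ R →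
      |polyFun p x - f x| ≤ η := by
  let X := Metric.closedBall (0 : EuclideanSpace ℝ (Fin n)) R
  have : CompactSpace X := isCompact_iff_compactSpace.1 (isCompact_closedBall _ _)
  let c : Fin n → C(X, ℝ) := fun i => ⟨fun x => x.1 i, by fun_prop⟩
  let A : Subalgebra ℝ C(X, ℝ) := (MvPolynomial.aeval c).range
  have sep : A.SeparatesPoints := by
    intro x y hxy
    obtain ⟨i, hi⟩ : ∃ i, x.1 i ≠ y.1 i := by
      by_contra! hcon
      exact hxy (Subtype.ext (by ext i; exact hcon i))
    exact ⟨c i, ⟨c i, ⟨MvPolynomial.X i, by simp⟩, rfl⟩, hi⟩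
  obtain ⟨⟨_, p, rfl⟩, hp⟩ := ContinuousMap.exists_mem_subalgebra_near_continuous_of_separatesPoints
    A sep (fun x => f x.1) (by fun_prop) η hη
  refine ⟨p, fun x hx => ?_⟩
  have key : ∀ (x : X) (p : MvPolynomial (Fin n) ℝ),
      (MvPolynomial.aeval c p) x = polyFun p x.1 := by
    intro x p
    induction p using MvPolynomial.induction_on with
    | C a => simp [polyFun]
    | add p q hp hq => simp_all [polyFun]
    | mul_X p i hp => simp_all [polyFun, c]
  have := hp ⟨x, by simpa [X] using hx⟩
  rw [← key ⟨x, by simpa [X] using hx⟩]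
  exact this.le

/-- The convolution of a polynomial with a compactly supported function is a polynomial. -/
theorem exists_mvPolynomial_eq_convolution (p : MvPolynomial (Fin n) ℝ) :
    ∀ g : EuclideanSpace ℝ (Fin n) → ℝ, Continuous g → HasCompactSupport g →
    ∃ P : MvPolynomial (Fin n) ℝ, ∀ x : EuclideanSpace ℝ (Fin n),
      ∫ y, polyFun p (x - y) * g y = polyFun P x := by
  induction p using MvPolynomial.induction_on with
  | C a =>
    intro g _ _
    exact ⟨MvPolynomial.C (∫ y, a * g y), fun x => by simp [polyFun]⟩
  | add p q hp hq =>
    intro g hg hc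
    obtain ⟨P, hP⟩ := hp g hg hc
    obtain ⟨P', hP'⟩ := hq g hg hc
    refine ⟨P + P', fun x => ?_⟩
    have int : ∀ p : MvPolynomial (Fin n) ℝ,
        Integrable (fun y => polyFun p (x - y) * g y) := fun p =>
      (((continuous_polyFun p).comp (continuous_const.sub continuous_id)).mul
        hg).integrable_of_hasCompactSupport hc.mul_left
    rw [polyFun_add, ← hP, ← hP']
    simp only [polyFun_add, add_mul]
    exact integral_add (int p) (int q)
  | mul_X p i hp =>
    intro g hg hc
    obtain ⟨P, hP⟩ := hp g hg hc
    -- Since `(x - y) i = x i - y i`, the extra factor produces a convolution with `y i * g y`;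
    -- hence the induction is over all `g` at once.
    obtain ⟨P', hP'⟩ := hp (fun y => y i * g y) (by fun_prop) hc.mul_left
    refine ⟨P * MvPolynomial.X i - P', fun x => ?_⟩
    have int : ∀ g : EuclideanSpace ℝ (Fin n) → ℝ, Continuous g → HasCompactSupport g →
        Integrable (fun y => polyFun p (x - y) * g y) := fun g hg hc =>
      (((continuous_polyFun p).comp (continuous_const.sub continuous_id)).mul
        hg).integrable_of_hasCompactSupport hc.mul_left
    rw [polyFun_sub, polyFun_mul_X, ← hP, ← hP']
    simp only [polyFun_mul_X]
    rw [← integral_mul_const, ← integral_sub ((int g hg hc).mul_const _)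
      (int (fun y => y i * g y) (by fun_prop) hc.mul_left)]
    congr 1
    funext y
    simp only [PiLp.sub_apply]
    ring

/-- Only the values of `f₁` and `f₂` on the ball of radius `1 + R` enter, so a polynomial can stand
in for a mollifier. The target `Y` covers both a function and its derivative. -/
theorem norm_convolution_sub_le {Y : Type*} [NormedAddCommGroup Y] [NormedSpace ℝ Y]
    {f₁ f₂ : EuclideanSpace ℝ (Fin n) → ℝ} {k : EuclideanSpace ℝ (Fin n) → Y}
    (h₁ : Continuous f₁) (h₂ : Continuous f₂) (hk : Continuous k) {R η : ℝ}
    (hsupp : ∀ y, k y ≠ 0 → ‖y‖ ≤ R) (hc : HasCompactSupport k)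
    (hf : ∀ x : EuclideanSpace ℝ (Fin n), ‖x‖ ≤ 1 + R → |f₁ x - f₂ x| ≤ η)
    {x : EuclideanSpace ℝ (Fin n)} (hx : ‖x‖ ≤ 1) :
    ‖(f₁ ⋆[ContinuousLinearMap.lsmul ℝ ℝ, volume] k) x -
      (f₂ ⋆[ContinuousLinearMap.lsmul ℝ ℝ, volume] k) x‖ ≤ η * ∫ y, ‖k y‖ := by
  have int : ∀ f : EuclideanSpace ℝ (Fin n) → ℝ, Continuous f →
      Integrable (fun y => f (x - y) • k y) := fun f hf =>
    ((hf.comp (continuous_const.sub continuous_id)).smul hk).integrable_of_hasCompactSupport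
      hc.smul_left
  rw [convolution_lsmul_swap, convolution_lsmul_swap, ← integral_sub (int _ h₁) (int _ h₂),
    ← integral_const_mul]
  refine norm_integral_le_of_norm_le
    ((hk.norm.integrable_of_hasCompactSupport hc.norm).const_mul η) (Eventually.of_forall fun y => ?_)
  rw [← sub_smul, norm_smul, Real.norm_eq_abs]
  by_cases hy : k y = 0
  · simp [hy]
  · gcongr
    exact hf _ ((norm_sub_le _ _).trans (add_le_add hx (hsupp y hy)))

/-- Compactly supported `C¹` functions are approximated in `C¹` of the unit ball by polynomials. -/
theorem exists_mvPolynomial_c1_near {g : EuclideanSpace ℝ (Fin n) → ℝ} (hg : ContDiff ℝ 1 g)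
    (hc : HasCompactSupport g) {η : ℝ} (hη : 0 < η) :
    ∃ P : MvPolynomial (Fin n) ℝ, ∀ x : EuclideanSpace ℝ (Fin n), ‖x‖ ≤ 1 →
      |polyFun P x - g x| ≤ η ∧
      ‖fderiv ℝ (polyFun P) x - fderiv ℝ g x‖
        ≤ η := by
  have hD : Continuous (fderiv ℝ g) := hg.continuous_fderiv one_ne_zero
  have hcD : HasCompactSupport (fderiv ℝ g) := hc.fderiv ℝ
  obtain ⟨δ₁, hδ₁, u₁⟩ := Metric.uniformContinuous_iff.1
    (hc.uniformContinuous_of_continuous hg.continuous) (η / 2) (by positivity)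
  obtain ⟨δ₂, hδ₂, u₂⟩ := Metric.uniformContinuous_iff.1
    (hcD.uniformContinuous_of_continuous hD) (η / 2) (by positivity)
  let φ : ContDiffBump (0 : EuclideanSpace ℝ (Fin n)) :=
    ⟨min δ₁ δ₂ / 2, min δ₁ δ₂, by positivity, by
      have : 0 < min δ₁ δ₂ := lt_min hδ₁ hδ₂
      linarith⟩
  set ψ := φ.normed volume with hψ
  have hψc : Continuous ψ := φ.continuous_normed
  obtain ⟨R₁, hR₁⟩ := hc.isCompact.isBounded.exists_norm_le
  obtain ⟨R₂, hR₂⟩ := hcD.isCompact.isBounded.exists_norm_le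
  set I := (∫ y, ‖g y‖) + ∫ y, ‖fderiv ℝ g y‖ with hI
  have hI1 : 0 ≤ ∫ y, ‖g y‖ := integral_nonneg fun _ => norm_nonneg _
  have hI2 : 0 ≤ ∫ y, ‖fderiv ℝ g y‖ := integral_nonneg fun _ => norm_nonneg _
  -- The mollifier `ψ` is replaced by a polynomial `p`. Then `p ⋆ g` is a polynomial with derivative
  -- `p ⋆ Dg`, so the same `p` serves for `g` and its derivative.
  obtain ⟨p, hp⟩ := exists_mvPolynomial_near hψc (1 + max R₁ R₂) (η := η / (2 * (I + 1)))
    (by positivity)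
  have hpc : Continuous (polyFun p) :=
    (continuous_polyFun p)
  obtain ⟨P, hP⟩ := exists_mvPolynomial_eq_convolution p g hg.continuous hc
  have eP : (polyFun P) =
      ((polyFun p)
        ⋆[ContinuousLinearMap.lsmul ℝ ℝ, volume] g) := by
    funext x
    rw [convolution_lsmul_swap, ← hP]
    rfl
  have dP : ∀ x : EuclideanSpace ℝ (Fin n),
      HasFDerivAt (polyFun P)
      (((polyFun p)
        ⋆[ContinuousLinearMap.lsmul ℝ ℝ, volume] (fderiv ℝ g)) x) x := by
    intro x
    rw [eP]
    exact hc.hasFDerivAt_convolution_right (ContinuousLinearMap.lsmul ℝ ℝ)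
      hpc.locallyIntegrable hg x
  have small : ∀ a : ℝ, 0 ≤ a → a ≤ I → η / (2 * (I + 1)) * a ≤ η / 2 := by
    intro a ha haI
    rw [div_mul_eq_mul_div, div_le_div_iff₀ (by positivity) two_pos]
    nlinarith
  refine ⟨P, fun x hx => ⟨?_, ?_⟩⟩
  · have e : polyFun P x = _ := congrFun eP x
    rw [e]
    have h1 := norm_convolution_sub_le hpc hψc hg.continuous (R := max R₁ R₂)
      (fun y hy => (hR₁ y (subset_tsupport _ hy)).trans (le_max_left _ _)) hc hp hx
    have h2 := φ.dist_normed_convolution_le (μ := volume) (x₀ := x)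
      hg.continuous.aestronglyMeasurable (ε := η / 2) (fun y hy => (u₁ ((Metric.mem_ball.1 hy).trans_le
        (min_le_left _ _))).le)
    have h3 := small _ hI1 (by linarith)
    rw [dist_eq_norm] at h2
    rw [← Real.norm_eq_abs]
    refine (norm_sub_le_norm_sub_add_norm_sub _ ((ψ ⋆[ContinuousLinearMap.lsmul ℝ ℝ, volume] g) x)
      _).trans ?_
    linarith
  · rw [(dP x).fderiv]
    have h1 := norm_convolution_sub_le hpc hψc hD (R := max R₁ R₂)
      (fun y hy => (hR₂ y (subset_tsupport _ hy)).trans (le_max_right _ _)) hcD hp hx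
    have h2 := φ.dist_normed_convolution_le (μ := volume) (x₀ := x)
      hD.aestronglyMeasurable (ε := η / 2) (fun y hy => (u₂ ((Metric.mem_ball.1 hy).trans_le
        (min_le_right _ _))).le)
    have h3 := small _ hI2 (by linarith)
    rw [dist_eq_norm] at h2
    refine (norm_sub_le_norm_sub_add_norm_sub _
      ((ψ ⋆[ContinuousLinearMap.lsmul ℝ ℝ, volume] (fderiv ℝ g)) x) _).trans ?_
    linarith

/-- `C¹` functions on the closed ball are approximated by compactly supported `C¹` functions. -/
theorem exists_hasCompactSupport_c1_near {g : EuclideanSpace ℝ (Fin n) → ℝ}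
    (hg : ContDiffOn ℝ 1 g (unitBall n)) {η : ℝ} (hη : 0 < η) :
    ∃ f : EuclideanSpace ℝ (Fin n) → ℝ, ContDiff ℝ 1 f ∧ HasCompactSupport f ∧
      ∀ x ∈ unitBall n, |f x - g x| ≤ η ∧
        ‖fderiv ℝ f x - fderivWithin ℝ g (unitBall n) x‖ ≤ η := by
  have hDc : ContinuousOn (fderivWithin ℝ g (unitBall n)) (unitBall n) :=
    hg.continuousOn_fderivWithin (uniqueDiffOn_unitBall n) le_rfl
  have cpt : IsCompact (unitBall n) := isCompact_closedBall _ _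
  obtain ⟨δ₁, hδ₁, u₁⟩ := Metric.uniformContinuousOn_iff.1
    (cpt.uniformContinuousOn_of_continuous hg.continuousOn) η hη
  obtain ⟨δ₂, hδ₂, u₂⟩ := Metric.uniformContinuousOn_iff.1
    (cpt.uniformContinuousOn_of_continuous hDc) (η / 2) (by positivity)
  obtain ⟨M, hM⟩ := cpt.exists_bound_of_continuousOn hDc
  have hM0 : 0 ≤ M := (norm_nonneg _).trans (hM 0 (by simp))
  -- The function `g` is replaced by `g ((1 - r) x)`, which is `C¹` on a ball larger than the unit
  -- ball. The condition on `r * M` absorbs the factor `1 - r` that appears in the derivative.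
  obtain ⟨r, hr0, hr1, hrδ₁, hrδ₂, hrM⟩ : ∃ r : ℝ, 0 < r ∧ r < 1 ∧ r < δ₁ ∧ r < δ₂ ∧
      r * M ≤ η / 2 := by
    refine ⟨min (1 / 2) (min (δ₁ / 2) (min (δ₂ / 2) (η / (2 * (M + 1))))), by positivity,
      (min_le_left _ _).trans_lt (by norm_num), ?_, ?_, ?_⟩
    · exact ((min_le_right _ _).trans (min_le_left _ _)).trans_lt (by linarith)
    · exact ((min_le_right _ _).trans ((min_le_right _ _).trans (min_le_left _ _))).trans_lt
        (by linarith)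
    · have h1 : min (1 / 2) (min (δ₁ / 2) (min (δ₂ / 2) (η / (2 * (M + 1))))) ≤
          η / (2 * (M + 1)) :=
        (min_le_right _ _).trans ((min_le_right _ _).trans (min_le_right _ _))
      calc _ ≤ η / (2 * (M + 1)) * M := by gcongr
        _ ≤ η / 2 := by
          rw [div_mul_eq_mul_div, div_le_div_iff₀ (by positivity) two_pos]
          nlinarith
  set s := 1 - r with hs
  have hs0 : 0 < s := by linarith
  have hs1 : 1 < 1 / s := by rw [lt_div_iff₀ hs0]; linarith
  let χ : ContDiffBump (0 : EuclideanSpace ℝ (Fin n)) :=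
    ⟨1 + (1 / s - 1) / 3, 1 + 2 * ((1 / s - 1) / 3), by linarith, by linarith⟩
  have inner_mem : ∀ x : EuclideanSpace ℝ (Fin n), ‖x‖ < 1 / s → s • x ∈ Metric.ball 0 1 := by
    intro x hx
    rw [mem_ball_zero_iff, norm_smul, Real.norm_of_nonneg hs0.le]
    rw [lt_div_iff₀ hs0] at hx
    linarith
  have hgat : ∀ x : EuclideanSpace ℝ (Fin n), ‖x‖ < 1 / s → ContDiffAt ℝ 1 g (s • x) := fun x hx =>
    hg.contDiffAt (mem_of_superset (Metric.isOpen_ball.mem_nhds (inner_mem x hx))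
      Metric.ball_subset_closedBall)
  refine ⟨fun x => χ x * g (s • x), ?_, χ.hasCompactSupport.mul_right, fun x hx => ?_⟩
  · refine contDiff_iff_contDiffAt.2 fun x => ?_
    by_cases hx : x ∈ tsupport fun x => χ x * g (s • x)
    swap
    · exact contDiffAt_const.congr_of_eventuallyEq (notMem_tsupport_iff_eventuallyEq.1 hx)
    have hx' : x ∈ tsupport χ := tsupport_mul_subset_left hx
    rw [χ.tsupport_eq, mem_closedBall_zero_iff] at hx'
    have hlt : ‖x‖ < 1 / s := hx'.trans_lt (by
      change 1 + 2 * ((1 / s - 1) / 3) < 1 / s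
      linarith)
    exact χ.contDiffAt.mul ((hgat x hlt).comp x (contDiff_const_smul s).contDiffAt)
  · have hx1 : ‖x‖ ≤ 1 := by simpa using hx
    have hsx : s • x ∈ unitBall n :=
      Metric.ball_subset_closedBall (inner_mem x (hx1.trans_lt hs1))
    have hdist : dist (s • x) x ≤ r := by
      rw [dist_eq_norm, show s • x - x = -(r • x) by rw [hs]; module, norm_neg, norm_smul,
        Real.norm_of_nonneg hr0.le]
      nlinarith
    have hev : (fun x => χ x * g (s • x)) =ᶠ[𝓝 x] fun x => g (s • x) := by
      have h1 : x ∈ Metric.ball (0 : EuclideanSpace ℝ (Fin n)) (1 + (1 / s - 1) / 3) := by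
        rw [mem_ball_zero_iff]; linarith
      filter_upwards [χ.eventuallyEq_one_of_mem_ball h1] with y hy
      rw [hy]; simp
    refine ⟨?_, ?_⟩
    · change |χ x * g (s • x) - g x| ≤ η
      rw [show χ x * g (s • x) = g (s • x) from hev.eq_of_nhds, ← Real.dist_eq]
      exact (u₁ _ hsx _ hx (hdist.trans_lt hrδ₁)).le
    · have hd : HasFDerivAt (fun x => g (s • x))
          ((fderivWithin ℝ g (unitBall n) (s • x)).comp
            (s • ContinuousLinearMap.id ℝ (EuclideanSpace ℝ (Fin n)))) x := by
        have h1 := ((hgat x (hx1.trans_lt hs1)).differentiableAt one_ne_zero).hasFDerivAt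
        have h2 : fderivWithin ℝ g (unitBall n) (s • x) = fderiv ℝ g (s • x) :=
          fderivWithin_of_mem_nhds (mem_of_superset
            (Metric.isOpen_ball.mem_nhds (inner_mem x (hx1.trans_lt hs1)))
            Metric.ball_subset_closedBall)
        rw [h2]
        exact h1.comp x ((hasFDerivAt_id x).const_smul s)
      rw [hev.fderiv_eq, hd.fderiv, ContinuousLinearMap.comp_smul, ContinuousLinearMap.comp_id]
      have e : s • fderivWithin ℝ g (unitBall n) (s • x) - fderivWithin ℝ g (unitBall n) x =
          (fderivWithin ℝ g (unitBall n) (s • x) - fderivWithin ℝ g (unitBall n) x) -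
            r • fderivWithin ℝ g (unitBall n) (s • x) := by rw [hs]; module
      rw [e]
      refine (norm_sub_le _ _).trans ?_
      rw [norm_smul, Real.norm_of_nonneg hr0.le, ← dist_eq_norm]
      have h1 := (u₂ _ hsx _ hx (hdist.trans_lt hrδ₂)).le
      have h2 := mul_le_mul_of_nonneg_left (hM _ hsx) hr0.le
      linarith

theorem EuclideanSpace.norm_le_sum {ι : Type*} [Fintype ι] (x : EuclideanSpace ℝ ι) :
    ‖x‖ ≤ ∑ i, |x i| := by
  classical
  have : x = ∑ i, x i • EuclideanSpace.single i (1 : ℝ) := by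
    ext j
    simp [Pi.single_apply]
  calc ‖x‖ = ‖∑ i, x i • EuclideanSpace.single i (1 : ℝ)‖ := by rw [← this]
    _ ≤ ∑ i, ‖x i • EuclideanSpace.single i (1 : ℝ)‖ := norm_sum_le _ _
    _ = _ := by simp [norm_smul]

/-- The polynomial vector field with given components. -/
noncomputable def polyField {n m : ℕ} (p : Fin m → MvPolynomial (Fin n) ℝ) (q : EuclideanSpace ℝ (Fin n)) :
    EuclideanSpace ℝ (Fin m) :=
  WithLp.toLp 2 fun i => polyFun (p i) q

theorem contDiff_polyField {m : ℕ} (p : Fin m → MvPolynomial (Fin n) ℝ) {k : WithTop ℕ∞} :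
    ContDiff ℝ k (polyField p) :=
  contDiff_euclidean.2 fun i => contDiff_polyFun (p i)

theorem exists_polyField_c1_near {m : ℕ}
    {Q : EuclideanSpace ℝ (Fin n) → EuclideanSpace ℝ (Fin m)}
    (hQ : ContDiffOn ℝ 1 Q (unitBall n)) {η : ℝ} (hη : 0 < η) :
    ∃ p : Fin m → MvPolynomial (Fin n) ℝ, ∀ q ∈ unitBall n, ‖polyField p q - Q q‖ ≤ η ∧
      ‖fderiv ℝ (polyField p) q - fderivWithin ℝ Q (unitBall n) q‖ ≤ η := by
  have hη' : 0 < η / (2 * (m + 1)) := by positivity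
  have hQi : ∀ i, ContDiffOn ℝ 1 (fun q => Q q i) (unitBall n) := contDiffOn_euclidean.1 hQ
  have ex : ∀ i, ∃ P : MvPolynomial (Fin n) ℝ, ∀ x ∈ unitBall n,
      |polyFun P x - Q x i| ≤ η / (m + 1) ∧
      ‖fderiv ℝ (polyFun P) x -
        fderivWithin ℝ (fun q => Q q i) (unitBall n) x‖ ≤ η / (m + 1) := by
    intro i
    obtain ⟨f, hf, hc, hfn⟩ := exists_hasCompactSupport_c1_near (hQi i) hη'
    obtain ⟨P, hP⟩ := exists_mvPolynomial_c1_near hf hc hη'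
    have e : η / (m + 1) = η / (2 * (m + 1)) + η / (2 * (m + 1)) := by field_simp; ring
    refine ⟨P, fun x hx => ⟨?_, ?_⟩⟩
    · rw [e]
      exact (abs_sub_le _ (f x) _).trans (add_le_add (hP x (by simpa using hx)).1 (hfn x hx).1)
    · rw [e]
      exact (norm_sub_le_norm_sub_add_norm_sub _ (fderiv ℝ f x) _).trans
        (add_le_add (hP x (by simpa using hx)).2 (hfn x hx).2)
  choose p hp using ex
  have tot : ∑ _i : Fin m, η / ((m : ℝ) + 1) ≤ η := by
    rw [Finset.sum_const, Finset.card_univ, Fintype.card_fin, nsmul_eq_mul, mul_div_assoc',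
      div_le_iff₀ (by positivity)]
    nlinarith
  refine ⟨p, fun q hq => ⟨?_, ?_⟩⟩
  · refine (EuclideanSpace.norm_le_sum _).trans ((Finset.sum_le_sum fun i _ => ?_).trans tot)
    exact (hp i q hq).1
  · refine ContinuousLinearMap.opNorm_le_bound _ hη.le fun v => ?_
    refine (EuclideanSpace.norm_le_sum _).trans ?_
    have tot' : ∑ _i : Fin m, η / ((m : ℝ) + 1) * ‖v‖ ≤ η * ‖v‖ := by
      rw [← Finset.sum_mul]; gcongr
    refine (Finset.sum_le_sum fun i _ => ?_).trans tot'
    have h1 : HasFDerivAt (polyField p) (fderiv ℝ (polyField p) q) q :=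
      (((contDiff_polyField p (k := 1)).differentiable one_ne_zero) q).hasFDerivAt
    have h2 : HasFDerivWithinAt Q (fderivWithin ℝ Q (unitBall n) q) (unitBall n) q :=
      ((hQ.differentiableOn one_ne_zero) q hq).hasFDerivWithinAt
    have h1' := (EuclideanSpace.proj (𝕜 := ℝ) i).hasFDerivAt.comp q h1
    have h2' := (EuclideanSpace.proj (𝕜 := ℝ) i).hasFDerivAt.comp_hasFDerivWithinAt q h2
    have h3 := (hp i q hq).2
    have e1 : fderiv ℝ (polyFun (p i)) q =
      (EuclideanSpace.proj (𝕜 := ℝ) i).comp (fderiv ℝ (polyField p) q) := h1'.fderiv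
    have e2 : fderivWithin ℝ (fun q => Q q i) (unitBall n) q =
      (EuclideanSpace.proj (𝕜 := ℝ) i).comp (fderivWithin ℝ Q (unitBall n) q) :=
      h2'.fderivWithin (uniqueDiffOn_unitBall n q hq)
    rw [e1, e2, ← ContinuousLinearMap.comp_sub] at h3
    exact ((ContinuousLinearMap.le_opNorm _ v).trans
      (mul_le_mul_of_nonneg_right h3 (norm_nonneg _)))

end PolynomialApproximation

end

/-! ### Polynomials as readouts of quadratic chains. -/

section

section Chain

variable {n : ℕ}

/-- The functions in `S` are linear combinations of the solution `m` of a fixed-point equation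
`m = e + s * b(q) m` with `b(q)` linear in `q`, the coefficients `e`, `b` being independent of the
scaling parameter `s`. -/
def IsChainRealizable (S : Set (EuclideanSpace ℝ (Fin n) → ℝ)) : Prop :=
  ∃ (A : Type) (_ : Fintype A) (e : A → ℝ) (b : A → Fin n → A → ℝ), ∀ s : ℝ, 0 < s →
    ∃ m : EuclideanSpace ℝ (Fin n) → A → ℝ,
      (∀ q a, m q a = e a + s * ∑ i, ∑ a', b a i a' * (q i * m q a')) ∧
      ∀ f ∈ S, ∃ C : A → ℝ, ∀ q, f q = ∑ a, C a * m q a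

namespace IsChainRealizable

variable {S S' : Set (EuclideanSpace ℝ (Fin n) → ℝ)} {f g : EuclideanSpace ℝ (Fin n) → ℝ}

theorem union (h : IsChainRealizable S) (h' : IsChainRealizable S') :
    IsChainRealizable (S ∪ S') := by
  obtain ⟨A, _, e, b, H⟩ := h
  obtain ⟨A', _, e', b', H'⟩ := h'
  refine ⟨A ⊕ A', inferInstance, Sum.elim e e',
    fun x i y => Sum.elim (fun a => Sum.elim (b a i) (fun _ => 0) y)
      (fun a => Sum.elim (fun _ => 0) (b' a i) y) x, fun s hs => ?_⟩
  obtain ⟨m, hm, hS⟩ := H s hs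
  obtain ⟨m', hm', hS'⟩ := H' s hs
  refine ⟨fun q => Sum.elim (m q) (m' q), ?_, ?_⟩
  · rintro q (a | a)
    · simpa using hm q a
    · simpa using hm' q a
  · rintro f (hf | hf)
    · obtain ⟨C, hC⟩ := hS f hf
      exact ⟨Sum.elim C fun _ => 0, fun q => by simpa using hC q⟩
    · obtain ⟨C, hC⟩ := hS' f hf
      exact ⟨Sum.elim (fun _ => 0) C, fun q => by simpa using hC q⟩

theorem add (h : IsChainRealizable {f}) (h' : IsChainRealizable {g}) :
    IsChainRealizable {f + g} := by
  obtain ⟨A, _, e, b, H⟩ := h.union h'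
  refine ⟨A, inferInstance, e, b, fun s hs => ?_⟩
  obtain ⟨m, hm, hS⟩ := H s hs
  refine ⟨m, hm, ?_⟩
  rintro _ rfl
  obtain ⟨C, hC⟩ := hS f (by simp)
  obtain ⟨C', hC'⟩ := hS g (by simp)
  exact ⟨C + C', fun q => by simp [hC, hC', add_mul, Finset.sum_add_distrib]⟩

theorem const (c : ℝ) :
    IsChainRealizable {fun _ : EuclideanSpace ℝ (Fin n) => c} := by
  refine ⟨Unit, inferInstance, fun _ => 1, fun _ _ _ => 0, fun s _ => ⟨fun _ _ => 1, by simp, ?_⟩⟩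
  rintro _ rfl
  exact ⟨fun _ => c, by simp⟩

/-- New variables `s * (q i * m q a)` are adjoined to the chain. The factor `s` is compensated in
the readout, which may depend on `s`, whereas `e` and `b` may not: the size of `s` is fixed only
after `b` is known. -/
theorem mul_coord (h : IsChainRealizable {f}) (i : Fin n) :
    IsChainRealizable {fun q => f q * q i} := by
  classical
  obtain ⟨A, _, e, b, H⟩ := h
  refine ⟨A ⊕ A, inferInstance, Sum.elim e fun _ => 0,
    fun x j y => Sum.elim (fun a => Sum.elim (b a j) (fun _ => 0) y)
      (fun a => Sum.elim (fun a' => if j = i then (if a' = a then 1 else 0) else 0)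
        (fun _ => 0) y) x,
    fun s hs => ?_⟩
  obtain ⟨m, hm, hS⟩ := H s hs
  obtain ⟨C, hC⟩ := hS f rfl
  refine ⟨fun q => Sum.elim (m q) fun a => s * (q i * m q a), ?_, ?_⟩
  · rintro q (a | a)
    · simpa using hm q a
    · simp [ite_mul]
  · rintro _ rfl
    refine ⟨Sum.elim (fun _ => 0) fun a => C a / s, fun q => ?_⟩
    have := hs.ne'
    simp only [Fintype.sum_sum_type, Sum.elim_inl, Sum.elim_inr, zero_mul, Finset.sum_const_zero,
      zero_add, hC, Finset.sum_mul]
    refine Finset.sum_congr rfl fun a _ => ?_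
    field_simp

theorem polyFun (p : MvPolynomial (Fin n) ℝ) : IsChainRealizable {polyFun p} := by
  induction p using MvPolynomial.induction_on with
  | C a =>
    have : _root_.polyFun (MvPolynomial.C a) = fun _ : EuclideanSpace ℝ (Fin n) => a := by
      funext x; simp [_root_.polyFun]
    rw [this]
    exact const a
  | add p q hp hq =>
    have : _root_.polyFun (p + q) = _root_.polyFun p + _root_.polyFun q := by
      funext x; exact polyFun_add p q x
    rw [this]
    exact hp.add hq
  | mul_X p i hp =>
    have : _root_.polyFun (p * MvPolynomial.X i) = fun x => _root_.polyFun p x * x i := by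
      funext x; exact polyFun_mul_X p i x
    rw [this]
    exact hp.mul_coord i

theorem range {ι : Type*} [Fintype ι] {F : ι → EuclideanSpace ℝ (Fin n) → ℝ}
    (h : ∀ i, IsChainRealizable {F i}) : IsChainRealizable (Set.range F) := by
  classical
  have key : ∀ s : Finset ι, IsChainRealizable (F '' s) := by
    intro s
    induction s using Finset.induction_on with
    | empty =>
      exact ⟨Unit, inferInstance, fun _ => 0, fun _ _ _ => 0, fun s _ =>
        ⟨fun _ _ => 0, by simp, by simp⟩⟩
    | insert i s _ ih =>
      rw [Finset.coe_insert, Set.image_insert_eq, ← Set.singleton_union]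
      exact (h i).union ih
  simpa using key Finset.univ

end IsChainRealizable

/-- Polynomial vector fields are read off from chains of quadratic relations. -/
theorem exists_chain_polyField {m : ℕ} (p : Fin m → MvPolynomial (Fin n) ℝ) :
    ∃ (A : Type) (_ : Fintype A) (e : A → ℝ) (b : A → Fin n → A → ℝ), ∀ s : ℝ, 0 < s →
      ∃ (y : EuclideanSpace ℝ (Fin n) → A → ℝ) (C : Fin m → A → ℝ),
        (∀ q a, y q a = e a + s * ∑ i, ∑ a', b a i a' * (q i * y q a')) ∧
        ∀ q k, polyField p q k = ∑ a, C k a * y q a := by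
  obtain ⟨A, hA, e, b, H⟩ :=
    IsChainRealizable.range (F := fun k => polyFun (p k)) fun k => IsChainRealizable.polyFun (p k)
  refine ⟨A, hA, e, b, fun s hs => ?_⟩
  obtain ⟨y, hy, hS⟩ := H s hs
  choose C hC using fun k => hS (polyFun (p k)) ⟨k, rfl⟩
  exact ⟨y, C, hy, fun q k => hC k q⟩

end Chain

end

/-! ### Closeness of the reduced field to its limit in `C¹`. -/

section

open Filter Topology Set

set_option maxHeartbeats 400000 in
/-- For large `Λ` the slow manifold of `q' = C w + Λ⁻¹ R(q,w)`,
`w' = Λ(G₀(q,w) + Λ⁻¹ S(q,w) - w)` exists, and the reduced field is `C¹`-close to `P` on the unit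
ball if `P` is the reduced field of the unperturbed system in the stable sense `hstab`. -/
theorem exists_slow_manifold_near {n : ℕ} {H : Type*} [NormedAddCommGroup H] [NormedSpace ℝ H]
    [CompleteSpace H] (C : H →L[ℝ] EuclideanSpace ℝ (Fin n))
    {G₀ : EuclideanSpace ℝ (Fin n) × H → H} {ℓ₀ L₀ B₀ ℓ₁ L₁ B₁ k η : ℝ}
    {P : EuclideanSpace ℝ (Fin n) → EuclideanSpace ℝ (Fin n)}
    (hG₀ : ThreePt ℓ₀ L₀ G₀) (hB₀ : ∀ p, ‖G₀ p‖ ≤ B₀) (hℓ₀ : 0 ≤ ℓ₀)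
    (hℓ₀' : 8 * ℓ₀ ≤ 1) (hL₀ : 0 ≤ L₀) (hℓ₁ : 0 ≤ ℓ₁) (hL₁ : 0 ≤ L₁) (hB₁ : 0 ≤ B₁)
    (hP : ContDiff ℝ 2 P) (hk : 0 ≤ k)
    (hstab : ∀ q w, ‖q‖ ≤ 2 → ‖w‖ ≤ B₀ + 1 → ‖C w - P q‖ ≤ k * ‖w - G₀ (q, w)‖) (hη : 0 < η) :
    ∃ Λ₁ : ℝ, ∀ Λ, Λ₁ ≤ Λ → ∀ (R : EuclideanSpace ℝ (Fin n) × H → EuclideanSpace ℝ (Fin n))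
      (S : EuclideanSpace ℝ (Fin n) × H → H), ThreePt ℓ₁ L₁ R → (∀ p, ‖R p‖ ≤ B₁) →
      ThreePt ℓ₁ L₁ S → (∀ p, ‖S p‖ ≤ B₁) →
      ∃ (ℓF LF ℓG LG L : ℝ) (h : EuclideanSpace ℝ (Fin n) → H),
        ThreePt ℓF LF (fun p => C p.2 + Λ⁻¹ • R p) ∧ ThreePt ℓG LG (fun p => G₀ p + Λ⁻¹ • S p) ∧
        0 < ℓF ∧ 0 ≤ LF ∧ 0 ≤ L ∧ 4 * ℓG ≤ 1 ∧ 8 * ℓF ≤ Λ ∧ ThreePt 2 L h ∧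
        (∀ q, ‖h q‖ ≤ B₀ + 1) ∧
        (∀ q, fderiv ℝ h q (C (h q) + Λ⁻¹ • R (q, h q)) =
          Λ • (G₀ (q, h q) + Λ⁻¹ • S (q, h q) - h q)) ∧
        ∀ q, ‖q‖ ≤ 1 → ‖C (h q) + Λ⁻¹ • R (q, h q) - P q‖ ≤ η ∧
          ‖fderiv ℝ (fun q => C (h q) + Λ⁻¹ • R (q, h q)) q - fderiv ℝ P q‖ ≤ η := by
  have hB₀0 : 0 ≤ B₀ := (norm_nonneg _).trans (hB₀ 0)
  -- `P` is cut off outside the ball of radius `2` to satisfy a global three-point estimate. Radius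
  -- `2` leaves room for steps of length at most `1` from the unit ball.
  let χ : ContDiffBump (0 : EuclideanSpace ℝ (Fin n)) := ⟨2, 3, by norm_num, by norm_num⟩
  obtain ⟨ℓP, LP, hℓP, hLP, hPt⟩ := ThreePt.exists_of_hasCompactSupport
    (f := fun q => χ q • P q) (χ.contDiff.smul hP) χ.hasCompactSupport.smul_right
  have χ2 : ∀ q : EuclideanSpace ℝ (Fin n), ‖q‖ ≤ 2 → χ q • P q = P q := fun q hq => by
    rw [χ.one_of_mem_closedBall (by simpa using hq), one_smul]
  obtain ⟨ℓF, hℓF⟩ : ∃ x, x = ‖C‖ + ℓ₁ + 1 := ⟨_, rfl⟩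
  obtain ⟨LF, hLF⟩ : ∃ x, x = L₁ := ⟨_, rfl⟩
  obtain ⟨Lh, hLh⟩ : ∃ x, x = 2 * (LF / ℓF + 8 * (L₀ + L₁)) := ⟨_, rfl⟩
  have hℓF0 : 0 < ℓF := by rw [hℓF]; positivity
  have hLF0 : 0 ≤ LF := by rw [hLF]; exact hL₁
  have hLh0 : 0 ≤ Lh := by rw [hLh]; positivity
  obtain ⟨Lf, hLf⟩ : ∃ x, x = ℓF * Lh + LF * 2 ^ 2 := ⟨_, rfl⟩
  have hLf0 : 0 ≤ Lf := by rw [hLf]; positivity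
  obtain ⟨Lt, hLt⟩ : ∃ x, x = Lf + LP := ⟨_, rfl⟩
  have hLt0 : 0 ≤ Lt := by rw [hLt]; positivity
  obtain ⟨ω, hω⟩ : ∃ x, x = 2 * (‖C‖ * (B₀ + 1) + B₁) + B₁ := ⟨_, rfl⟩
  have hω0 : 0 ≤ ω := by rw [hω]; positivity
  obtain ⟨β, hβ⟩ : ∃ x, x = k * ω + B₁ := ⟨_, rfl⟩
  have hβ0 : 0 ≤ β := by rw [hβ]; positivity
  -- The interpolation bound is `2 (β / Λ) / s + 2 Lt s`. First `s` makes the second term at most `η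
  -- / 2`; then `Λ ≥ 4 β / (s η)` does the same for the first.
  obtain ⟨s, hs⟩ : ∃ x, x = min 1 (η / (4 * Lt + 1)) := ⟨_, rfl⟩
  have hs0 : 0 < s := by rw [hs]; positivity
  have hs1 : s ≤ 1 := hs ▸ min_le_left _ _
  have hsη : 2 * Lt * s ≤ η / 2 := by
    have h1 : s ≤ η / (4 * Lt + 1) := hs ▸ min_le_right _ _
    rw [le_div_iff₀ (by positivity)] at h1
    nlinarith
  refine ⟨max 1 (max (8 * ℓF) (max (8 * ℓ₁) (max B₁ (4 * β / (s * η))))),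
    fun Λ hΛ R S hR hRB hS hSB => ?_⟩
  simp only [max_le_iff] at hΛ
  obtain ⟨hΛ1, hΛF, hΛℓ, hΛB, hΛβ⟩ := hΛ
  have hΛ0 : 0 < Λ := by linarith
  have hi0 : 0 ≤ Λ⁻¹ := by positivity
  have hi1 : Λ⁻¹ ≤ 1 := inv_le_one_of_one_le₀ hΛ1
  have hiabs : |Λ⁻¹| = Λ⁻¹ := abs_of_nonneg hi0
  have hF : ThreePt ℓF LF (fun p : EuclideanSpace ℝ (Fin n) × H => C p.2 + Λ⁻¹ • R p) := by
    have h1 := ThreePt.clm (C.comp (ContinuousLinearMap.snd ℝ (EuclideanSpace ℝ (Fin n)) H))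
    refine (h1.add (hR.smul Λ⁻¹)).mono ?_ ?_
    · have h2 : ‖C.comp (ContinuousLinearMap.snd ℝ (EuclideanSpace ℝ (Fin n)) H)‖ ≤ ‖C‖ := by
        refine (ContinuousLinearMap.opNorm_comp_le _ _).trans ?_
        have := ContinuousLinearMap.norm_snd_le ℝ (EuclideanSpace ℝ (Fin n)) H
        nlinarith [norm_nonneg C]
      rw [hiabs, hℓF]
      have := mul_le_of_le_one_left hℓ₁ hi1
      linarith
    · rw [hiabs, hLF, zero_add]; exact mul_le_of_le_one_left hL₁ hi1
  have hG4 : 4 * (ℓ₀ + Λ⁻¹ * ℓ₁) ≤ 1 := by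
    have : Λ⁻¹ * ℓ₁ ≤ 1 / 8 := by
      rw [inv_mul_le_iff₀ hΛ0]; linarith
    linarith
  have hG : ThreePt (ℓ₀ + Λ⁻¹ * ℓ₁) (L₀ + L₁) (fun p => G₀ p + Λ⁻¹ • S p) := by
    refine (hG₀.add (hS.smul Λ⁻¹)).mono (by rw [hiabs]) ?_
    rw [hiabs]; exact add_le_add le_rfl (mul_le_of_le_one_left hL₁ hi1)
  have hGB : ∀ p, ‖G₀ p + Λ⁻¹ • S p‖ ≤ B₀ + 1 := by
    intro p
    refine (norm_add_le _ _).trans (add_le_add (hB₀ p) ?_)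
    rw [norm_smul, Real.norm_of_nonneg hi0, inv_mul_le_iff₀ hΛ0]
    linarith [hSB p]
  obtain ⟨h, hh, hhB, hinv⟩ := exists_slow_manifold hF hG hGB hℓF0 hLF0 (by positivity)
    (by positivity) hG4 hΛF
  rw [← hLh] at hh
  have hg : ThreePt 2 Lh (fun q => (q, h q)) := by
    have h1 := ((ThreePt.clm (ContinuousLinearMap.id ℝ (EuclideanSpace ℝ (Fin n)))).mono
      (ℓ' := 2) (L' := Lh) (ContinuousLinearMap.norm_id_le.trans (by norm_num)) hLh0).prodMk hh
    simpa using h1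
  have hf : ThreePt (ℓF * 2) Lf (fun q => C (h q) + Λ⁻¹ • R (q, h q)) := by
    rw [hLf]; exact hF.comp hg hℓF0.le hLF0
  have hRi : ∀ p, ‖Λ⁻¹ • R p‖ ≤ Λ⁻¹ * B₁ := fun p => by
    rw [norm_smul, Real.norm_of_nonneg hi0]; gcongr; exact hRB p
  have hSi : ∀ p, ‖Λ⁻¹ • S p‖ ≤ Λ⁻¹ * B₁ := fun p => by
    rw [norm_smul, Real.norm_of_nonneg hi0]; gcongr; exact hSB p
  -- By the invariance equation `Λ (G - h)` is the derivative of `h` along the reduced field, which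
  -- is bounded independently of `Λ`; so the graph is an approximate equilibrium of the fast
  -- equation up to `O(1/Λ)`, and `hstab` applies.
  have res : ∀ q, ‖h q - G₀ (q, h q)‖ ≤ Λ⁻¹ * ω := by
    intro q
    obtain ⟨h', hh1, hh2, -, -⟩ := hh.exists_fderiv (by norm_num) hLh0
    have h1 := hinv q
    simp only at h1
    rw [(hh1 q).fderiv] at h1
    have h2 : h q - G₀ (q, h q) = Λ⁻¹ • S (q, h q) -
        Λ⁻¹ • h' q (C (h q) + Λ⁻¹ • R (q, h q)) := by
      rw [h1, inv_smul_smul₀ hΛ0.ne']; abel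
    have h3 : ‖C (h q) + Λ⁻¹ • R (q, h q)‖ ≤ ‖C‖ * (B₀ + 1) + B₁ := by
      refine (norm_add_le _ _).trans (add_le_add ?_ ((hRi _).trans (by nlinarith)))
      exact (C.le_opNorm _).trans (by gcongr; exact hhB q)
    have h4 : ‖h' q (C (h q) + Λ⁻¹ • R (q, h q))‖ ≤ 2 * (‖C‖ * (B₀ + 1) + B₁) :=
      ((h' q).le_opNorm _).trans (mul_le_mul (hh2 q) h3 (norm_nonneg _) (by norm_num))
    rw [h2]
    refine (norm_sub_le _ _).trans ?_
    rw [norm_smul _ (h' q _), Real.norm_of_nonneg hi0]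
    have := mul_le_mul_of_nonneg_left h4 hi0
    have := hSi (q, h q)
    rw [hω]
    linarith
  have close : ∀ q, ‖q‖ ≤ 2 → ‖C (h q) + Λ⁻¹ • R (q, h q) - P q‖ ≤ Λ⁻¹ * β := by
    intro q hq
    have h1 := hstab q (h q) hq (hhB q)
    have h2 := mul_le_mul_of_nonneg_left (res q) hk
    rw [show C (h q) + Λ⁻¹ • R (q, h q) - P q = (C (h q) - P q) + Λ⁻¹ • R (q, h q) by abel]
    refine (norm_add_le _ _).trans ?_
    have := hRi (q, h q)
    rw [hβ]
    linarith
  have hΛβ' : Λ⁻¹ * β ≤ s * η / 4 := by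
    rw [inv_mul_le_iff₀ hΛ0]
    rw [div_le_iff₀ (by positivity)] at hΛβ
    linarith
  refine ⟨ℓF, LF, ℓ₀ + Λ⁻¹ * ℓ₁, L₀ + L₁, Lh, h, hF, hG, hℓF0, hLF0, hLh0, hG4, hΛF, hh, hhB, hinv,
    fun q hq => ⟨(close q (by linarith)).trans (hΛβ'.trans (by nlinarith)), ?_⟩⟩
  have hd := (hf.sub hPt).norm_fderiv_le_of_small (by positivity) (hLt ▸ hLt0) hs0 hs1
    (β := Λ⁻¹ * β) (fun q hq => by rw [χ2 q hq]; exact close q hq) hq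
  have hev : (fun q => χ q • P q) =ᶠ[𝓝 q] P := by
    have : q ∈ Metric.ball (0 : EuclideanSpace ℝ (Fin n)) 2 := by
      rw [mem_ball_zero_iff]; linarith
    filter_upwards [Metric.isOpen_ball.mem_nhds this] with y hy
    exact χ2 y (mem_ball_zero_iff.1 hy).le
  rw [fderiv_fun_sub ((hf.contDiff (by positivity) (by positivity)).differentiable one_ne_zero q)
    ((hPt.contDiff hℓP hLP).differentiable one_ne_zero q), hev.fderiv_eq] at hd
  rw [← hLt] at hd
  refine hd.trans ?_
  have : 2 * (Λ⁻¹ * β) / s ≤ η / 2 := by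
    rw [div_le_iff₀ hs0]; nlinarith
  linarith

end

/-! ### Truncated quadratic maps, scaling, coordinate maps. -/

section

open Filter Topology Set
open scoped RealInnerProductSpace

/-- A bounded `C^{1,1}` truncation of the identity of `ℝ`. -/
theorem exists_truncation {R : ℝ} (hR : 0 < R) :
    ∃ (τ : ℝ → ℝ) (ℓ L B : ℝ), 0 ≤ ℓ ∧ 0 ≤ L ∧ 0 ≤ B ∧ ThreePt ℓ L τ ∧ (∀ x, |τ x| ≤ B) ∧
      ∀ x, |x| ≤ R → τ x = x := by
  let χ : ContDiffBump (0 : ℝ) := ⟨R, R + 1, hR, by linarith⟩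
  have hc : HasCompactSupport fun x => χ x * x := χ.hasCompactSupport.mul_right
  have hd : ContDiff ℝ 2 fun x => χ x * x := χ.contDiff.mul contDiff_id
  obtain ⟨ℓ, L, hℓ, hL, ht⟩ := ThreePt.exists_of_hasCompactSupport hd hc
  obtain ⟨B, hB⟩ := hc.exists_bound_of_continuous hd.continuous
  refine ⟨fun x => χ x * x, ℓ, L, B, hℓ, hL, (norm_nonneg _).trans (hB 0), ht, hB, fun x hx => ?_⟩
  change χ x * x = x
  rw [χ.one_of_mem_closedBall (by simpa using hx), one_mul]

variable {N : ℕ}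

/-- A quadratic map of `ℝᴺ` evaluated at truncated coordinates. -/
noncomputable def truncQuad (τ : ℝ → ℝ) (c : Fin N → Fin N → Fin N → ℝ) (d : Fin N → Fin N → ℝ)
    (x : EuclideanSpace ℝ (Fin N)) : EuclideanSpace ℝ (Fin N) :=
  WithLp.toLp 2 fun i => (∑ j, ∑ l, c i j l * (τ (x j) * τ (x l))) + ∑ j, d i j * τ (x j)

/-- The constants depend on the coefficients only through `c₀`. This uniformity matters because the
scaled coefficients change with `Λ`. -/
theorem exists_truncQuad_bounds {τ : ℝ → ℝ} {ℓ L B : ℝ} (hℓ : 0 ≤ ℓ) (hL : 0 ≤ L) (hB : 0 ≤ B)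
    (hτ : ThreePt ℓ L τ) (hτB : ∀ x, |τ x| ≤ B) {c₀ : ℝ} (hc₀ : 0 ≤ c₀) :
    ∃ ℓ' L' B' : ℝ, 0 ≤ ℓ' ∧ 0 ≤ L' ∧ 0 ≤ B' ∧
      ∀ (c : Fin N → Fin N → Fin N → ℝ) (d : Fin N → Fin N → ℝ), (∀ i j l, |c i j l| ≤ c₀) →
        (∀ i j, |d i j| ≤ c₀) → ThreePt ℓ' L' (truncQuad τ c d) ∧ ∀ x, ‖truncQuad τ c d x‖ ≤ B' := by
  have h1 : ∀ j : Fin N, ThreePt ℓ L (fun x : EuclideanSpace ℝ (Fin N) => τ (x j)) := by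
    intro j
    have h2 : ThreePt 1 0 (fun x : EuclideanSpace ℝ (Fin N) => x j) :=
      { lip := fun a b => by
          rw [one_mul, ← PiLp.sub_apply]
          exact PiLp.norm_apply_le _ _
        three := fun a b c => by
          rw [one_mul, zero_mul, add_zero, ← PiLp.add_apply, ← PiLp.smul_apply, ← PiLp.sub_apply]
          exact PiLp.norm_apply_le _ _ }
    simpa using hτ.comp h2 hℓ hL
  obtain ⟨ℓ₂, hℓ₂⟩ : ∃ x, x = B * (ℓ + ℓ) := ⟨_, rfl⟩
  obtain ⟨L₂, hL₂⟩ : ∃ x, x = B * (L + L) + ℓ * ℓ / 2 := ⟨_, rfl⟩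
  have hℓ₂0 : 0 ≤ ℓ₂ := by rw [hℓ₂]; positivity
  have hL₂0 : 0 ≤ L₂ := by rw [hL₂]; positivity
  have h3 : ∀ j l : Fin N, ThreePt ℓ₂ L₂
      (fun x : EuclideanSpace ℝ (Fin N) => τ (x j) * τ (x l)) := fun j l => by
    rw [hℓ₂, hL₂]
    exact (h1 j).mul (h1 l) hℓ (fun x => hτB _) (fun x => hτB _)
  refine ⟨N * (N * (N * (c₀ * ℓ₂)) + N * (c₀ * ℓ)), N * (N * (N * (c₀ * L₂)) + N * (c₀ * L)),
    N * (N * (N * (c₀ * (B * B))) + N * (c₀ * B)), by positivity, by positivity, by positivity,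
    fun c d hc hd => ⟨?_, fun x => ?_⟩⟩
  · have h4 : ∀ i, ThreePt (N * (N * (c₀ * ℓ₂)) + N * (c₀ * ℓ)) (N * (N * (c₀ * L₂)) + N * (c₀ * L))
        (fun x => truncQuad τ c d x i) := by
      intro i
      have a1 := ThreePt.sum Finset.univ fun j _ => ThreePt.sum Finset.univ fun l _ =>
        ((h3 j l).smul (c i j l)).mono (mul_le_mul_of_nonneg_right (hc i j l) hℓ₂0)
          (mul_le_mul_of_nonneg_right (hc i j l) hL₂0)
      have a2 := ThreePt.sum Finset.univ fun j _ =>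
        ((h1 j).smul (d i j)).mono (mul_le_mul_of_nonneg_right (hd i j) hℓ)
          (mul_le_mul_of_nonneg_right (hd i j) hL)
      simpa [truncQuad] using a1.add a2
    simpa using ThreePt.euclidean h4
  · refine (EuclideanSpace.norm_le_sum _).trans ?_
    have h5 : ∀ i, |truncQuad τ c d x i| ≤ N * (N * (c₀ * (B * B))) + N * (c₀ * B) := by
      intro i
      refine (abs_add_le _ _).trans (add_le_add ?_ ?_)
      · refine (Finset.abs_sum_le_sum_abs _ _).trans ?_
        have : ∀ j ∈ (Finset.univ : Finset (Fin N)), |∑ l, c i j l * (τ (x j) * τ (x l))| ≤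
            N * (c₀ * (B * B)) := by
          intro j _
          refine (Finset.abs_sum_le_sum_abs _ _).trans ?_
          refine (Finset.sum_le_card_nsmul _ _ (c₀ * (B * B)) fun l _ => ?_).trans (by simp)
          rw [abs_mul, abs_mul]
          exact mul_le_mul (hc _ _ _) (mul_le_mul (hτB _) (hτB _) (abs_nonneg _) hB)
            (by positivity) hc₀
        exact (Finset.sum_le_card_nsmul _ _ _ this).trans (by simp)
      · refine (Finset.abs_sum_le_sum_abs _ _).trans ?_
        refine (Finset.sum_le_card_nsmul _ _ (c₀ * B) fun l _ => ?_).trans (by simp)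
        rw [abs_mul]
        exact mul_le_mul (hd _ _) (hτB _) (abs_nonneg _) hc₀
    exact (Finset.sum_le_card_nsmul _ _ _ fun i _ => h5 i).trans (by simp [mul_add])

/-- Under `X i = σ i * x i` the quadratic coefficients are tied to `K`, whereas any linear and
constant terms can be prescribed in the new coordinates. -/
theorem quadField_scaled {K : Fin N → Fin N → Fin N → ℝ} {σ : Fin N → ℝ} (hσ : ∀ i, σ i ≠ 0)
    {k : Fin N → Fin N → Fin N → ℝ} (hk : ∀ i j l, K i j l * σ j * σ l = σ i * k i j l)
    (M : Fin N → Fin N → ℝ) (g x : Fin N → ℝ) (i : Fin N) :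
    quadField K (Matrix.of fun i j => σ i * M i j / σ j) (WithLp.toLp 2 fun i => σ i * g i)
      (WithLp.toLp 2 fun i => σ i * x i) i =
      σ i * ((∑ j, ∑ l, k i j l * (x j * x l)) + ∑ j, M i j * x j + g i) := by
  simp only [quadField, Matrix.of_apply]
  rw [mul_add, mul_add, Finset.mul_sum, Finset.mul_sum]
  congr 2
  · refine Finset.sum_congr rfl fun j _ => ?_
    rw [Finset.mul_sum]
    refine Finset.sum_congr rfl fun l _ => ?_
    calc _ = (K i j l * σ j * σ l) * (x j * x l) := by ring
      _ = _ := by rw [hk]; ring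
  · refine Finset.sum_congr rfl fun j _ => ?_
    have := hσ j
    field_simp

theorem contDiff_quadField (K : Fin N → Fin N → Fin N → ℝ) (M : Matrix (Fin N) (Fin N) ℝ)
    (g : EuclideanSpace ℝ (Fin N)) : ContDiff ℝ 1 (quadField K M g) := by
  refine contDiff_euclidean.2 fun i => ?_
  have hx : ∀ j, ContDiff ℝ 1 fun x : EuclideanSpace ℝ (Fin N) => x j := fun j =>
    (EuclideanSpace.proj (𝕜 := ℝ) j).contDiff
  simp only [quadField]
  refine ContDiff.add (ContDiff.add (ContDiff.sum fun j _ => ContDiff.sum fun l _ => ?_)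
    (ContDiff.sum fun j _ => ?_)) contDiff_const
  · exact (contDiff_const.mul (hx j)).mul (hx l)
  · exact contDiff_const.mul (hx j)

/-- Quadratic coefficients in coordinates scaled by `δ` on `I` and by `δ ρ` off `I`: only the
block mapping `I × I` to the complement of `I` is not small. -/
theorem exists_scaled_coeff (K : Fin N → Fin N → Fin N → ℝ) (I : Finset (Fin N)) {δ ρ : ℝ}
    (hδ : 0 < δ) (hρ : 0 < ρ) (hρ1 : ρ ≤ 1) :
    ∃ c : Fin N → Fin N → Fin N → ℝ, (∀ i j l, |c i j l| ≤ |K i j l|) ∧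
      ∀ i j l, K i j l * (if j ∈ I then δ else δ * ρ) * (if l ∈ I then δ else δ * ρ) =
        (if i ∈ I then δ else δ * ρ) *
          (δ / ρ * (if i ∉ I ∧ j ∈ I ∧ l ∈ I then K i j l else 0) + δ * c i j l) := by
  have key : ∀ i j l, ∃ c : ℝ, |c| ≤ |K i j l| ∧
      K i j l * (if j ∈ I then δ else δ * ρ) * (if l ∈ I then δ else δ * ρ) =
        (if i ∈ I then δ else δ * ρ) *
          (δ / ρ * (if i ∉ I ∧ j ∈ I ∧ l ∈ I then K i j l else 0) + δ * c) := by
    intro i j l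
    have small : ∀ t : ℝ, 0 ≤ t → t ≤ 1 → |K i j l * t| ≤ |K i j l| := fun t h0 h1 => by
      rw [abs_mul, abs_of_nonneg h0]
      exact mul_le_of_le_one_right (abs_nonneg _) h1
    by_cases hi : i ∈ I <;> by_cases hj : j ∈ I <;> by_cases hl : l ∈ I <;>
      simp only [hi, hj, hl, if_true, if_false, not_true, not_false_iff, and_true, and_false,
        mul_zero, zero_add]
    · exact ⟨K i j l, le_rfl, by ring⟩
    · exact ⟨K i j l * ρ, small ρ hρ.le hρ1, by ring⟩
    · exact ⟨K i j l * ρ, small ρ hρ.le hρ1, by ring⟩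
    · exact ⟨K i j l * (ρ * ρ), small _ (by positivity) (by nlinarith), by ring⟩
    · exact ⟨0, by simp, by field_simp; ring⟩
    · exact ⟨K i j l, le_rfl, by ring⟩
    · exact ⟨K i j l, le_rfl, by ring⟩
    · exact ⟨K i j l * ρ, small ρ hρ.le hρ1, by ring⟩
  choose c hc using key
  exact ⟨c, fun i j l => (hc i j l).1, fun i j l => (hc i j l).2⟩

section Merge

variable {n : ℕ}

/-- Insert the coordinates of `q` at the indices `J k` into the vector `w`. -/
noncomputable def mergeCoords (J : Fin n → Fin N) :
    EuclideanSpace ℝ (Fin n) × EuclideanSpace ℝ (Fin N) →L[ℝ] EuclideanSpace ℝ (Fin N) :=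
  open Classical in
  LinearMap.toContinuousLinearMap
    { toFun := fun p => WithLp.toLp 2 fun j =>
        (∑ k, if J k = j then p.1 k else 0) + if j ∈ range J then 0 else p.2 j
      map_add' := fun p p' => by
        ext j
        have h1 : ∀ k, (if J k = j then (p + p').1 k else 0) =
            (if J k = j then p.1 k else 0) + if J k = j then p'.1 k else 0 := fun k => by
          split_ifs <;> simp
        have h2 : (if j ∈ range J then 0 else (p + p').2 j) =
            (if j ∈ range J then 0 else p.2 j) + if j ∈ range J then 0 else p'.2 j := by
          split_ifs <;> simp
        change (∑ k, if J k = j then (p + p').1 k else 0) +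
            (if j ∈ range J then 0 else (p + p').2 j) =
          ((∑ k, if J k = j then p.1 k else 0) + if j ∈ range J then 0 else p.2 j) +
            ((∑ k, if J k = j then p'.1 k else 0) + if j ∈ range J then 0 else p'.2 j)
        rw [Finset.sum_congr rfl fun k _ => h1 k, Finset.sum_add_distrib, h2]
        ring
      map_smul' := fun r p => by
        ext j
        simp [Finset.mul_sum, mul_add] }

theorem mergeCoords_apply_of_range {J : Fin n → Fin N} (hJ : Function.Injective J)
    (p : EuclideanSpace ℝ (Fin n) × EuclideanSpace ℝ (Fin N)) (k : Fin n) :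
    mergeCoords J p (J k) = p.1 k := by
  classical
  simp [mergeCoords, hJ.eq_iff]

theorem mergeCoords_apply_of_notMem {J : Fin n → Fin N}
    (p : EuclideanSpace ℝ (Fin n) × EuclideanSpace ℝ (Fin N)) {j : Fin N} (hj : j ∉ range J) :
    mergeCoords J p j = p.2 j := by
  have hj' : ∀ k, J k ≠ j := fun k hk => hj ⟨k, hk⟩
  simp [mergeCoords, hj']

/-- Coordinatewise multiplication. -/
noncomputable def scaleCoords (σ : Fin N → ℝ) :
    EuclideanSpace ℝ (Fin N) →L[ℝ] EuclideanSpace ℝ (Fin N) :=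
  LinearMap.toContinuousLinearMap
    { toFun := fun x => WithLp.toLp 2 fun j => σ j * x j
      map_add' := fun x y => by ext j; simp [mul_add]
      map_smul' := fun r x => by ext j; simp [mul_left_comm] }

@[simp]
theorem scaleCoords_apply (σ : Fin N → ℝ) (x : EuclideanSpace ℝ (Fin N)) (j : Fin N) :
    scaleCoords σ x j = σ j * x j := rfl

/-- A matrix acting on Euclidean spaces. -/
noncomputable def matrixCLM {m : ℕ} (C : Fin n → Fin m → ℝ) :
    EuclideanSpace ℝ (Fin m) →L[ℝ] EuclideanSpace ℝ (Fin n) :=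
  LinearMap.toContinuousLinearMap
    { toFun := fun x => WithLp.toLp 2 fun k => ∑ j, C k j * x j
      map_add' := fun x y => by ext j; simp [mul_add, Finset.sum_add_distrib]
      map_smul' := fun r x => by ext j; simp [mul_left_comm, Finset.mul_sum] }

@[simp]
theorem matrixCLM_apply {m : ℕ} (C : Fin n → Fin m → ℝ) (x : EuclideanSpace ℝ (Fin m))
    (k : Fin n) : matrixCLM C x k = ∑ j, C k j * x j := rfl

end Merge

theorem exists_inward_rate {n : ℕ} {Q : EuclideanSpace ℝ (Fin n) → EuclideanSpace ℝ (Fin n)}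
    (hQ : ContinuousOn Q (unitBall n)) (hin : ∀ q, ‖q‖ = 1 → ⟪Q q, q⟫ < 0) :
    ∃ c : ℝ, 0 < c ∧ ∀ q, ‖q‖ = 1 → ⟪Q q, q⟫ ≤ -c := by
  rcases (Metric.sphere (0 : EuclideanSpace ℝ (Fin n)) 1).eq_empty_or_nonempty with he | hne
  · refine ⟨1, one_pos, fun q hq => ?_⟩
    have : q ∈ Metric.sphere (0 : EuclideanSpace ℝ (Fin n)) 1 := by simpa using hq
    rw [he] at this
    exact this.elim
  · obtain ⟨x, hx, hmax⟩ := (isCompact_sphere (0 : EuclideanSpace ℝ (Fin n)) 1).exists_isMaxOn hne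
      (f := fun q => ⟪Q q, q⟫)
      ((hQ.mono Metric.sphere_subset_closedBall).inner continuousOn_id)
    refine ⟨-⟪Q x, x⟫, by linarith [hin x (by simpa using hx)], fun q hq => ?_⟩
    rw [neg_neg]
    exact hmax (show q ∈ Metric.sphere (0 : EuclideanSpace ℝ (Fin n)) 1 by simpa using hq)

theorem c1Norm_le {n m : ℕ} {F : EuclideanSpace ℝ (Fin n) → EuclideanSpace ℝ (Fin m)} {a b : ℝ}
    (ha : ∀ q ∈ unitBall n, ‖F q‖ ≤ a)
    (hb : ∀ q ∈ unitBall n, ‖fderivWithin ℝ F (unitBall n) q‖ ≤ b) : c1Norm F ≤ a + b := by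
  have : Nonempty (unitBall n) := ⟨⟨0, by simp⟩⟩
  exact add_le_add (ciSup_le fun q => ha q q.2) (ciSup_le fun q => hb q q.2)

end

/-! ### The decomposition condition and stability of the chain. -/

section

open Filter Topology Set
open scoped RealInnerProductSpace

section Assembly

variable {n N : ℕ} {A : Type*} [Fintype A]

/-- Under the decomposition condition, suitable combinations of the quadratic forms with indices
off `I`, restricted to the variables with indices in `I`, are prescribed bilinear forms. -/
theorem exists_combination_eq_bilinear {K : Fin N → Fin N → Fin N → ℝ} {I : Finset (Fin N)}
    (hI : ∀ b : Fin N → Fin N → ℝ, ∃ u : Fin N → ℝ,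
      ∀ j ∈ I, ∀ l ∈ I, ∑ i ∈ Iᶜ, K i j l * u i = b j l)
    {J : Fin n → Fin N} {α : A → Fin N} (hJ : ∀ k, J k ∈ I) (hα : ∀ a, α a ∈ I)
    (b : Fin n → A → ℝ) :
    ∃ u : Fin N → ℝ, ∀ x : Fin N → ℝ,
      ∑ i ∈ Iᶜ, u i * (∑ j ∈ I, ∑ l ∈ I, K i j l * (x j * x l)) =
        ∑ k, ∑ a, b k a * (x (J k) * x (α a)) := by
  classical
  -- The right-hand side is the coefficient matrix, over `I × I`, of the prescribed bilinear form.
  obtain ⟨u, hu⟩ := hI fun j l => ∑ k, ∑ a, if J k = j then (if α a = l then b k a else 0) else 0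
  refine ⟨u, fun x => ?_⟩
  calc ∑ i ∈ Iᶜ, u i * (∑ j ∈ I, ∑ l ∈ I, K i j l * (x j * x l))
      = ∑ j ∈ I, ∑ l ∈ I, (∑ i ∈ Iᶜ, K i j l * u i) * (x j * x l) := by
        simp only [Finset.mul_sum, Finset.sum_mul]
        rw [Finset.sum_comm]
        refine Finset.sum_congr rfl fun j _ => ?_
        rw [Finset.sum_comm]
        exact Finset.sum_congr rfl fun l _ => Finset.sum_congr rfl fun i _ => by ring
    _ = ∑ j ∈ I, ∑ l ∈ I, ∑ k, ∑ a,
          (if J k = j then (if α a = l then b k a * (x j * x l) else 0) else 0) := by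
        refine Finset.sum_congr rfl fun j hj => Finset.sum_congr rfl fun l hl => ?_
        rw [hu j hj l hl, Finset.sum_mul]
        refine Finset.sum_congr rfl fun k _ => ?_
        rw [Finset.sum_mul]
        refine Finset.sum_congr rfl fun a _ => ?_
        split_ifs <;> simp
    _ = ∑ k, ∑ a, ∑ j ∈ I, ∑ l ∈ I,
          (if J k = j then (if α a = l then b k a * (x j * x l) else 0) else 0) := by
        rw [Finset.sum_congr rfl fun j _ => Finset.sum_comm]
        rw [Finset.sum_comm]
        refine Finset.sum_congr rfl fun k _ => ?_
        rw [Finset.sum_congr rfl fun j _ => Finset.sum_comm]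
        rw [Finset.sum_comm]
    _ = _ := by
        refine Finset.sum_congr rfl fun k _ => Finset.sum_congr rfl fun a _ => ?_
        rw [Finset.sum_eq_single (J k) (fun j _ hj => by simp [hj.symm])
            (fun h => absurd (hJ k) h),
          Finset.sum_eq_single (α a) (fun l _ hl => by simp [hl.symm])
            (fun h => absurd (hα a) h)]
        simp

/-- At an index where `|D|` is largest, the linear term is at most half of that maximum, because `|q
k| ≤ 2` and `4 * s * ∑ |b| ≤ 1`. -/
theorem abs_le_of_small_linear_system {b : A → Fin n → A → ℝ} {D θ : A → ℝ} {q : Fin n → ℝ}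
    {s t : ℝ} (hs : 0 ≤ s) (hq : ∀ k, |q k| ≤ 2) (hb : 4 * s * (∑ a, ∑ k, ∑ a', |b a k a'|) ≤ 1)
    (hD : ∀ a, D a = s * (∑ k, ∑ a', b a k a' * (q k * D a')) + θ a) (hθ : ∀ a, |θ a| ≤ t)
    (a : A) : |D a| ≤ 2 * t := by
  obtain ⟨a₀, -, ha₀⟩ := Finset.exists_max_image Finset.univ (fun a => |D a|) ⟨a, Finset.mem_univ a⟩
  have h1 : |∑ k, ∑ a', b a₀ k a' * (q k * D a')| ≤
      (∑ a, ∑ k, ∑ a', |b a k a'|) * (2 * |D a₀|) := by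
    have h2 : |∑ k, ∑ a', b a₀ k a' * (q k * D a')| ≤
        (∑ k, ∑ a', |b a₀ k a'|) * (2 * |D a₀|) := by
      refine (Finset.abs_sum_le_sum_abs _ _).trans ?_
      rw [Finset.sum_mul]
      refine Finset.sum_le_sum fun k _ => (Finset.abs_sum_le_sum_abs _ _).trans ?_
      rw [Finset.sum_mul]
      refine Finset.sum_le_sum fun a' _ => ?_
      rw [abs_mul, abs_mul]
      exact mul_le_mul_of_nonneg_left
        (mul_le_mul (hq k) (ha₀ a' (Finset.mem_univ _)) (abs_nonneg _) (by norm_num))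
        (abs_nonneg _)
    refine h2.trans (mul_le_mul_of_nonneg_right ?_ (by positivity))
    exact Finset.single_le_sum (f := fun a => ∑ k, ∑ a', |b a k a'|)
      (fun a _ => Finset.sum_nonneg fun k _ => Finset.sum_nonneg fun a' _ => abs_nonneg _)
      (Finset.mem_univ a₀)
  have h3 : |D a₀| ≤ s * ((∑ a, ∑ k, ∑ a', |b a k a'|) * (2 * |D a₀|)) + t := by
    conv_lhs => rw [hD a₀]
    refine (abs_add_le _ _).trans (add_le_add ?_ (hθ a₀))
    rw [abs_mul, abs_of_nonneg hs]
    exact mul_le_mul_of_nonneg_left h1 hs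
  have h4 : |D a| ≤ |D a₀| := ha₀ a (Finset.mem_univ a)
  nlinarith [abs_nonneg (D a₀)]

/-- The block of the quadratic coefficients mapping `I × I` to the complement of `I`. -/
def offBlock (K : Fin N → Fin N → Fin N → ℝ) (I : Finset (Fin N)) (i j l : Fin N) : ℝ :=
  if i ∉ I ∧ j ∈ I ∧ l ∈ I then K i j l else 0

open Classical in
/-- The rows `r a`, restricted to the complement of `I`, placed at the indices `α a`. -/
noncomputable def rowBlock (r : A → Fin N → ℝ) (I : Finset (Fin N)) (α : A → Fin N)
    (i j : Fin N) : ℝ :=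
  if j ∈ I then 0 else ∑ a, if α a = i then r a j else 0

open Classical in
/-- The vector with the coordinates `e a` at the indices `α a`. -/
noncomputable def placeCoords (e : A → ℝ) (α : A → Fin N) : EuclideanSpace ℝ (Fin N) :=
  WithLp.toLp 2 fun i => ∑ a, if α a = i then e a else 0

/-- A vector almost fixed by the fast vector field almost solves the chain equations. -/
theorem abs_sub_chain_le {K : Fin N → Fin N → Fin N → ℝ} {I : Finset (Fin N)}
    {J : Fin n → Fin N} {α : A → Fin N} (hJinj : Function.Injective J)
    (hαinj : Function.Injective α) (hJα : ∀ k a, J k ≠ α a) (hJ : ∀ k, J k ∈ I)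
    (hα : ∀ a, α a ∈ I) {b : A → Fin n → A → ℝ} {r : A → Fin N → ℝ}
    (hr : ∀ (a : A) (x : Fin N → ℝ),
      ∑ i ∈ Iᶜ, r a i * (∑ j ∈ I, ∑ l ∈ I, K i j l * (x j * x l)) =
        ∑ k, ∑ a', b a k a' * (x (J k) * x (α a')))
    {e y : A → ℝ} {κ : ℝ} (hκ : 0 ≤ κ) (hκ1 : κ ≤ 1)
    (hκb : 4 * κ ^ 2 * (∑ a, ∑ k, ∑ a', |b a k a'|) ≤ 1) {q : EuclideanSpace ℝ (Fin n)}
    (hq : ‖q‖ ≤ 2) (hy : ∀ a, y a = e a + κ ^ 2 * ∑ k, ∑ a', b a k a' * (q k * y a'))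
    {τ : ℝ → ℝ} {w : EuclideanSpace ℝ (Fin N)}
    (hτ : ∀ j, τ (mergeCoords J (q, w) j) = mergeCoords J (q, w) j) (a : A) :
    |w (α a) - y a| ≤ 2 * ((1 + ∑ a, ∑ i, |r a i|) * ‖w - (placeCoords e α +
      κ • truncQuad τ (offBlock K I) (rowBlock r I α) (mergeCoords J (q, w)))‖) := by
  classical
  obtain ⟨x, hx⟩ : ∃ x, x = mergeCoords J (q, w) := ⟨_, rfl⟩
  rw [← hx] at hτ ⊢
  obtain ⟨ω, hω⟩ : ∃ ω, ω = w - (placeCoords e α +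
      κ • truncQuad τ (offBlock K I) (rowBlock r I α) x) := ⟨_, rfl⟩
  rw [← hω]
  have hxJ : ∀ k, x (J k) = q k := fun k => by rw [hx, mergeCoords_apply_of_range hJinj]
  have hxα : ∀ a, x (α a) = w (α a) := fun a => by
    rw [hx, mergeCoords_apply_of_notMem _ (by rintro ⟨k, hk⟩; exact hJα k a hk)]
  have hxI : ∀ i, i ∉ I → x i = w i := fun i hi => by
    rw [hx, mergeCoords_apply_of_notMem _ (by rintro ⟨k, rfl⟩; exact hi (hJ k))]
  have hωi : ∀ i, ω i = w i - ((placeCoords e α) i + κ *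
      ((∑ j, ∑ l, offBlock K I i j l * (x j * x l)) + ∑ j, rowBlock r I α i j * x j)) := by
    intro i
    rw [hω]
    simp [truncQuad, hτ]
  -- The two kinds of fast coordinates, up to the residual `ω`: those at `α a` read off linear
  -- combinations of the coordinates off `I`, which in turn (`h2`) read off the quadratic forms in
  -- the coordinates of `I`.
  have h1 : ∀ a, w (α a) = e a + κ * (∑ i ∈ Iᶜ, r a i * w i) + ω (α a) := by
    intro a
    have e1 : placeCoords e α (α a) = e a := by simp [placeCoords, hαinj.eq_iff]
    have e2 : ∀ j l, offBlock K I (α a) j l = 0 := fun j l => by simp [offBlock, hα]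
    have e3 : ∑ j, rowBlock r I α (α a) j * x j = ∑ i ∈ Iᶜ, r a i * w i := by
      rw [← Finset.sum_compl_add_sum I, Finset.sum_eq_zero (s := I), add_zero]
      · refine Finset.sum_congr rfl fun i hi => ?_
        rw [Finset.mem_compl] at hi
        simp [rowBlock, hi, hαinj.eq_iff, hxI]
      · intro j hj
        simp [rowBlock, hj]
    rw [hωi, e1, e3]
    simp only [e2, zero_mul, Finset.sum_const_zero]
    ring
  have h2 : ∀ i ∈ Iᶜ, w i = ω i + κ * ∑ j ∈ I, ∑ l ∈ I, K i j l * (x j * x l) := by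
    intro i hi
    rw [Finset.mem_compl] at hi
    have hne : ∀ a, α a ≠ i := fun a h => hi (h ▸ hα a)
    have e1 : placeCoords e α i = 0 := by simp [placeCoords, hne]
    have e2 : ∀ j, rowBlock r I α i j = 0 := fun j => by simp [rowBlock, hne]
    have e3 : ∑ j, ∑ l, offBlock K I i j l * (x j * x l) =
        ∑ j ∈ I, ∑ l ∈ I, K i j l * (x j * x l) := by
      rw [← Finset.sum_compl_add_sum I, Finset.sum_eq_zero (s := Iᶜ), zero_add]
      · refine Finset.sum_congr rfl fun j hj => ?_
        rw [← Finset.sum_compl_add_sum I, Finset.sum_eq_zero (s := Iᶜ), zero_add]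
        · exact Finset.sum_congr rfl fun l hl => by simp [offBlock, hi, hj, hl]
        · intro l hl
          rw [Finset.mem_compl] at hl
          simp [offBlock, hl]
      · intro j hj
        rw [Finset.mem_compl] at hj
        simp [offBlock, hj]
    rw [hωi, e1, e3]
    simp only [e2, zero_mul, Finset.sum_const_zero]
    ring
  refine abs_le_of_small_linear_system (D := fun a => w (α a) - y a) (s := κ ^ 2) (q := q)
    (b := b) (θ := fun a => ω (α a) + κ * ∑ i ∈ Iᶜ, r a i * ω i) (by positivity)
    (fun k => (PiLp.norm_apply_le q k).trans hq) hκb (fun a => ?_) (fun a => ?_) a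
  -- Eliminating the coordinates off `I` multiplies the two factors `κ`, and `hr` turns the
  -- combination of quadratic forms into the chain's bilinear form; hence `s = κ ^ 2`.
  · have h3 : ∑ i ∈ Iᶜ, r a i * w i =
        (∑ i ∈ Iᶜ, r a i * ω i) + κ * ∑ k, ∑ a', b a k a' * (q k * w (α a')) := by
      have h4 : ∑ k, ∑ a', b a k a' * (q k * w (α a')) =
          ∑ i ∈ Iᶜ, r a i * (∑ j ∈ I, ∑ l ∈ I, K i j l * (x j * x l)) := by
        rw [hr a x]
        simp only [hxJ, hxα]
      rw [h4, Finset.mul_sum, ← Finset.sum_add_distrib]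
      refine Finset.sum_congr rfl fun i hi => ?_
      rw [h2 i hi]
      ring
    have h5 : ∑ k, ∑ a', b a k a' * (q k * (w (α a') - y a')) =
        (∑ k, ∑ a', b a k a' * (q k * w (α a'))) - ∑ k, ∑ a', b a k a' * (q k * y a') := by
      simp only [← Finset.sum_sub_distrib]
      exact Finset.sum_congr rfl fun k _ => Finset.sum_congr rfl fun a' _ => by ring
    change w (α a) - y a = _
    rw [h5, h1 a, h3]
    conv_lhs => rw [hy a]
    ring
  · have h6 : |∑ i ∈ Iᶜ, r a i * ω i| ≤ (∑ a, ∑ i, |r a i|) * ‖ω‖ := by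
      refine (Finset.abs_sum_le_sum_abs _ _).trans ?_
      refine (Finset.sum_le_univ_sum_of_nonneg fun i => abs_nonneg _).trans ?_
      have : ∑ i, |r a i * ω i| ≤ (∑ i, |r a i|) * ‖ω‖ := by
        rw [Finset.sum_mul]
        refine Finset.sum_le_sum fun i _ => ?_
        rw [abs_mul]
        exact mul_le_mul_of_nonneg_left (PiLp.norm_apply_le ω i) (abs_nonneg _)
      refine this.trans (mul_le_mul_of_nonneg_right ?_ (norm_nonneg _))
      exact Finset.single_le_sum (f := fun a => ∑ i, |r a i|)
        (fun a _ => Finset.sum_nonneg fun i _ => abs_nonneg _) (Finset.mem_univ a)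
    refine (abs_add_le _ _).trans ?_
    rw [add_mul, one_mul, abs_mul, abs_of_nonneg hκ]
    refine add_le_add (PiLp.norm_apply_le ω _) ?_
    exact (mul_le_of_le_one_left (abs_nonneg _) hκ1).trans h6

end Assembly

end

/-! ### The quadratic system in slow-fast form. -/

section

open Filter Topology Set
open scoped RealInnerProductSpace

section Realization

variable {n N : ℕ}

/-- The coordinates with indices `J k`. -/
noncomputable def selectCoords (J : Fin n → Fin N) :
    EuclideanSpace ℝ (Fin N) →L[ℝ] EuclideanSpace ℝ (Fin n) :=
  matrixCLM fun k j => if J k = j then 1 else 0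

@[simp]
theorem selectCoords_apply (J : Fin n → Fin N) (x : EuclideanSpace ℝ (Fin N)) (k : Fin n) :
    selectCoords J x k = x (J k) := by
  simp [selectCoords]

/-- The linear and constant terms of a quadratic system can be chosen so that, in scaled
coordinates, the system is a slow-fast system. -/
theorem exists_quadField_eq_slow_fast {K : Fin N → Fin N → Fin N → ℝ} {I : Finset (Fin N)}
    {J : Fin n → Fin N} (hJinj : Function.Injective J) (hJ : ∀ k, J k ∈ I) {σ : Fin N → ℝ}
    (hσ : ∀ i, σ i ≠ 0) {Λ κ : ℝ} (hΛ : Λ ≠ 0) {c : Fin N → Fin N → Fin N → ℝ}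
    (hc : ∀ i j l, K i j l * σ j * σ l = σ i * (Λ * κ * offBlock K I i j l + Λ⁻¹ * c i j l))
    {C : Fin n → Fin N → ℝ} (hC : ∀ k k', C k (J k') = 0) (r : Fin N → Fin N → ℝ)
    (e : EuclideanSpace ℝ (Fin N)) :
    ∃ (M : Matrix (Fin N) (Fin N) ℝ) (g : EuclideanSpace ℝ (Fin N)),
      ∀ (τ : ℝ → ℝ) (q : EuclideanSpace ℝ (Fin n)) (w : EuclideanSpace ℝ (Fin N)),
        (∀ j, τ (mergeCoords J (q, w) j) = mergeCoords J (q, w) j) →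
        quadField K M g (scaleCoords σ (mergeCoords J (q, w))) =
          scaleCoords σ (mergeCoords J
            (matrixCLM C w + Λ⁻¹ • selectCoords J (truncQuad τ c 0 (mergeCoords J (q, w))),
            Λ • (e + κ • truncQuad τ (offBlock K I) r (mergeCoords J (q, w)) +
              Λ⁻¹ • (Λ⁻¹ • truncQuad τ c 0 (mergeCoords J (q, w))) - w))) := by
  classical
  -- In scaled coordinates, the slow rows `J k` carry the readout `C`; the other rows carry the
  -- coupling `Λ κ r` and the damping `-Λ`.
  let M₀ : Fin N → Fin N → ℝ := fun i j => (∑ k, if J k = i then C k j else 0) +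
    if i ∈ range J then 0 else Λ * κ * r i j - if i = j then Λ else 0
  let g₀ : Fin N → ℝ := fun i => if i ∈ range J then 0 else Λ * e i
  refine ⟨Matrix.of fun i j => σ i * M₀ i j / σ j, WithLp.toLp 2 fun i => σ i * g₀ i,
    fun τ q w hτ => ?_⟩
  obtain ⟨x, hx⟩ : ∃ x, x = mergeCoords J (q, w) := ⟨_, rfl⟩
  rw [← hx] at hτ ⊢
  have hx' : ∀ i, i ∉ range J → x i = w i := fun i hi => by
    rw [hx, mergeCoords_apply_of_notMem _ hi]
  ext i
  rw [show scaleCoords σ x = WithLp.toLp 2 fun i => σ i * x i from rfl,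
    quadField_scaled hσ hc M₀ g₀ x i, scaleCoords_apply]
  congr 1
  have hsplit : ∑ j, ∑ l, (Λ * κ * offBlock K I i j l + Λ⁻¹ * c i j l) * (x j * x l) =
      Λ * κ * (∑ j, ∑ l, offBlock K I i j l * (x j * x l)) +
        Λ⁻¹ * ∑ j, ∑ l, c i j l * (x j * x l) := by
    simp only [Finset.mul_sum, ← Finset.sum_add_distrib]
    exact Finset.sum_congr rfl fun j _ => Finset.sum_congr rfl fun l _ => by ring
  rw [hsplit]
  by_cases hi : i ∈ range J
  · obtain ⟨k, rfl⟩ := hi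
    rw [mergeCoords_apply_of_range hJinj]
    have e1 : ∀ j l, offBlock K I (J k) j l = 0 := fun j l => by simp [offBlock, hJ]
    have e2 : ∀ j, M₀ (J k) j = C k j := fun j => by simp [M₀, hJinj.eq_iff]
    have e3 : g₀ (J k) = 0 := by simp [g₀]
    have e4 : ∑ j, C k j * x j = ∑ j, C k j * w j := by
      -- The merged vector `x` has the entries of `q`, not of `w`, at the indices `J`; since `C`
      -- vanishes there, the readout does not see the difference.
      refine Finset.sum_congr rfl fun j _ => ?_
      by_cases hj : j ∈ range J
      · obtain ⟨k', rfl⟩ := hj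
        rw [hC, zero_mul, zero_mul]
      · rw [hx' j hj]
    simp only [e1, e2, e3, e4, zero_mul, Finset.sum_const_zero, mul_zero, zero_add, add_zero]
    simp [truncQuad, hτ]
    ring
  · rw [mergeCoords_apply_of_notMem _ hi]
    have hne : ∀ k, J k ≠ i := fun k hk => hi ⟨k, hk⟩
    have e2 : ∑ j, M₀ i j * x j = Λ * κ * (∑ j, r i j * x j) - Λ * w i := by
      have : ∀ j, M₀ i j * x j = Λ * κ * (r i j * x j) - if i = j then Λ * x j else 0 := by
        intro j
        simp only [M₀, if_neg hi, if_neg (hne _), Finset.sum_const_zero]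
        split_ifs <;> ring
      rw [Finset.sum_congr rfl fun j _ => this j, Finset.sum_sub_distrib, ← Finset.mul_sum,
        Finset.sum_ite_eq, if_pos (Finset.mem_univ _), hx' i hi]
    have e3 : g₀ i = Λ * e i := by simp only [g₀, if_neg hi]
    rw [e2, e3]
    simp [truncQuad, hτ]
    field_simp
    ring

theorem mergeCoords_scale_surjective {J : Fin n → Fin N} (hJinj : Function.Injective J)
    {σ : Fin N → ℝ} (hσ : ∀ i, σ i ≠ 0) :
    Function.Surjective ((scaleCoords σ).comp (mergeCoords J)) := by
  intro X
  refine ⟨(WithLp.toLp 2 fun k => X (J k) / σ (J k), WithLp.toLp 2 fun j => X j / σ j), ?_⟩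
  ext j
  have := hσ j
  rw [ContinuousLinearMap.comp_apply, scaleCoords_apply]
  by_cases hj : j ∈ range J
  · obtain ⟨k, rfl⟩ := hj
    rw [mergeCoords_apply_of_range hJinj]
    field_simp
  · rw [mergeCoords_apply_of_notMem _ hj]
    field_simp

theorem selectCoords_scale_merge {J : Fin n → Fin N} (hJinj : Function.Injective J)
    {σ : Fin N → ℝ} (hσ : ∀ i, σ i ≠ 0)
    (p : EuclideanSpace ℝ (Fin n) × EuclideanSpace ℝ (Fin N)) :
    (selectCoords J).comp (scaleCoords fun i => (σ i)⁻¹)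
      ((scaleCoords σ).comp (mergeCoords J) p) = p.1 := by
  ext k
  have := hσ (J k)
  simp only [ContinuousLinearMap.comp_apply, selectCoords_apply, scaleCoords_apply,
    mergeCoords_apply_of_range hJinj]
  field_simp

theorem abs_mergeCoords_le {J : Fin n → Fin N} (hJinj : Function.Injective J) {R : ℝ}
    {q : EuclideanSpace ℝ (Fin n)} {w : EuclideanSpace ℝ (Fin N)} (hq : ‖q‖ ≤ R) (hw : ‖w‖ ≤ R)
    (j : Fin N) : |mergeCoords J (q, w) j| ≤ R := by
  by_cases hj : j ∈ range J
  · obtain ⟨k, rfl⟩ := hj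
    rw [mergeCoords_apply_of_range hJinj]
    exact (PiLp.norm_apply_le q k).trans hq
  · rw [mergeCoords_apply_of_notMem _ hj]
    exact (PiLp.norm_apply_le w j).trans hw

end Realization

end

/-! ### Choice of parameters and conclusion. -/

section

open Filter Topology Set
open scoped RealInnerProductSpace

section Realization

variable {n N : ℕ}

theorem exists_pos_small {a b c : ℝ} (ha : 0 ≤ a) (hb : 0 ≤ b) (hc : 0 ≤ c) :
    ∃ κ : ℝ, 0 < κ ∧ κ ≤ 1 ∧ κ * a ≤ 1 ∧ κ * b ≤ 1 ∧ κ ^ 2 * c ≤ 1 := by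
  have h : 0 < 1 + a + b + c := by positivity
  have h1 : (1 + a + b + c)⁻¹ * (1 + a + b + c) = 1 := inv_mul_cancel₀ h.ne'
  have h0 : 0 < (1 + a + b + c)⁻¹ := inv_pos.2 h
  have h2 : (1 + a + b + c)⁻¹ ≤ 1 := inv_le_one_of_one_le₀ (by linarith)
  have key : ∀ t, t ≤ 1 + a + b + c → (1 + a + b + c)⁻¹ * t ≤ 1 := fun t ht =>
    (mul_le_mul_of_nonneg_left ht h0.le).trans h1.le
  refine ⟨(1 + a + b + c)⁻¹, h0, h2, key _ (by linarith), key _ (by linarith), ?_⟩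
  refine le_trans ?_ (key c (by linarith))
  exact mul_le_mul_of_nonneg_right (by rw [pow_two]; exact mul_le_of_le_one_left h0.le h2) hc

/-- The order of choices avoids circularity: `r` and the truncation depend on `b` and `e`; then
comes `κ`, then the readout `C` for `s = κ ^ 2`, and finally `Λ`, with the scaling of coordinates
determined by `Λ` and `κ`. -/
theorem exists_epsRealizes_of_near_polyField {K : Fin N → Fin N → Fin N → ℝ} {I : Finset (Fin N)}
    (hI : ∀ b : Fin N → Fin N → ℝ, ∃ u : Fin N → ℝ,
      ∀ j ∈ I, ∀ l ∈ I, ∑ i ∈ Iᶜ, K i j l * u i = b j l)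
    {A : Type*} [Fintype A] {J : Fin n → Fin N} {α : A → Fin N} (hJinj : Function.Injective J)
    (hαinj : Function.Injective α) (hJα : ∀ k a, J k ≠ α a) (hJ : ∀ k, J k ∈ I)
    (hα : ∀ a, α a ∈ I) {p : Fin n → MvPolynomial (Fin n) ℝ} {e : A → ℝ} {b : A → Fin n → A → ℝ}
    (hchain : ∀ s : ℝ, 0 < s →
      ∃ (y : EuclideanSpace ℝ (Fin n) → A → ℝ) (C : Fin n → A → ℝ),
        (∀ q a, y q a = e a + s * ∑ i, ∑ a', b a i a' * (q i * y q a')) ∧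
        ∀ q k, polyField p q k = ∑ a, C k a * y q a)
    {Q : EuclideanSpace ℝ (Fin n) → EuclideanSpace ℝ (Fin n)} (hQ : ContDiffOn ℝ 1 Q (unitBall n))
    {η ε c : ℝ} (hη : 0 < η) (hηε : 4 * η < ε) (hηc : 2 * η < c)
    (hin : ∀ q, ‖q‖ = 1 → ⟪Q q, q⟫ ≤ -c)
    (hp : ∀ q ∈ unitBall n, ‖polyField p q - Q q‖ ≤ η ∧
      ‖fderiv ℝ (polyField p) q - fderivWithin ℝ Q (unitBall n) q‖ ≤ η) :
    ∃ (M : Matrix (Fin N) (Fin N) ℝ) (g : EuclideanSpace ℝ (Fin N)),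
      EpsRealizes ε Q (quadField K M g) := by
  classical
  choose r hr using fun a => exists_combination_eq_bilinear hI hJ hα (b a)
  obtain ⟨d, hd⟩ : ∃ d, d = rowBlock r I α := ⟨_, rfl⟩
  obtain ⟨e', he'⟩ : ∃ e', e' = placeCoords e α := ⟨_, rfl⟩
  -- The fast nonlinearity will be bounded by `‖e'‖ + 1`, the manifold by `‖e'‖ + 2`, and the
  -- attracted neighbourhood has width at most `1`; truncation at `‖e'‖ + 3` is not felt there.
  obtain ⟨τ, ℓτ, Lτ, Bτ, hℓτ, hLτ, hBτ, hτ, hτB, hτid⟩ :=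
    exists_truncation (R := ‖e'‖ + 3) (by positivity)
  obtain ⟨c₀, hc₀⟩ : ∃ c₀, c₀ = (∑ i, ∑ j, ∑ l, |K i j l|) + ∑ i, ∑ j, |d i j| := ⟨_, rfl⟩
  have hK0 : 0 ≤ ∑ i, ∑ j, ∑ l, |K i j l| := by positivity
  have hd0 : 0 ≤ ∑ i, ∑ j, |d i j| := by positivity
  have hKc : ∀ i j l, |K i j l| ≤ c₀ := fun i j l => by
    have h1 := Finset.single_le_sum (f := fun i => ∑ j, ∑ l, |K i j l|)
      (fun i _ => by positivity) (Finset.mem_univ i)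
    have h2 := Finset.single_le_sum (f := fun j => ∑ l, |K i j l|)
      (fun i _ => by positivity) (Finset.mem_univ j)
    have h3 := Finset.single_le_sum (f := fun l => |K i j l|)
      (fun i _ => by positivity) (Finset.mem_univ l)
    linarith
  have hdc : ∀ i j, |d i j| ≤ c₀ := fun i j => by
    have h1 := Finset.single_le_sum (f := fun i => ∑ j, |d i j|)
      (fun i _ => by positivity) (Finset.mem_univ i)
    have h2 := Finset.single_le_sum (f := fun j => |d i j|)
      (fun i _ => by positivity) (Finset.mem_univ j)
    linarith
  have hc₀0 : 0 ≤ c₀ := by rw [hc₀]; positivity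
  obtain ⟨ℓ, L, B, hℓ, hL, hB, hquad⟩ :=
    exists_truncQuad_bounds (N := N) hℓτ hLτ hBτ hτ hτB hc₀0
  obtain ⟨m, hm⟩ : ∃ m, m = ‖mergeCoords (N := N) J‖ := ⟨_, rfl⟩
  have hm0 : 0 ≤ m := by rw [hm]; positivity
  -- The three smallness conditions make the fast nonlinearity a weak contraction (`8 ℓ₀ ≤ 1`),
  -- bound its nonconstant part by `1`, and make the chain equations uniquely and stably solvable.
  obtain ⟨κ, hκ, hκ1, hκℓ, hκB, hκb⟩ := exists_pos_small (a := 8 * (ℓ * m)) (b := B)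
    (c := 4 * ∑ a, ∑ k, ∑ a', |b a k a'|) (by positivity) hB (by positivity)
  obtain ⟨y, C₀, hy, hC₀⟩ := hchain (κ ^ 2) (by positivity)
  obtain ⟨C, hC⟩ : ∃ C : Fin n → Fin N → ℝ, C = fun k j => ∑ a, if α a = j then C₀ k a else 0 :=
    ⟨_, rfl⟩
  have hCJ : ∀ k k', C k (J k') = 0 := fun k k' => by
    rw [hC]; exact Finset.sum_eq_zero fun a _ => if_neg (hJα k' a).symm
  have hCw : ∀ (w : EuclideanSpace ℝ (Fin N)) k, matrixCLM C w k = ∑ a, C₀ k a * w (α a) := by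
    intro w k
    rw [matrixCLM_apply, hC]
    simp only [Finset.sum_mul]
    rw [Finset.sum_comm]
    simp
  have hmerge : ∀ (c' : Fin N → Fin N → Fin N → ℝ) (d' : Fin N → Fin N → ℝ),
      (∀ i j l, |c' i j l| ≤ c₀) → (∀ i j, |d' i j| ≤ c₀) →
      ThreePt (ℓ * m) (L * m ^ 2) (fun p => truncQuad τ c' d' (mergeCoords J p)) ∧
        ∀ p, ‖truncQuad τ c' d' (mergeCoords J p)‖ ≤ B := fun c' d' h1 h2 => by
    obtain ⟨h3, h4⟩ := hquad c' d' h1 h2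
    refine ⟨?_, fun p => h4 _⟩
    have := h3.comp (ThreePt.clm (mergeCoords J)) hℓ hL
    rwa [← hm, mul_zero, zero_add] at this
  obtain ⟨hG1, hG2⟩ := hmerge (offBlock K I) d (fun i j l => by
    unfold offBlock
    split_ifs
    · exact hKc i j l
    · simpa using hc₀0) hdc
  have hG₀ : ThreePt (κ * (ℓ * m)) (κ * (L * m ^ 2))
      (fun p => e' + κ • truncQuad τ (offBlock K I) d (mergeCoords J p)) := by
    have := (ThreePt.const e').add (hG1.smul κ)
    rwa [zero_add, zero_add, abs_of_pos hκ] at this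
  have hB₀ : ∀ p, ‖e' + κ • truncQuad τ (offBlock K I) d (mergeCoords J p)‖ ≤ ‖e'‖ + 1 := by
    intro p
    refine (norm_add_le _ _).trans (add_le_add le_rfl ?_)
    rw [norm_smul, Real.norm_of_nonneg hκ.le]
    exact (mul_le_mul_of_nonneg_left (hG2 p) hκ.le).trans hκB
  have hτm : ∀ (q : EuclideanSpace ℝ (Fin n)) (w : EuclideanSpace ℝ (Fin N)), ‖q‖ ≤ 2 →
      ‖w‖ ≤ ‖e'‖ + 3 → ∀ j, τ (mergeCoords J (q, w) j) = mergeCoords J (q, w) j :=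
    fun q w hq hw j => hτid _ (abs_mergeCoords_le hJinj
      (hq.trans (by linarith [norm_nonneg e'])) hw j)
  obtain ⟨k, hk⟩ : ∃ k, k = (∑ k, ∑ a, |C₀ k a|) * (2 * (1 + ∑ a, ∑ i, |r a i|)) := ⟨_, rfl⟩
  have hk0 : 0 ≤ k := by rw [hk]; positivity
  have hstab : ∀ (q : EuclideanSpace ℝ (Fin n)) (w : EuclideanSpace ℝ (Fin N)), ‖q‖ ≤ 2 →
      ‖w‖ ≤ ‖e'‖ + 1 + 1 → ‖matrixCLM C w - polyField p q‖ ≤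
        k * ‖w - (e' + κ • truncQuad τ (offBlock K I) d (mergeCoords J (q, w)))‖ := by
    intro q w hq hw
    have h1 := abs_sub_chain_le hJinj hαinj hJα hJ hα hr hκ.le hκ1 (by linarith) hq (hy q)
      (hτm q w hq (by linarith))
    rw [← hd, ← he'] at h1
    refine (EuclideanSpace.norm_le_sum _).trans ?_
    rw [hk, mul_assoc, Finset.sum_mul]
    refine Finset.sum_le_sum fun k' _ => ?_
    rw [PiLp.sub_apply, hCw, hC₀, ← Finset.sum_sub_distrib, Finset.sum_mul]
    refine (Finset.abs_sum_le_sum_abs _ _).trans (Finset.sum_le_sum fun a _ => ?_)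
    rw [← mul_sub, abs_mul, mul_assoc]
    exact mul_le_mul_of_nonneg_left (h1 a) (abs_nonneg _)
  obtain ⟨μ, hμ⟩ : ∃ μ, μ = ‖selectCoords (N := N) J‖ := ⟨_, rfl⟩
  have hμ0 : 0 ≤ μ := by rw [hμ]; positivity
  obtain ⟨Λ₁, hΛ₁⟩ := exists_slow_manifold_near (matrixCLM C) hG₀ hB₀ (by positivity)
    (by linarith) (by positivity) (ℓ₁ := (1 + μ) * (ℓ * m)) (L₁ := (1 + μ) * (L * m ^ 2))
    (B₁ := (1 + μ) * B) (by positivity) (by positivity) (by positivity)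
    (contDiff_polyField p) hk0 hstab hη
  -- `Λ ≥ κ⁻¹` ensures `Λ * κ ≥ 1`. The scaling uses `δ = Λ⁻¹` and `ρ = Λ⁻¹ / (Λ * κ) ≤ 1`, so that
  -- `δ / ρ = Λ * κ` is exactly the strength required of the large block.
  obtain ⟨Λ, hΛ⟩ : ∃ Λ, Λ = max Λ₁ κ⁻¹ := ⟨_, rfl⟩
  have hΛκ : κ⁻¹ ≤ Λ := hΛ ▸ le_max_right _ _
  have hκinv : 1 ≤ κ⁻¹ := (one_le_inv₀ hκ).2 hκ1
  have hΛ0 : 0 < Λ := by linarith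
  have hΛκ1 : 1 ≤ Λ * κ := by
    have := mul_le_mul_of_nonneg_right hΛκ hκ.le
    rwa [inv_mul_cancel₀ hκ.ne'] at this
  have hδ1 : Λ⁻¹ ≤ 1 := inv_le_one_of_one_le₀ (by linarith)
  have hδ0 : 0 < Λ⁻¹ := inv_pos.2 hΛ0
  have hρ0 : 0 < Λ⁻¹ / (Λ * κ) := by positivity
  obtain ⟨c', hc'K, hc'⟩ := exists_scaled_coeff K I hδ0 hρ0
    ((div_le_one (by positivity)).2 (hδ1.trans hΛκ1))
  obtain ⟨σ, hσ⟩ : ∃ σ : Fin N → ℝ,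
    σ = fun i => if i ∈ I then Λ⁻¹ else Λ⁻¹ * (Λ⁻¹ / (Λ * κ)) := ⟨_, rfl⟩
  have hσ0 : ∀ i, σ i ≠ 0 := fun i => by
    rw [hσ]
    dsimp only
    split_ifs <;> positivity
  have hρ : Λ⁻¹ / (Λ⁻¹ / (Λ * κ)) = Λ * κ := by field_simp
  have hcσ : ∀ i j l,
      K i j l * σ j * σ l = σ i * (Λ * κ * offBlock K I i j l + Λ⁻¹ * c' i j l) := by
    intro i j l
    have := hc' i j l
    rw [hρ] at this
    rw [hσ]
    exact this
  obtain ⟨M, g, hMg⟩ := exists_quadField_eq_slow_fast hJinj hJ hσ0 hΛ0.ne' hcσ hCJ d e'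
  obtain ⟨hS1, hS2⟩ := hmerge c' 0 (fun i j l => (hc'K i j l).trans (hKc i j l))
    (fun i j => by simpa using hc₀0)
  have hR1 : ThreePt ((1 + μ) * (ℓ * m)) ((1 + μ) * (L * m ^ 2))
      (fun p => selectCoords J (truncQuad τ c' 0 (mergeCoords J p))) := by
    have h1 := (ThreePt.clm (selectCoords J)).comp hS1 (norm_nonneg _) le_rfl
    rw [← hμ, zero_mul, add_zero] at h1
    exact h1.mono (mul_le_mul_of_nonneg_right (by linarith) (by positivity))
      (mul_le_mul_of_nonneg_right (by linarith) (by positivity))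
  have hR2 : ∀ p, ‖selectCoords J (truncQuad τ c' 0 (mergeCoords J p))‖ ≤ (1 + μ) * B := by
    intro p
    refine ((selectCoords J).le_opNorm _).trans ?_
    rw [← hμ]
    exact mul_le_mul (by linarith) (hS2 p) (norm_nonneg _) (by linarith)
  have hS1' : ThreePt ((1 + μ) * (ℓ * m)) ((1 + μ) * (L * m ^ 2))
      (fun p => Λ⁻¹ • truncQuad τ c' 0 (mergeCoords J p)) := by
    refine (hS1.smul Λ⁻¹).mono ?_ ?_ <;> rw [abs_of_pos hδ0]
    · exact mul_le_mul_of_nonneg_right (by linarith) (by positivity)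
    · exact mul_le_mul_of_nonneg_right (by linarith) (by positivity)
  have hS2' : ∀ p, ‖Λ⁻¹ • truncQuad τ c' 0 (mergeCoords J p)‖ ≤ (1 + μ) * B := by
    intro p
    rw [norm_smul, Real.norm_of_nonneg hδ0.le]
    exact mul_le_mul (by linarith) (hS2 p) (norm_nonneg _) (by linarith)
  obtain ⟨ℓF, LF, ℓG, LG, Lh, h, hF, hG, hℓF, hLF, hLh, hG4, hΛF, hh, hhB, hinv, hfP⟩ :=
    hΛ₁ Λ (hΛ ▸ le_max_left _ _) _ _ hR1 hR2 hS1' hS2'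
  obtain ⟨f, hf⟩ : ∃ f : EuclideanSpace ℝ (Fin n) → EuclideanSpace ℝ (Fin n),
      f = fun q => matrixCLM C (h q) + Λ⁻¹ •
        selectCoords J (truncQuad τ c' 0 (mergeCoords J (q, h q))) := ⟨_, rfl⟩
  have hfq : ∀ q, f q = matrixCLM C (h q) + Λ⁻¹ •
        selectCoords J (truncQuad τ c' 0 (mergeCoords J (q, h q))) := fun q => by rw [hf]
  have hfd : Differentiable ℝ f := by
    have h1 : ThreePt 2 Lh (fun q => (q, h q)) := by
      have h1 := ((ThreePt.clm (ContinuousLinearMap.id ℝ (EuclideanSpace ℝ (Fin n)))).mono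
        (ℓ' := 2) (L' := Lh) (ContinuousLinearMap.norm_id_le.trans (by norm_num)) hLh).prodMk hh
      simpa using h1
    have h2 := hF.comp h1 hℓF.le hLF
    rw [hf]
    exact (h2.contDiff (by positivity) (by positivity)).differentiable one_ne_zero
  rw [← hf] at hfP
  simp only [← hfq] at hfP
  have hfQ : ∀ q ∈ unitBall n, ‖f q - Q q‖ ≤ 2 * η := by
    intro q hq
    have h1 := (hfP q (by simpa using hq)).1
    have h2 := (hp q hq).1
    have h3 := norm_add_le (f q - polyField p q) (polyField p q - Q q)
    rw [sub_add_sub_cancel] at h3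
    linarith
  refine ⟨M, g, epsRealizes_of_slow_manifold (contDiff_quadField K M g)
    ((scaleCoords σ).comp (mergeCoords J)) (mergeCoords_scale_surjective hJinj hσ0)
    ((selectCoords J).comp (scaleCoords fun i => (σ i)⁻¹))
    (selectCoords_scale_merge hJinj hσ0) hF hG hℓF hLF hLh hG4 hΛF hh hhB hinv
    (R := ‖e'‖ + 3) (by linarith) (fun q w hq hw => hMg τ q w (hτm q w hq hw))
    (fun q hq => ?_) hQ ?_⟩
  · change ⟪matrixCLM C (h q) + Λ⁻¹ •
        selectCoords J (truncQuad τ c' 0 (mergeCoords J (q, h q))), q⟫ < 0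
    rw [← hfq]
    have h1 := hfQ q (by simpa using hq.le)
    have h2 := real_inner_le_norm (f q - Q q) q
    rw [hq, mul_one, inner_sub_left] at h2
    linarith [hin q hq]
  · change c1Norm (fun q => matrixCLM C (h q) + Λ⁻¹ •
        selectCoords J (truncQuad τ c' 0 (mergeCoords J (q, h q))) - Q q) < ε
    simp only [← hfq]
    refine (c1Norm_le (a := 2 * η) (b := 2 * η) hfQ fun q hq => ?_).trans_lt (by linarith)
    have hu : UniqueDiffWithinAt ℝ (unitBall n) q := uniqueDiffOn_unitBall n q hq
    rw [fderivWithin_fun_sub hu (hfd q).differentiableWithinAt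
      (hQ.differentiableOn one_ne_zero q hq), (hfd q).fderivWithin hu]
    have h1 := (hfP q (by simpa using hq)).2
    have h2 := (hp q hq).2
    have h3 := norm_add_le (fderiv ℝ f q - fderiv ℝ (polyField p) q)
      (fderiv ℝ (polyField p) q - fderivWithin ℝ Q (unitBall n) q)
    rw [sub_add_sub_cancel] at h3
    linarith

end Realization

theorem proposition7p3
    (K : (N : ℕ) → Fin N → Fin N → Fin N → ℝ)
    (hK : ∀ N : ℕ, 6 ≤ N →
      ∃ p : ℕ, (N : ℝ) / 2 < (p : ℝ) ^ 2 + p ∧ p ^ 2 + p ≤ N ∧ PDecomposition p (K N))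
    (n : ℕ) (ε : ℝ) (hε : 0 < ε)
    (Q : EuclideanSpace ℝ (Fin n) → EuclideanSpace ℝ (Fin n))
    (hQ : ContDiffOn ℝ 1 Q (unitBall n))
    (hgrad : (⨆ q : unitBall n, ‖fderivWithin ℝ Q (unitBall n) q‖) < 1)
    (hinward : ∀ q : EuclideanSpace ℝ (Fin n), ‖q‖ = 1 → inner ℝ (Q q) q < 0) :
    ∃ (N : ℕ) (M : Matrix (Fin N) (Fin N) ℝ) (g : EuclideanSpace ℝ (Fin N)),
      EpsRealizes ε Q (quadField (K N) M g) := by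
  obtain ⟨c, hc, hin⟩ := exists_inward_rate hQ.continuousOn hinward
  obtain ⟨η, hη, hηε, hηc⟩ : ∃ η : ℝ, 0 < η ∧ 4 * η < ε ∧ 2 * η < c := by
    refine ⟨min (ε / 8) (c / 8), by positivity, ?_, ?_⟩
    · linarith [min_le_left (ε / 8) (c / 8)]
    · linarith [min_le_right (ε / 8) (c / 8)]
  obtain ⟨p, hp⟩ := exists_polyField_c1_near hQ hη
  obtain ⟨A, _, e, b, hchain⟩ := exists_chain_polyField p
  obtain ⟨d, hd⟩ : ∃ d, d = Fintype.card (Fin n ⊕ A) := ⟨_, rfl⟩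
  -- For this `N` one has `N / 2 = d ^ 2 + d + 3`, so `N / 2 < P ^ 2 + P` forces `P > d`, and `I`
  -- has room for all slow and chain variables.
  obtain ⟨P, hP, -, I, hIcard, hI⟩ := hK (2 * (d ^ 2 + d) + 6) (by omega)
  have hdP : d ≤ P := by
    by_contra! hlt
    have h1 : (P : ℝ) ≤ d := by exact_mod_cast hlt.le
    have h2 : (P : ℝ) ^ 2 ≤ (d : ℝ) ^ 2 := by gcongr
    push_cast at hP
    linarith
  obtain ⟨φ⟩ : Nonempty ((Fin n ⊕ A) ↪ I) := Function.Embedding.nonempty_of_card_le (by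
    rw [Fintype.card_coe, hIcard, ← hd]
    exact hdP)
  have hφ : Function.Injective fun x => (φ x : Fin (2 * (d ^ 2 + d) + 6)) :=
    Subtype.val_injective.comp φ.injective
  exact ⟨_, exists_epsRealizes_of_near_polyField hI (J := fun k => (φ (Sum.inl k) : Fin _))
    (α := fun a => (φ (Sum.inr a) : Fin _)) (hφ.comp Sum.inl_injective)
    (hφ.comp Sum.inr_injective) (fun k a h => Sum.inl_ne_inr (hφ h)) (fun k => (φ _).2)
    (fun a => (φ _).2) hchain hQ hη hηε hηc hin hp⟩

end
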